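/- Fix constants $\gamma,\mu,M,\eta>0$ and $q\in(0,1)$. For each sample size $n$, consider a linear model $y=X\beta^*+\varepsilon$ with $y\in\mathbb R^n$, where the dimension $p$, the vector $\beta^*\in\mathbb R^p$, the positive definite matrix $\Sigma\in\mathbb R^{p\times p}$, the distribution of the noise, the number $K$ and the loss-penalty pairs below may all depend on $n$. Assume $p\le\gamma n$, that the rows $x_1,\dots,x_n$ of $X$ are iid $N(0,\Sigma)$, that the noise vector $\varepsilon$ is independent of $X$ and has a density with respect to Lebesgue measure on $\mathbb R^n$, that $\mathbb E|\varepsilon_i|^{1+q}\le M$ for every $i$ (in particular, $\varepsilon$ may have iid coordinates with a density and this moment bound), and that $\|\Sigma^{1/2}\beta^*\|^2\le M$. For $k=1,\dots,K$ let $\rho_k:\mathbb R\to\mathbb R$ be convex and continuously differentiable with unique minimizer $0$, whose derivative $\psi_k=\rho_k'$ is $1$-Lipschitz with $|\psi_k|\le M$, and let $g_k:\mathbb R^p\to\mathbb R$ be such that $b\mapsto g_k(b)-\frac\mu2 b^\top\Sigma b$ is convex and $g_k(0)=\min_{b}g_k(b)$. Let $$\hat\beta_k=\hat\beta_k(y,X)=\operatorname*{argmin}_{b\in\mathbb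 R^p}\ \frac1n\sum_{i=1}^n\rho_k(y_i-x_i^\top b)+g_k(b),\qquad r_k=y-X\hat\beta_k\in\mathbb R^n.$$ Let $\hat A_k=\hat A_k(y,X)\in\mathbb R^{p\times p}$ be a matrix such that $\|\Sigma^{1/2}\hat A_k\Sigma^{1/2}\|_{op}\le (n\mu)^{-1}$ and, for all $i\le n$ and $j\le p$, $$\frac{\partial\hat\beta_k}{\partial y_i}=\hat A_kX^\top e_i\,\psi_k'(r_{k,i}),\qquad \frac{\partial\hat\beta_k}{\partial x_{ij}}=\hat A_ke_j\,\psi_k(r_{k,i})-\hat A_kX^\top e_i\,\psi_k'(r_{k,i})\,(\hat\beta_k)_j ,$$ at every $(y,X)$ at which $\hat\beta_k$ is differentiable and such a matrix exists (elsewhere $\hat A_k$ is an arbitrary matrix). Let $\hat k\in\operatorname*{argmin}_{k=1,\dots,K}\big\|r_k+\operatorname{tr}[\Sigma\hat A_k]\,\psi_k(r_k)\big\|$, where $\psi_k$ acts coordinatewise. If $K=o(n^{q/(1+q)})$, then as $n\to\infty$ $$\mathbb P\Big(\|\Sigma^{1/2}(\hat\beta_{\hat k}-\beta^*)\|^2>\min_{k=1,\dots,K}\|\Sigma^{1/2}(\hat\beta_k-\beta^*)\|^2+\eta\Big)\to0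 .$$ -/

import Mathlib

open MeasureTheory ProbabilityTheory Filter Topology Asymptotics
open scoped MatrixOrder

noncomputable section

namespace RobustSelection

/-- The data `(y, X)`: a response vector and a design matrix, given by its rows. -/
abbrev Data (n p : ℕ) : Type :=
  EuclideanSpace ℝ (Fin n) × (Fin n → EuclideanSpace ℝ (Fin p))

/-- The matrix `A` acting on vectors of the Euclidean space. -/
abbrev act {p : ℕ} (A : Matrix (Fin p) (Fin p) ℝ) :
    EuclideanSpace ℝ (Fin p) →L[ℝ] EuclideanSpace ℝ (Fin p) :=
  Matrix.toEuclideanCLM (𝕜 := ℝ) A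

/-- The product `X b` of the design matrix with rows `X i` and the vector `b`. -/
def design {n p : ℕ} (X : Fin n → EuclideanSpace ℝ (Fin p)) (b : EuclideanSpace ℝ (Fin p)) :
    EuclideanSpace ℝ (Fin n) :=
  WithLp.toLp 2 fun i => inner ℝ (X i) b

/-- The function `f` applied to each coordinate of the vector `v`. -/
def coordwise {n : ℕ} (f : ℝ → ℝ) (v : EuclideanSpace ℝ (Fin n)) : EuclideanSpace ℝ (Fin n) :=
  WithLp.toLp 2 fun i => f (v i)

/-- The objective `(1/n) ∑ i, ρ (y i - ⟨x i, b⟩) + g b`. -/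
def objective {n p : ℕ} (ρ : ℝ → ℝ) (g : EuclideanSpace ℝ (Fin p) → ℝ) (d : Data n p)
    (b : EuclideanSpace ℝ (Fin p)) : ℝ :=
  (1 / (n : ℝ)) * ∑ i, ρ ((d.1 - design d.2 b) i) + g b

/-- The regularized M-estimator, a minimizer of the objective, as a function of the data
(the minimizer exists and is unique when `g` is strongly convex and `ρ` is convex and minimal
at `0`). -/
def mEstimator {n p : ℕ} (ρ : ℝ → ℝ) (g : EuclideanSpace ℝ (Fin p) → ℝ) (d : Data n p) :
    EuclideanSpace ℝ (Fin p) :=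
  Classical.epsilon fun b => IsMinOn (objective ρ g d) Set.univ b

/-- The residual vector `r = y - X β̂`. -/
def residual {n p : ℕ} (ρ : ℝ → ℝ) (g : EuclideanSpace ℝ (Fin p) → ℝ) (d : Data n p) :
    EuclideanSpace ℝ (Fin n) :=
  d.1 - design d.2 (mEstimator ρ g d)

/-- `A` is a derivative matrix of the M-estimator at the data `d = (y, X)`: the M-estimator is
differentiable there, `‖Σ^{1/2} A Σ^{1/2}‖ ≤ 1 / (n μ)`, and with `ψ = ρ'`
`∂β̂/∂y_i = A Xᵀ e_i ψ'(r_i)` and `∂β̂/∂x_{ij} = A e_j ψ(r_i) - A Xᵀ e_i ψ'(r_i) β̂_j`. -/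
structure IsDerivativeMatrix {n p : ℕ} (μ : ℝ) (S : Matrix (Fin p) (Fin p) ℝ) (ρ : ℝ → ℝ)
    (g : EuclideanSpace ℝ (Fin p) → ℝ) (d : Data n p) (A : Matrix (Fin p) (Fin p) ℝ) :
    Prop where
  differentiableAt : DifferentiableAt ℝ (fun d' : Data n p => mEstimator ρ g d') d
  opNorm_le : ‖act (CFC.sqrt S * A * CFC.sqrt S)‖ ≤ ((n : ℝ) * μ)⁻¹
  deriv_response : ∀ i : Fin n,
    fderiv ℝ (fun d' : Data n p => mEstimator ρ g d') d (EuclideanSpace.single i 1, 0) =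
      deriv (deriv ρ) (residual ρ g d i) • act A (d.2 i)
  deriv_design : ∀ (i : Fin n) (j : Fin p),
    fderiv ℝ (fun d' : Data n p => mEstimator ρ g d') d
        (0, Pi.single i (EuclideanSpace.single j 1)) =
      deriv ρ (residual ρ g d i) • act A (EuclideanSpace.single j 1) -
        (deriv (deriv ρ) (residual ρ g d i) * mEstimator ρ g d j) • act A (d.2 i)

/-- The matrix `Â` at the data `d`: a derivative matrix of the M-estimator, wherever there is one.
It is unique when `ψ(r) ≠ 0`, so that `tr(Σ Â) ψ(r)` does not depend on the choice. -/
def derivativeMatrix {n p : ℕ} (μ : ℝ) (S : Matrix (Fin p) (Fin p) ℝ) (ρ : ℝ → ℝ)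
    (g : EuclideanSpace ℝ (Fin p) → ℝ) (d : Data n p) : Matrix (Fin p) (Fin p) ℝ :=
  Classical.epsilon fun A => IsDerivativeMatrix μ S ρ g d A

/-- The selection criterion `‖r + tr(Σ Â) ψ(r)‖` with `ψ = ρ'`. -/
def criterion {n p : ℕ} (μ : ℝ) (S : Matrix (Fin p) (Fin p) ℝ) (ρ : ℝ → ℝ)
    (g : EuclideanSpace ℝ (Fin p) → ℝ) (d : Data n p) : ℝ :=
  ‖residual ρ g d +
    (S * derivativeMatrix μ S ρ g d).trace • coordwise (deriv ρ) (residual ρ g d)‖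

/-- The out-of-sample error `‖Σ^{1/2} (β̂ - β*)‖²`. -/
def outOfSampleError {n p : ℕ} (S : Matrix (Fin p) (Fin p) ℝ) (βstar : EuclideanSpace ℝ (Fin p))
    (ρ : ℝ → ℝ) (g : EuclideanSpace ℝ (Fin p) → ℝ) (d : Data n p) : ℝ :=
  ‖act (CFC.sqrt S) (mEstimator ρ g d - βstar)‖ ^ 2

/-- A convex, continuously differentiable loss with `0` as unique minimizer, whose derivative is
1-Lipschitz and bounded by `M`. -/
structure IsAdmissibleLoss (M : ℝ) (ρ : ℝ → ℝ) : Prop where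
  convex : ConvexOn ℝ Set.univ ρ
  contDiff : ContDiff ℝ 1 ρ
  unique_min : ∀ u : ℝ, u ≠ 0 → ρ 0 < ρ u
  lipschitz_deriv : LipschitzWith 1 (deriv ρ)
  abs_deriv_le : ∀ u : ℝ, |deriv ρ u| ≤ M

/-- A penalty that is `μ`-strongly convex with respect to `Σ` and minimized at `0`. -/
structure IsAdmissiblePenalty {p : ℕ} (μ : ℝ) (S : Matrix (Fin p) (Fin p) ℝ)
    (g : EuclideanSpace ℝ (Fin p) → ℝ) : Prop where
  strongConvex : ConvexOn ℝ Set.univ fun b => g b - μ / 2 * inner ℝ b (act S b)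
  min_zero : ∀ b, g 0 ≤ g b

/-- The linear model `y = X β* + ε` on a probability space: the rows of `X` are iid `N(0, Σ)` with
`Σ` invertible, and the noise vector `ε` is independent of `X` and has a density. The
coordinates of `ε` have `1 + q` moments bounded by `M`, and `‖Σ^{1/2} β*‖² ≤ M`. -/
structure IsGaussianModel {Ω : Type*} [MeasurableSpace Ω] (P : Measure Ω) {n p : ℕ} (q M : ℝ)
    (S : Matrix (Fin p) (Fin p) ℝ) (βstar : EuclideanSpace ℝ (Fin p))
    (X : Ω → Fin n → EuclideanSpace ℝ (Fin p)) (ε : Ω → EuclideanSpace ℝ (Fin n)) : Prop where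
  posDef : S.PosDef
  row_law : ∀ i, HasLaw (fun ω => X ω i) (multivariateGaussian 0 S) P
  rows_indep : iIndepFun (fun i ω => X ω i) P
  noise_aemeasurable : AEMeasurable ε P
  noise_density : P.map ε ≪ volume
  noise_indep : IndepFun ε X P
  noise_integrable : ∀ i, Integrable (fun ω => |ε ω i| ^ (1 + q)) P
  noise_moment : ∀ i, ∫ ω, |ε ω i| ^ (1 + q) ∂P ≤ M
  signal : ‖act (CFC.sqrt S) βstar‖ ^ 2 ≤ M

/-- The observed data `(X β* + ε, X)` at the outcome `ω`. -/
def observed {Ω : Type*} {n p : ℕ} (βstar : EuclideanSpace ℝ (Fin p))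
    (X : Ω → Fin n → EuclideanSpace ℝ (Fin p)) (ε : Ω → EuclideanSpace ℝ (Fin n)) (ω : Ω) :
    Data n p :=
  (design (X ω) βstar + ε ω, X ω)

end RobustSelection

end

open RobustSelection

/-! ### Product measures: resampling a coordinate and absolute continuity. -/

section ProductMeasures

/-! Write G_i = Σ^{-1/2} x_i for the standardized rows and H = Σ^{1/2}(β̂ - β*) for the standardized
error of one estimator, so that r_i = ε_i - ⟨G_i, H⟩ and the out-of-sample error is ‖H‖². The heart
of the proof is that, for each estimator and with high probability, the squared criterion equals
‖ε‖² + n‖H‖² up to a·n (`measure_criterion_deviation_le`). The term ‖ε‖² is common to all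
candidates, so a minimizer of the criterion nearly minimizes the error; a union bound over the K
candidates finishes.

To see the approximation, fix the noise and regard H as a function of G. The formulas for the
derivatives of β̂ show that tr(ΣÂ)ψ(r_i) is, up to a small term, the divergence of H in the row G_i.
Let H^(i) be H with row i of the design set to zero; it is independent of G_i. The second order
Stein inequality, applied in row i to H - H^(i), bounds the mean square of ⟨G_i, H⟩ - div_i H -
⟨G_i, H^(i)⟩ by three times the means of ‖H - H^(i)‖² and of the squared Frobenius norm of the row
derivative. Both are O(1/n), so the vector of debiased residuals is ε - w + e' with w_i = ⟨G_i,
H^(i)⟩ and E‖e'‖² = O(1).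

It remains to expand ‖ε - w + e'‖². The sum of the w_i² is close to n‖H‖² and ⟨ε, w⟩ has second
moment O(‖ε‖²), because functions centred in their own row and insensitive to the other rows are
almost orthogonal (`integral_sq_sum_mul_le`). Markov's inequality then gives failure probability
O(n^{-1/2} + ‖ε‖²/n²). The moment of order 1 + q yields ‖ε‖² = O(n^{2/(1+q)}) with probability close
to one, and K times the resulting rate tends to zero.

The deterministic input is the strong monotonicity of the optimality conditions
(`strong_monotonicity`). It makes β̂ locally Lipschitz, hence almost everywhere differentiable,
bounds the effect of deleting a row, and in the limit yields the derivative matrix and its operator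
norm bound. Because the score is bounded, the size bound on β̂ involves the design but not the
noise. -/

/-- On a box, the discarded i-th coordinate contributes total mass 1 and the fresh copy contributes
the missing factor. -/
theorem MeasureTheory.measurePreserving_update_pi {ι : Type*} [Fintype ι] [DecidableEq ι]
    {α : ι → Type*} [∀ i, MeasurableSpace (α i)] (μ : ∀ i, Measure (α i))
    [∀ i, IsProbabilityMeasure (μ i)] (i : ι) :
    MeasurePreserving (fun z : (∀ j, α j) × α i => Function.update z.1 i z.2)
      ((Measure.pi μ).prod (μ i)) (Measure.pi μ) := by
  have hmeas : Measurable (fun z : (∀ j, α j) × α i => Function.update z.1 i z.2) :=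
    measurable_update'
  refine ⟨hmeas, ?_⟩
  symm
  refine Measure.pi_eq fun s hs => ?_
  rw [Measure.map_apply hmeas (MeasurableSet.univ_pi hs)]
  have hpre : (fun z : (∀ j, α j) × α i => Function.update z.1 i z.2) ⁻¹' (Set.univ.pi s) =
      (Set.univ.pi (Function.update s i Set.univ)) ×ˢ (s i) := by
    ext ⟨f, x⟩
    simp only [Set.mem_preimage, Set.mem_univ_pi, Set.mem_prod]
    constructor
    · intro h
      refine ⟨fun j => ?_, by simpa using h i⟩
      rcases eq_or_ne j i with rfl | hj
      · simp
      · simpa [hj] using h j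
    · rintro ⟨h1, h2⟩ j
      rcases eq_or_ne j i with rfl | hj
      · simpa using h2
      · simpa [hj] using h1 j
  rw [hpre, Measure.prod_prod, Measure.pi_pi, ← Finset.prod_erase_mul _ _ (Finset.mem_univ i),
    ← Finset.prod_erase_mul (a := i) _ (fun j => μ j (s j)) (Finset.mem_univ i)]
  simp only [Function.update_self, measure_univ, mul_one]
  congr 1
  refine Finset.prod_congr rfl fun j hj => ?_
  rw [Function.update_of_ne (Finset.ne_of_mem_erase hj)]

theorem MeasureTheory.integral_pi_eq_integral_update {ι : Type*} [Fintype ι] [DecidableEq ι]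
    {α : ι → Type*} [∀ i, MeasurableSpace (α i)] (μ : ∀ i, Measure (α i))
    [∀ i, IsProbabilityMeasure (μ i)] (i : ι) {f : (∀ j, α j) → ℝ}
    (hf : Integrable f (Measure.pi μ)) :
    ∫ x, f x ∂Measure.pi μ = ∫ x, ∫ t, f (Function.update x i t) ∂μ i ∂Measure.pi μ := by
  have hmp := measurePreserving_update_pi μ i
  rw [← hmp.map_eq] at hf
  conv_lhs => rw [← hmp.map_eq]
  rw [integral_map hmp.measurable.aemeasurable hf.aestronglyMeasurable,
    integral_prod (fun z : (∀ j, α j) × α i => f (Function.update z.1 i z.2))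
      (hf.comp_measurable hmp.measurable)]

theorem MeasureTheory.lintegral_pi_eq_lintegral_update {ι : Type*} [Fintype ι] [DecidableEq ι]
    {α : ι → Type*} [∀ i, MeasurableSpace (α i)] (μ : ∀ i, Measure (α i))
    [∀ i, IsProbabilityMeasure (μ i)] (i : ι) {f : (∀ j, α j) → ENNReal} (hf : Measurable f) :
    ∫⁻ x, f x ∂Measure.pi μ = ∫⁻ x, ∫⁻ t, f (Function.update x i t) ∂μ i ∂Measure.pi μ := by
  have hmp := measurePreserving_update_pi μ i
  conv_lhs => rw [← hmp.map_eq]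
  rw [lintegral_map hf hmp.measurable,
    lintegral_prod (fun z : (∀ j, α j) × α i => f (Function.update z.1 i z.2))
      (hf.comp hmp.measurable).aemeasurable]

/-- Splitting off one coordinate at a time reduces this to binary products. It transfers
Lebesgue-almost-everywhere statements to Gaussian designs. -/
theorem MeasureTheory.Measure.AbsolutelyContinuous.pi_fin {α : Type*} [MeasurableSpace α]
    {μ ν : Measure α} [SigmaFinite μ] [SigmaFinite ν] (h : μ ≪ ν) (n : ℕ) :
    Measure.pi (fun _ : Fin n => μ) ≪ Measure.pi (fun _ : Fin n => ν) := by
  induction n with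
  | zero =>
    rw [Measure.pi_of_empty (fun _ : Fin 0 => μ) default,
      Measure.pi_of_empty (fun _ : Fin 0 => ν) default]
  | succ n ih =>
    have h1 := (measurePreserving_piFinSuccAbove (fun _ : Fin (n + 1) => μ) 0).symm
    have h2 := (measurePreserving_piFinSuccAbove (fun _ : Fin (n + 1) => ν) 0).symm
    rw [← h1.map_eq, ← h2.map_eq]
    exact (h.prod ih).map (MeasurableEquiv.measurable _)

end ProductMeasures

/-! ### Moments of the standard Gaussian vector. -/

section GaussianMoments

theorem ProbabilityTheory.stdGaussian_absolutelyContinuous (p : ℕ) :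
    stdGaussian (EuclideanSpace ℝ (Fin p)) ≪ volume := by
  rw [← map_pi_eq_stdGaussian,
    ← (PiLp.volume_preserving_toLp (Fin p)).map_eq]
  exact ((gaussianReal_absolutelyContinuous 0 one_ne_zero).pi_fin p).map (by fun_prop)

variable {E : Type*} [NormedAddCommGroup E] [InnerProductSpace ℝ E] [FiniteDimensional ℝ E]
  [MeasurableSpace E] [BorelSpace E]

/-- A linear image of a Gaussian is Gaussian, and mean and variance identify it. Every moment of an
inner product thereby reduces to a one-dimensional one. -/
theorem ProbabilityTheory.stdGaussian_map_inner (a : E) :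
    (stdGaussian E).map (fun x => inner ℝ x a) =
      (gaussianReal 0 1).map (fun t => ‖a‖ * t) := by
  rw [gaussianReal_map_const_mul]
  have : (fun x : E => inner ℝ x a) = (innerSL ℝ a : E →L[ℝ] ℝ) := by
    ext x; simp [real_inner_comm]
  rw [this, IsGaussian.map_eq_gaussianReal, integral_strongDual_stdGaussian,
    variance_dual_stdGaussian, innerSL_apply_norm]
  congr 1
  · simp
  · ext
    simp [Real.toNNReal_of_nonneg]

theorem ProbabilityTheory.integral_comp_inner_stdGaussian (a : E) {φ : ℝ → ℝ}
    (hφ : Continuous φ) :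
    ∫ x, φ (inner ℝ x a) ∂stdGaussian E = ∫ t, φ (‖a‖ * t) ∂gaussianReal 0 1 := by
  rw [← integral_map (φ := fun x : E => inner ℝ x a) (by fun_prop)
    hφ.aestronglyMeasurable, stdGaussian_map_inner,
    integral_map (by fun_prop) hφ.aestronglyMeasurable]

theorem ProbabilityTheory.integral_inner_stdGaussian (a : E) :
    ∫ x, inner ℝ x a ∂stdGaussian E = 0 := by
  rw [integral_comp_inner_stdGaussian a (φ := fun t => t) continuous_id]
  rw [integral_const_mul, integral_id_gaussianReal, mul_zero]

theorem ProbabilityTheory.integral_sq_gaussianReal : ∫ t, t ^ 2 ∂gaussianReal 0 1 = 1 := by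
  have h := variance_fun_id_gaussianReal (μ := 0) (v := 1)
  rw [variance_eq_integral (by fun_prop)] at h
  simpa using h

theorem ProbabilityTheory.integral_inner_sq_stdGaussian (a : E) :
    ∫ x, inner ℝ x a ^ 2 ∂stdGaussian E = ‖a‖ ^ 2 := by
  rw [integral_comp_inner_stdGaussian a (φ := fun t => t ^ 2) (by fun_prop)]
  simp_rw [mul_pow, integral_const_mul, integral_sq_gaussianReal, mul_one]

/-- The fourth moment of the standard normal distribution. -/
noncomputable def ProbabilityTheory.gaussianFourthMoment : ℝ := ∫ t, t ^ 4 ∂gaussianReal 0 1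

theorem ProbabilityTheory.gaussianFourthMoment_nonneg : 0 ≤ gaussianFourthMoment :=
  integral_nonneg fun t => by positivity

theorem ProbabilityTheory.integral_inner_pow_four_stdGaussian (a : E) :
    ∫ x, inner ℝ x a ^ 4 ∂stdGaussian E = gaussianFourthMoment * ‖a‖ ^ 4 := by
  rw [integral_comp_inner_stdGaussian a (φ := fun t => t ^ 4) (by fun_prop)]
  simp_rw [mul_pow, integral_const_mul]
  rw [mul_comm]; rfl

theorem ProbabilityTheory.integrable_norm_pow_stdGaussian (k : ℕ) :
    Integrable (fun x : E => ‖x‖ ^ k) (stdGaussian E) := by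
  rcases Nat.eq_zero_or_pos k with rfl | hk
  · simp
  · exact (IsGaussian.memLp_id (stdGaussian E) k (by simp)).integrable_norm_pow (by lia)

theorem ProbabilityTheory.integrable_of_norm_le_pow_stdGaussian {f : E → ℝ}
    (hf : AEStronglyMeasurable f (stdGaussian E)) (C : ℝ) (k : ℕ)
    (h : ∀ x, |f x| ≤ C * (1 + ‖x‖) ^ k) : Integrable f (stdGaussian E) := by
  have : Integrable (fun x : E => C * (1 + ‖x‖) ^ k) (stdGaussian E) := by
    refine Integrable.const_mul ?_ C
    simp_rw [add_pow]
    refine integrable_finsetSum _ fun i _ => ?_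
    simpa using ((integrable_norm_pow_stdGaussian (E := E) (k - i)).mul_const (k.choose i : ℝ))
  exact this.mono' hf (ae_of_all _ fun x => by simpa using h x)

theorem ProbabilityTheory.integral_norm_sq_stdGaussian (p : ℕ) :
    ∫ x, ‖x‖ ^ 2 ∂stdGaussian (EuclideanSpace ℝ (Fin p)) = p := by
  have h : ∀ x : EuclideanSpace ℝ (Fin p),
      ‖x‖ ^ 2 = ∑ j, inner ℝ x (EuclideanSpace.single j (1 : ℝ)) ^ 2 := by
    intro x
    rw [EuclideanSpace.real_norm_sq_eq]
    refine Finset.sum_congr rfl fun j _ => ?_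
    simp [EuclideanSpace.inner_single_right]
  simp_rw [h]
  rw [integral_finsetSum]
  · simp_rw [integral_inner_sq_stdGaussian]
    simp
  · intro j _
    refine integrable_of_norm_le_pow_stdGaussian (by fun_prop) 1 2 fun x => ?_
    rw [abs_pow, one_mul]
    gcongr
    calc _ ≤ ‖x‖ * ‖EuclideanSpace.single j (1 : ℝ)‖ := abs_real_inner_le_norm _ _
      _ ≤ _ := by simp

/-- Cauchy–Schwarz over the coordinates gives ‖x‖⁴ ≤ p ∑ x_j⁴, so one-dimensional fourth moments
suffice and the order p² is not lost. -/
theorem ProbabilityTheory.integral_norm_pow_four_stdGaussian_le (p : ℕ) :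
    ∫ x, ‖x‖ ^ 4 ∂stdGaussian (EuclideanSpace ℝ (Fin p)) ≤ gaussianFourthMoment * p ^ 2 := by
  have h : ∀ x : EuclideanSpace ℝ (Fin p),
      ‖x‖ ^ 4 ≤ p * ∑ j, inner ℝ x (EuclideanSpace.single j (1 : ℝ)) ^ 4 := by
    intro x
    have h1 : ‖x‖ ^ 4 = (∑ j, x j ^ 2) ^ 2 := by
      rw [← EuclideanSpace.real_norm_sq_eq]; ring
    rw [h1]
    refine (sq_sum_le_card_mul_sum_sq).trans (le_of_eq ?_)
    simp only [Finset.card_univ, Fintype.card_fin]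
    congr 1
    refine Finset.sum_congr rfl fun j _ => ?_
    simp [EuclideanSpace.inner_single_right]
    ring
  have hint : ∀ j, Integrable (fun x : EuclideanSpace ℝ (Fin p) =>
      inner ℝ x (EuclideanSpace.single j (1 : ℝ)) ^ 4)
      (stdGaussian (EuclideanSpace ℝ (Fin p))) := by
    intro j
    refine integrable_of_norm_le_pow_stdGaussian (by fun_prop) 1 4 fun x => ?_
    rw [abs_pow, one_mul]
    gcongr
    calc _ ≤ ‖x‖ * ‖EuclideanSpace.single j (1 : ℝ)‖ := abs_real_inner_le_norm _ _
      _ ≤ _ := by simp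
  calc _ ≤ ∫ x, p * ∑ j, inner ℝ x (EuclideanSpace.single j (1 : ℝ)) ^ 4
          ∂stdGaussian (EuclideanSpace ℝ (Fin p)) :=
        integral_mono (integrable_norm_pow_stdGaussian 4)
          ((integrable_finsetSum _ fun j _ => hint j).const_mul _) h
    _ = _ := by
        rw [integral_const_mul, integral_finsetSum _ fun j _ => hint j]
        simp_rw [integral_inner_pow_four_stdGaussian]
        simp
        ring

end GaussianMoments

/-! ### Gaussian integration by parts and the second order Stein inequality for smooth fields. -/

section SteinIdentity

/-- Times the Gaussian density φ, the integrand is the exact derivative of -φu. The bounds on u and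
u' only serve integrability. -/
theorem ProbabilityTheory.integral_mul_sub_deriv_gaussianReal {u u' : ℝ → ℝ}
    (hu : ∀ t, HasDerivAt u (u' t) t) (hu' : Continuous u') {C : ℝ}
    (hC : ∀ t, |u t| ≤ C) (hC' : ∀ t, |u' t| ≤ C) :
    ∫ t, (t * u t - u' t) ∂gaussianReal 0 1 = 0 := by
  have hu_cont : Continuous u := continuous_iff_continuousAt.2 fun t => (hu t).continuousAt
  have hpdf : gaussianPDFReal 0 1 = fun t => (√(2 * Real.pi))⁻¹ * Real.exp (-t ^ 2 / 2) := by
    rw [gaussianPDFReal_def]; simp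
  have hpdf_deriv : ∀ t, HasDerivAt (gaussianPDFReal 0 1) (-t * gaussianPDFReal 0 1 t) t := by
    intro t
    rw [hpdf]
    have h1 : HasDerivAt (fun t : ℝ => -t ^ 2 / 2) (-t) t := by
      convert! ((hasDerivAt_pow 2 t).neg.div_const 2) using 1
      simp
      ring
    convert! (h1.exp.const_mul _) using 1
    ring
  have hpdf_cont : Continuous (gaussianPDFReal 0 1) := by rw [hpdf]; fun_prop
  have hint : ∀ {f : ℝ → ℝ}, Integrable f (gaussianReal 0 1) →
      Integrable (fun t => gaussianPDFReal 0 1 t * f t) := by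
    intro f hf
    rw [gaussianReal_of_var_ne_zero 0 one_ne_zero, integrable_withDensity_iff_integrable_smul'
      (measurable_gaussianPDF 0 1) (ae_of_all _ fun _ => gaussianPDF_lt_top)] at hf
    simpa using hf
  have hi1 : Integrable u (gaussianReal 0 1) :=
    (integrable_const C).mono' hu_cont.aestronglyMeasurable (ae_of_all _ hC)
  have hi2 : Integrable (fun t => t * u t - u' t) (gaussianReal 0 1) := by
    refine Integrable.sub ?_ ((integrable_const C).mono' hu'.aestronglyMeasurable (ae_of_all _ hC'))
    have : Integrable (fun t : ℝ => |t| * C) (gaussianReal 0 1) :=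
      (((memLp_id_gaussianReal 1).integrable le_rfl).abs).mul_const C
    refine this.mono' (by fun_prop) (ae_of_all _ fun t => ?_)
    rw [Real.norm_eq_abs, abs_mul]
    exact mul_le_mul_of_nonneg_left (hC t) (abs_nonneg t)
  rw [integral_gaussianReal_eq_integral_smul one_ne_zero]
  have key := integral_eq_zero_of_hasDerivAt_of_integrable
    (f := fun t => -(gaussianPDFReal 0 1 t * u t))
    (f' := fun t => gaussianPDFReal 0 1 t * (t * u t - u' t))
    (fun t => by
      convert! ((hpdf_deriv t).mul (hu t)).neg using 1
      ring) (hint hi2) (hint hi1).neg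
  simpa using key

variable {p : ℕ}

/-- The partial derivative of `u` in the direction of the `j`-th basis vector. -/
noncomputable def EuclideanSpace.partialDeriv (j : Fin p) (u : EuclideanSpace ℝ (Fin p) → ℝ)
    (x : EuclideanSpace ℝ (Fin p)) : ℝ :=
  fderiv ℝ u x (EuclideanSpace.single j 1)

/-- The adjoint of the `j`-th partial derivative with respect to the standard Gaussian. -/
noncomputable def EuclideanSpace.gaussianAdjoint (j : Fin p) (u : EuclideanSpace ℝ (Fin p) → ℝ)
    (x : EuclideanSpace ℝ (Fin p)) : ℝ :=
  x j * u x - EuclideanSpace.partialDeriv j u x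

open EuclideanSpace

theorem EuclideanSpace.continuous_partialDeriv {u : EuclideanSpace ℝ (Fin p) → ℝ}
    (hu : ContDiff ℝ 1 u) (j : Fin p) : Continuous (partialDeriv j u) :=
  (hu.continuous_fderiv one_ne_zero).clm_apply continuous_const

theorem EuclideanSpace.contDiff_partialDeriv {u : EuclideanSpace ℝ (Fin p) → ℝ}
    (hu : ContDiff ℝ 2 u) (j : Fin p) : ContDiff ℝ 1 (partialDeriv j u) :=
  (hu.fderiv_right (m := 1) (by norm_num)).clm_apply contDiff_const

theorem EuclideanSpace.hasCompactSupport_partialDeriv {u : EuclideanSpace ℝ (Fin p) → ℝ}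
    (hu : HasCompactSupport u) (j : Fin p) : HasCompactSupport (partialDeriv j u) :=
  hu.fderiv_apply ℝ _

theorem EuclideanSpace.hasCompactSupport_gaussianAdjoint {u : EuclideanSpace ℝ (Fin p) → ℝ}
    (hu : HasCompactSupport u) (j : Fin p) : HasCompactSupport (gaussianAdjoint j u) :=
  HasCompactSupport.sub (hu.mul_left) (hasCompactSupport_partialDeriv hu j)

theorem EuclideanSpace.contDiff_gaussianAdjoint {u : EuclideanSpace ℝ (Fin p) → ℝ}
    (hu : ContDiff ℝ 2 u) (j : Fin p) : ContDiff ℝ 1 (gaussianAdjoint j u) := by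
  have h := contDiff_partialDeriv hu j
  have h' : ContDiff ℝ 1 u := hu.of_le (by norm_num)
  unfold gaussianAdjoint
  fun_prop

/-- With the other coordinates frozen, coordinate j sees the one-dimensional identity along a line
in direction e_j. -/
theorem EuclideanSpace.integral_gaussianAdjoint {u : EuclideanSpace ℝ (Fin p) → ℝ}
    (hu : ContDiff ℝ 1 u) (hc : HasCompactSupport u) (j : Fin p) :
    ∫ x, gaussianAdjoint j u x ∂stdGaussian (EuclideanSpace ℝ (Fin p)) = 0 := by
  have hcd : Continuous (partialDeriv j u) := continuous_partialDeriv hu j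
  have hcont : Continuous (gaussianAdjoint j u) := by
    have := hu.continuous
    unfold gaussianAdjoint
    fun_prop
  have hint : Integrable (gaussianAdjoint j u) (stdGaussian (EuclideanSpace ℝ (Fin p))) :=
    hcont.integrable_of_hasCompactSupport (hasCompactSupport_gaussianAdjoint hc j)
  obtain ⟨C₁, hC₁⟩ := hc.exists_bound_of_continuous hu.continuous
  obtain ⟨C₂, hC₂⟩ := (hasCompactSupport_partialDeriv hc j).exists_bound_of_continuous hcd
  rw [← map_pi_eq_stdGaussian] at hint ⊢
  have hm : Measurable (WithLp.toLp 2 : (Fin p → ℝ) → EuclideanSpace ℝ (Fin p)) := by fun_prop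
  rw [integral_map hm.aemeasurable hcont.aestronglyMeasurable,
    integral_pi_eq_integral_update (f := fun x => gaussianAdjoint j u (WithLp.toLp 2 x)) _ j
      (hint.comp_measurable hm)]
  refine integral_eq_zero_of_ae (ae_of_all _ fun x => ?_)
  have hline : ∀ t : ℝ, HasDerivAt
      (fun t : ℝ => (WithLp.toLp 2 (Function.update x j t) : EuclideanSpace ℝ (Fin p)))
      (EuclideanSpace.single j 1) t := by
    intro t
    have h1 : (fun t : ℝ => (WithLp.toLp 2 (Function.update x j t) : EuclideanSpace ℝ (Fin p))) =
        fun t => WithLp.toLp 2 x + (t - x j) • EuclideanSpace.single j (1 : ℝ) := by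
      ext t i
      rcases eq_or_ne i j with rfl | h
      · simp
      · simp [h]
    rw [h1]
    simpa using (((hasDerivAt_id t).sub_const (x j)).smul_const
      (EuclideanSpace.single j (1 : ℝ))).const_add (WithLp.toLp 2 x)
  have hline_cont : Continuous
      (fun t : ℝ => (WithLp.toLp 2 (Function.update x j t) : EuclideanSpace ℝ (Fin p))) :=
    continuous_iff_continuousAt.2 fun t => (hline t).continuousAt
  have := integral_mul_sub_deriv_gaussianReal
    (u := fun t => u (WithLp.toLp 2 (Function.update x j t)))
    (u' := fun t => partialDeriv j u (WithLp.toLp 2 (Function.update x j t)))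
    (fun t => ((hu.differentiable one_ne_zero _).hasFDerivAt.comp_hasDerivAt t (hline t)))
    (hcd.comp hline_cont) (C := max C₁ C₂) (fun t => (hC₁ _).trans (le_max_left _ _))
    (fun t => (hC₂ _).trans (le_max_right _ _))
  simpa [gaussianAdjoint] using this

/-- The previous identity applied to the product uv, with Leibniz' rule. Compact support of one
factor is enough. -/
theorem EuclideanSpace.integral_gaussianAdjoint_mul {u v : EuclideanSpace ℝ (Fin p) → ℝ}
    (hu : ContDiff ℝ 1 u) (hv : ContDiff ℝ 1 v) (hc : HasCompactSupport u) (j : Fin p) :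
    ∫ x, gaussianAdjoint j u x * v x ∂stdGaussian (EuclideanSpace ℝ (Fin p)) =
      ∫ x, u x * partialDeriv j v x ∂stdGaussian (EuclideanSpace ℝ (Fin p)) := by
  have h := integral_gaussianAdjoint (hu.mul hv) (hc.mul_right (f' := v)) j
  have heq : ∀ x, gaussianAdjoint j (fun y => u y * v y) x =
      gaussianAdjoint j u x * v x - u x * partialDeriv j v x := by
    intro x
    simp only [gaussianAdjoint, partialDeriv]
    rw [fderiv_fun_mul (hu.differentiable one_ne_zero x) (hv.differentiable one_ne_zero x)]
    simp
    ring
  simp_rw [heq] at h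
  have hvc := hv.continuous
  have huc := hu.continuous
  have hcu := continuous_partialDeriv hu j
  have hcv := continuous_partialDeriv hv j
  rw [integral_sub, sub_eq_zero] at h
  · exact h
  · refine Continuous.integrable_of_hasCompactSupport ?_
      ((hasCompactSupport_gaussianAdjoint hc j).mul_right)
    unfold gaussianAdjoint
    fun_prop
  · exact Continuous.integrable_of_hasCompactSupport (by fun_prop) hc.mul_right

/-- This is the commutation relation between ∂_j and the adjoint of ∂_k: their commutator is the
Kronecker delta. The remaining terms match by symmetry of the second derivative. -/
theorem EuclideanSpace.partialDeriv_gaussianAdjoint {u : EuclideanSpace ℝ (Fin p) → ℝ}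
    (hu : ContDiff ℝ 2 u) (j k : Fin p) (x : EuclideanSpace ℝ (Fin p)) :
    partialDeriv j (gaussianAdjoint k u) x =
      (if j = k then u x else 0) + gaussianAdjoint k (partialDeriv j u) x := by
  have hd : Differentiable ℝ u := hu.differentiable (by norm_num)
  have hd' : Differentiable ℝ (partialDeriv k u) :=
    (contDiff_partialDeriv hu k).differentiable one_ne_zero
  have hp : HasFDerivAt (fun y : EuclideanSpace ℝ (Fin p) => y k)
      (EuclideanSpace.proj k : EuclideanSpace ℝ (Fin p) →L[ℝ] ℝ) x :=
    (EuclideanSpace.proj k : EuclideanSpace ℝ (Fin p) →L[ℝ] ℝ).hasFDerivAt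
  have h1 : HasFDerivAt (fun y => y k * u y - partialDeriv k u y) _ x :=
    (hp.mul (hd x).hasFDerivAt).sub (hd' x).hasFDerivAt
  have hsymm : partialDeriv j (partialDeriv k u) x = partialDeriv k (partialDeriv j u) x := by
    have hdd : DifferentiableAt ℝ (fderiv ℝ u) x :=
      (hu.fderiv_right (m := 1) (by norm_num)).differentiable one_ne_zero x
    have hgen : ∀ a b : Fin p, partialDeriv a (partialDeriv b u) x =
        fderiv ℝ (fderiv ℝ u) x (EuclideanSpace.single a 1) (EuclideanSpace.single b 1) := by
      intro a b
      have h2 := hdd.hasFDerivAt.clm_apply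
        (hasFDerivAt_const (EuclideanSpace.single b (1 : ℝ)) x)
      change fderiv ℝ (fun y => fderiv ℝ u y (EuclideanSpace.single b 1)) x
        (EuclideanSpace.single a 1) = _
      rw [h2.fderiv]
      simp
    rw [hgen, hgen]
    exact (hu.contDiffAt.isSymmSndFDerivAt (by simp)) _ _
  change fderiv ℝ (fun y => y k * u y - partialDeriv k u y) x (EuclideanSpace.single j 1) = _
  rw [HasFDerivAt.fderiv h1]
  simp only [sub_apply, add_apply, smul_apply, smul_eq_mul, PiLp.proj_apply]
  change _ - partialDeriv j (partialDeriv k u) x = _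
  rw [hsymm]
  simp only [gaussianAdjoint, partialDeriv]
  rcases eq_or_ne j k with rfl | h
  · simp; ring
  · simp [h, h.symm]

/-- Expand the square and move both adjoints across with the commutation relation: the (j, k) term
becomes the mean of δ_jk f_j f_k + ∂_k f_j ∂_j f_k. The second part sums to the trace of the squared
Jacobian, which is at most its squared Frobenius norm. -/
theorem EuclideanSpace.integral_sq_gaussianDivergence_le_of_contDiff
    {f : Fin p → EuclideanSpace ℝ (Fin p) → ℝ}
    (hf : ∀ j, ContDiff ℝ 2 (f j)) (hc : ∀ j, HasCompactSupport (f j)) :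
    ∫ x, (∑ j, gaussianAdjoint j (f j) x) ^ 2 ∂stdGaussian (EuclideanSpace ℝ (Fin p)) ≤
      ∫ x, (∑ j, f j x ^ 2 + ∑ j, ∑ k, partialDeriv k (f j) x ^ 2)
        ∂stdGaussian (EuclideanSpace ℝ (Fin p)) := by
  set γ := stdGaussian (EuclideanSpace ℝ (Fin p))
  have hf1 : ∀ j, ContDiff ℝ 1 (f j) := fun j => (hf j).of_le (by norm_num)
  have hcf : ∀ j, Continuous (f j) := fun j => (hf j).continuous
  have hcd : ∀ j k, Continuous (partialDeriv j (f k)) := fun j k =>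
    continuous_partialDeriv (hf1 k) j
  have hcδ : ∀ j, Continuous (gaussianAdjoint j (f j)) := fun j =>
    (contDiff_gaussianAdjoint (hf j) j).continuous
  have hterm : ∀ j k, ∫ x, gaussianAdjoint j (f j) x * gaussianAdjoint k (f k) x ∂γ =
      ∫ x, ((if j = k then f j x * f k x else 0) +
        partialDeriv k (f j) x * partialDeriv j (f k) x) ∂γ := by
    intro j k
    rw [integral_gaussianAdjoint_mul (hf1 j) (contDiff_gaussianAdjoint (hf k) k) (hc j)]
    have h1 : ∀ x, f j x * partialDeriv j (gaussianAdjoint k (f k)) x =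
        (if j = k then f j x * f k x else 0) +
          gaussianAdjoint k (partialDeriv j (f k)) x * f j x := by
      intro x
      rw [partialDeriv_gaussianAdjoint (hf k)]
      split_ifs <;> ring
    simp_rw [h1]
    have hi1 : Integrable (fun x => if j = k then f j x * f k x else 0) γ := by
      split_ifs
      · exact Continuous.integrable_of_hasCompactSupport (by fun_prop) (hc j).mul_right
      · simp
    have hcp := hasCompactSupport_partialDeriv (hc k) j
    have hdp := contDiff_partialDeriv (hf k) j
    rw [integral_add hi1, integral_add hi1,
      integral_gaussianAdjoint_mul hdp (hf1 j) hcp k]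
    · simp_rw [mul_comm]
      rfl
    · exact Continuous.integrable_of_hasCompactSupport (by fun_prop)
        (hasCompactSupport_partialDeriv (hc j) k).mul_right
    · refine Continuous.integrable_of_hasCompactSupport ?_
        (hasCompactSupport_gaussianAdjoint hcp k).mul_right
      have := continuous_partialDeriv hdp k
      unfold gaussianAdjoint
      fun_prop
  have hi : ∀ j k, Integrable (fun x => (if j = k then f j x * f k x else 0) +
        partialDeriv k (f j) x * partialDeriv j (f k) x) γ := by
    intro j k
    refine Integrable.add ?_ (Continuous.integrable_of_hasCompactSupport (by fun_prop)
        (hasCompactSupport_partialDeriv (hc j) k).mul_right)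
    split_ifs
    · exact Continuous.integrable_of_hasCompactSupport (by fun_prop) (hc j).mul_right
    · simp
  have hexp : ∀ x, (∑ j, gaussianAdjoint j (f j) x) ^ 2 =
      ∑ j, ∑ k, gaussianAdjoint j (f j) x * gaussianAdjoint k (f k) x := by
    intro x; rw [sq, Finset.sum_mul_sum]
  have hiδ : ∀ j k, Integrable
      (fun x => gaussianAdjoint j (f j) x * gaussianAdjoint k (f k) x) γ := fun j k =>
    Continuous.integrable_of_hasCompactSupport ((hcδ j).mul (hcδ k))
      (hasCompactSupport_gaussianAdjoint (hc j) j).mul_right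
  simp_rw [hexp]
  rw [integral_finsetSum _ fun j _ => integrable_finsetSum _ fun k _ => hiδ j k]
  simp_rw [integral_finsetSum _ fun k _ => hiδ _ k, hterm]
  simp_rw [← integral_finsetSum Finset.univ fun k _ => hi _ k]
  rw [← integral_finsetSum _ fun j _ => integrable_finsetSum _ fun k _ => hi j k]
  refine integral_mono (integrable_finsetSum _ fun j _ => integrable_finsetSum _ fun k _ => hi j k)
    ?_ fun x => ?_
  · refine Integrable.add (integrable_finsetSum _ fun j _ => ?_)
      (integrable_finsetSum _ fun j _ => integrable_finsetSum _ fun k _ => ?_)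
    · simp_rw [sq]
      exact Continuous.integrable_of_hasCompactSupport (by fun_prop) (hc j).mul_right
    · simp_rw [sq]
      exact Continuous.integrable_of_hasCompactSupport (by fun_prop)
        (hasCompactSupport_partialDeriv (hc j) k).mul_right
  · simp only [Finset.sum_add_distrib, Finset.sum_ite_eq, Finset.mem_univ, if_true, sq]
    refine add_le_add le_rfl ?_
    have hab : ∀ j k, partialDeriv k (f j) x * partialDeriv j (f k) x ≤
        (partialDeriv k (f j) x * partialDeriv k (f j) x) / 2 +
          (partialDeriv j (f k) x * partialDeriv j (f k) x) / 2 := fun j k => by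
      nlinarith [sq_nonneg (partialDeriv k (f j) x - partialDeriv j (f k) x)]
    calc _ ≤ ∑ j, ∑ k, ((partialDeriv k (f j) x * partialDeriv k (f j) x) / 2 +
          (partialDeriv j (f k) x * partialDeriv j (f k) x) / 2) :=
          Finset.sum_le_sum fun j _ => Finset.sum_le_sum fun k _ => hab j k
      _ = _ := by
        simp only [Finset.sum_add_distrib]
        rw [Finset.sum_comm (f := fun j k => partialDeriv j (f k) x * partialDeriv j (f k) x / 2)]
        simp only [← Finset.sum_div]
        ring

end SteinIdentity

/-! ### Extension of the inequality to Lipschitz fields. -/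

section Mollification

open EuclideanSpace
open scoped Convolution NNReal

variable {p : ℕ}

theorem EuclideanSpace.measurable_partialDeriv (j : Fin p) (u : EuclideanSpace ℝ (Fin p) → ℝ) :
    Measurable (partialDeriv j u) :=
  measurable_fderiv_apply_const ℝ u _

theorem EuclideanSpace.abs_partialDeriv_le_of_lipschitzWith {u : EuclideanSpace ℝ (Fin p) → ℝ}
    {C : ℝ≥0} (hu : LipschitzWith C u) (j : Fin p) (x : EuclideanSpace ℝ (Fin p)) :
    |partialDeriv j u x| ≤ C := by
  have h := (fderiv ℝ u x).le_of_opNorm_le (norm_fderiv_le_of_lipschitz ℝ hu)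
    (EuclideanSpace.single j (1 : ℝ))
  simpa [partialDeriv] using h

theorem ContDiffBump.abs_normed_convolution_le {E : Type*} [NormedAddCommGroup E]
    [InnerProductSpace ℝ E] [FiniteDimensional ℝ E] [MeasurableSpace E] [BorelSpace E]
    (φ : ContDiffBump (0 : E)) {h : E → ℝ} {D : ℝ} (hD : ∀ x, |h x| ≤ D) (x : E) :
    |(φ.normed volume ⋆[ContinuousLinearMap.lsmul ℝ ℝ, volume] h) x| ≤ D := by
  rw [convolution_def, ← Real.norm_eq_abs]
  have hint : Integrable (fun t => φ.normed volume t * D) volume :=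
    φ.integrable_normed.mul_const D
  refine (norm_integral_le_of_norm_le hint (ae_of_all _ fun t => ?_)).trans ?_
  · simp only [ContinuousLinearMap.lsmul_apply, smul_eq_mul, norm_mul, Real.norm_eq_abs,
      abs_of_nonneg (φ.nonneg_normed t)]
    exact mul_le_mul_of_nonneg_left (hD _) (φ.nonneg_normed t)
  · rw [integral_mul_const, φ.integral_normed, one_mul]

/-- The derivative is placed on the Lipschitz factor, not on the bump: u is differentiable almost
everywhere and its difference quotients are dominated by the Lipschitz constant. In this form the
derivatives of mollifications stay bounded and converge almost everywhere. -/
theorem EuclideanSpace.partialDeriv_normed_convolution (φ : ContDiffBump (0 : EuclideanSpace ℝ (Fin p)))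
    {u : EuclideanSpace ℝ (Fin p) → ℝ} {C : ℝ≥0} (hu : LipschitzWith C u) (j : Fin p)
    (x : EuclideanSpace ℝ (Fin p)) :
    partialDeriv j (φ.normed volume ⋆[ContinuousLinearMap.lsmul ℝ ℝ, volume] u) x =
      (φ.normed volume ⋆[ContinuousLinearMap.lsmul ℝ ℝ, volume] partialDeriv j u) x := by
  set e : EuclideanSpace ℝ (Fin p) := EuclideanSpace.single j 1
  have he : ‖e‖ = 1 := by simp [e]
  have hsm : ContDiff ℝ 1 (φ.normed volume ⋆[ContinuousLinearMap.lsmul ℝ ℝ, volume] u) :=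
    φ.hasCompactSupport_normed.contDiff_convolution_left _ (n := 1) φ.contDiff_normed
      hu.continuous.locallyIntegrable
  have hφc : Continuous (φ.normed (volume : Measure (EuclideanSpace ℝ (Fin p)))) :=
    φ.continuous_normed
  have huc := hu.continuous
  have hline : ∀ s : ℝ, HasDerivAt (fun s : ℝ => x + s • e) e s := fun s => by
    simpa using ((hasDerivAt_id s).smul_const e).const_add x
  have h1 : HasDerivAt
      (fun s : ℝ => (φ.normed volume ⋆[ContinuousLinearMap.lsmul ℝ ℝ, volume] u) (x + s • e))
      (partialDeriv j (φ.normed volume ⋆[ContinuousLinearMap.lsmul ℝ ℝ, volume] u) x) 0 := by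
    have h := (hsm.differentiable one_ne_zero (x + (0 : ℝ) • e)).hasFDerivAt.comp_hasDerivAt 0
      (hline 0)
    rw [zero_smul, add_zero] at h
    exact h
  have hdiff : ∀ᵐ t, DifferentiableAt ℝ u (x - t) :=
    (Measure.measurePreserving_sub_left volume x).quasiMeasurePreserving.ae hu.ae_differentiableAt
  have h2 := (hasDerivAt_integral_of_dominated_loc_of_lip (𝕜 := ℝ) (μ := volume) (s := Set.univ)
    (F := fun (s : ℝ) t => φ.normed volume t * u (x + s • e - t)) (x₀ := (0 : ℝ))
    (F' := fun t => φ.normed volume t * partialDeriv j u (x - t))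
    (bound := fun t => φ.normed volume t * C) univ_mem
    (Eventually.of_forall fun s => by
      exact (hφc.mul (huc.comp (by fun_prop))).aestronglyMeasurable)
    (by
      refine Continuous.integrable_of_hasCompactSupport (hφc.mul (huc.comp (by fun_prop))) ?_
      exact φ.hasCompactSupport_normed.mul_right)
    ((hφc.measurable.mul ((measurable_partialDeriv j u).comp
      (by fun_prop))).aestronglyMeasurable)
    (ae_of_all _ fun t => by
      refine LipschitzOnWith.of_dist_le_mul fun a _ b _ => ?_
      rw [Real.dist_eq, ← mul_sub, abs_mul, abs_of_nonneg (φ.nonneg_normed t), Real.coe_nnabs,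
        abs_of_nonneg (mul_nonneg (φ.nonneg_normed t) C.coe_nonneg), mul_assoc]
      refine mul_le_mul_of_nonneg_left ?_ (φ.nonneg_normed t)
      have h := hu.dist_le_mul (x + a • e - t) (x + b • e - t)
      have hd : dist (x + a • e - t) (x + b • e - t) = dist a b := by
        rw [dist_eq_norm, dist_eq_norm,
          show x + a • e - t - (x + b • e - t) = (a - b) • e by module, norm_smul, he, mul_one]
      rwa [hd, Real.dist_eq] at h)
    (φ.integrable_normed.mul_const _)
    (by
      filter_upwards [hdiff] with t ht
      have hl : HasDerivAt (fun s : ℝ => x + s • e - t) e 0 := (hline 0).sub_const t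
      have ht' : DifferentiableAt ℝ u (x + (0 : ℝ) • e - t) := by simpa using ht
      have := (ht'.hasFDerivAt.comp_hasDerivAt 0 hl).const_mul (φ.normed volume t)
      simpa [partialDeriv, e] using this)).2
  exact h1.unique (by simpa [convolution_def] using! h2)

/-- Mollify and pass to the limit: dominated convergence on the right, Fatou's lemma on the left. -/
theorem EuclideanSpace.lintegral_sq_gaussianDivergence_le_of_lipschitzWith
    {f : Fin p → EuclideanSpace ℝ (Fin p) → ℝ} {C : ℝ≥0}
    (hf : ∀ j, LipschitzWith C (f j)) (hc : ∀ j, HasCompactSupport (f j)) :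
    ∫⁻ x, ENNReal.ofReal ((∑ j, gaussianAdjoint j (f j) x) ^ 2)
        ∂stdGaussian (EuclideanSpace ℝ (Fin p)) ≤
      ENNReal.ofReal (∫ x, (∑ j, f j x ^ 2 + ∑ j, ∑ k, partialDeriv k (f j) x ^ 2)
        ∂stdGaussian (EuclideanSpace ℝ (Fin p))) := by
  let φ : ℕ → ContDiffBump (0 : EuclideanSpace ℝ (Fin p)) := fun m =>
    ⟨1 / ((m : ℝ) + 1), 2 * (1 / ((m : ℝ) + 1)), by positivity, by
      have : (0 : ℝ) < 1 / ((m : ℝ) + 1) := by positivity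
      linarith⟩
  have hφ0 : Tendsto (fun m => (φ m).rOut) atTop (𝓝 0) := by
    have h := (tendsto_one_div_add_atTop_nhds_zero_nat (𝕜 := ℝ)).const_mul 2
    rwa [mul_zero] at h
  -- The bounded ratio of the radii is what Lebesgue differentiation needs for the almost everywhere
  -- convergence of the merely measurable derivatives.
  have hφK : ∀ᶠ m in atTop, (φ m).rOut ≤ 2 * (φ m).rIn := Eventually.of_forall fun m => le_rfl
  let F : ℕ → Fin p → EuclideanSpace ℝ (Fin p) → ℝ := fun m j =>
    (φ m).normed volume ⋆[ContinuousLinearMap.lsmul ℝ ℝ, volume] f j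
  have hbd : ∃ D, ∀ j x, |f j x| ≤ D := by
    choose D hD using fun j => (hc j).exists_bound_of_continuous (hf j).continuous
    refine ⟨∑ j, |D j|, fun j x => (hD j x).trans ((le_abs_self _).trans ?_)⟩
    exact Finset.single_le_sum (f := fun j => |D j|) (fun _ _ => abs_nonneg _) (Finset.mem_univ j)
  obtain ⟨D, hD⟩ := hbd
  have hFsm : ∀ m j, ContDiff ℝ 2 (F m j) := fun m j =>
    (φ m).hasCompactSupport_normed.contDiff_convolution_left _ (n := 2) (φ m).contDiff_normed
      (hf j).continuous.locallyIntegrable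
  have hFc : ∀ m j, HasCompactSupport (F m j) := fun m j =>
    (φ m).hasCompactSupport_normed.convolution _ (hc j)
  have hFd : ∀ m j k x, partialDeriv k (F m j) x =
      ((φ m).normed volume ⋆[ContinuousLinearMap.lsmul ℝ ℝ, volume] partialDeriv k (f j)) x :=
    fun m j k x => partialDeriv_normed_convolution (φ m) (hf j) k x
  have hFD : ∀ m j x, |F m j x| ≤ D := fun m j x => (φ m).abs_normed_convolution_le (hD j) x
  have hFDd : ∀ m j k x, |partialDeriv k (F m j) x| ≤ C := fun m j k x => by
    rw [hFd]
    exact (φ m).abs_normed_convolution_le (abs_partialDeriv_le_of_lipschitzWith (hf j) k) x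
  have hlim : ∀ j, ∀ᵐ x ∂stdGaussian (EuclideanSpace ℝ (Fin p)),
      Tendsto (fun m => F m j x) atTop (𝓝 (f j x)) := fun j =>
    (stdGaussian_absolutelyContinuous p).ae_le
      (ContDiffBump.ae_convolution_tendsto_right_of_locallyIntegrable hφ0 hφK
        (hf j).continuous.locallyIntegrable)
  have hlim' : ∀ j k, ∀ᵐ x ∂stdGaussian (EuclideanSpace ℝ (Fin p)),
      Tendsto (fun m => partialDeriv k (F m j) x) atTop (𝓝 (partialDeriv k (f j) x)) := by
    intro j k
    simp_rw [hFd]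
    refine (stdGaussian_absolutelyContinuous p).ae_le
      (ContDiffBump.ae_convolution_tendsto_right_of_locallyIntegrable hφ0 hφK ?_)
    have : MemLp (partialDeriv k (f j)) ⊤ volume :=
      memLp_top_of_bound (measurable_partialDeriv k (f j)).aestronglyMeasurable C
        (ae_of_all _ (abs_partialDeriv_le_of_lipschitzWith (hf j) k))
    exact this.locallyIntegrable le_top
  have hlim_all : ∀ᵐ x ∂stdGaussian (EuclideanSpace ℝ (Fin p)),
      (∀ j, Tendsto (fun m => F m j x) atTop (𝓝 (f j x))) ∧
      ∀ j k, Tendsto (fun m => partialDeriv k (F m j) x) atTop (𝓝 (partialDeriv k (f j) x)) :=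
    (ae_all_iff.2 hlim).and (ae_all_iff.2 fun j => ae_all_iff.2 (hlim' j))
  have hFδ : ∀ m j, Continuous (gaussianAdjoint j (F m j)) := fun m j =>
    (contDiff_gaussianAdjoint (hFsm m j) j).continuous
  have hFp : ∀ m j k, Continuous (partialDeriv k (F m j)) := fun m j k =>
    continuous_partialDeriv ((hFsm m j).of_le (by norm_num)) k
  have hFcont : ∀ m j, Continuous (F m j) := fun m j => (hFsm m j).continuous
  have hR : Tendsto (fun m => ∫ x, (∑ j, F m j x ^ 2 + ∑ j, ∑ k, partialDeriv k (F m j) x ^ 2)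
      ∂stdGaussian (EuclideanSpace ℝ (Fin p))) atTop
      (𝓝 (∫ x, (∑ j, f j x ^ 2 + ∑ j, ∑ k, partialDeriv k (f j) x ^ 2)
        ∂stdGaussian (EuclideanSpace ℝ (Fin p)))) := by
    refine tendsto_integral_of_dominated_convergence
      (fun _ => ∑ _j : Fin p, D ^ 2 + ∑ _j : Fin p, ∑ _k : Fin p, (C : ℝ) ^ 2)
      (fun m => Continuous.aestronglyMeasurable (by fun_prop)) (integrable_const _)
      (fun m => ae_of_all _ fun x => ?_) ?_
    · rw [Real.norm_eq_abs, abs_of_nonneg (by positivity)]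
      refine add_le_add (Finset.sum_le_sum fun j _ => ?_)
        (Finset.sum_le_sum fun j _ => Finset.sum_le_sum fun k _ => ?_)
      · exact sq_le_sq' (neg_le_of_abs_le (hFD m j x)) (le_of_abs_le (hFD m j x))
      · exact sq_le_sq' (neg_le_of_abs_le (hFDd m j k x)) (le_of_abs_le (hFDd m j k x))
    · filter_upwards [hlim_all] with x hx
      exact (tendsto_finsetSum _ fun j _ => (hx.1 j).pow 2).add
        (tendsto_finsetSum _ fun j _ => tendsto_finsetSum _ fun k _ => (hx.2 j k).pow 2)
  have hL : ∀ᵐ x ∂stdGaussian (EuclideanSpace ℝ (Fin p)),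
      ENNReal.ofReal ((∑ j, gaussianAdjoint j (f j) x) ^ 2) =
        liminf (fun m => ENNReal.ofReal ((∑ j, gaussianAdjoint j (F m j) x) ^ 2)) atTop := by
    filter_upwards [hlim_all] with x hx
    refine (Tendsto.liminf_eq ?_).symm
    refine ENNReal.tendsto_ofReal (Tendsto.pow (tendsto_finsetSum _ fun j _ => ?_) 2)
    exact ((hx.1 j).const_mul _).sub (hx.2 j j)
  rw [lintegral_congr_ae hL]
  refine (lintegral_liminf_le fun m => ?_).trans ?_
  · exact (Continuous.measurable (by fun_prop)).ennreal_ofReal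
  · refine (liminf_le_liminf (Eventually.of_forall fun m => ?_)).trans
      (ENNReal.tendsto_ofReal hR).liminf_eq.le
    rw [← ofReal_integral_eq_lintegral_ofReal]
    · exact ENNReal.ofReal_le_ofReal
        (integral_sq_gaussianDivergence_le_of_contDiff (hFsm m) (hFc m))
    · simp_rw [sq, Finset.sum_mul_sum]
      refine integrable_finsetSum _ fun i _ => integrable_finsetSum _ fun k _ => ?_
      exact Continuous.integrable_of_hasCompactSupport (by fun_prop)
        (hasCompactSupport_gaussianAdjoint (hFc m i) i).mul_right
    · exact ae_of_all _ fun x => sq_nonneg _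

end Mollification

/-! ### Extension of the inequality to locally Lipschitz fields. -/

section Cutoff

open EuclideanSpace
open scoped NNReal

variable {p : ℕ}

/-- A Lipschitz cutoff equal to `1` on the ball of radius `R` and to `0` outside radius `2 R`. -/
noncomputable def EuclideanSpace.cutoff (R : ℝ) (x : EuclideanSpace ℝ (Fin p)) : ℝ :=
  max 0 (min 1 (2 - ‖x‖ / R))

theorem EuclideanSpace.cutoff_nonneg (R : ℝ) (x : EuclideanSpace ℝ (Fin p)) : 0 ≤ cutoff R x :=
  le_max_left _ _

theorem EuclideanSpace.cutoff_le_one (R : ℝ) (x : EuclideanSpace ℝ (Fin p)) : cutoff R x ≤ 1 :=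
  max_le zero_le_one (min_le_left _ _)

theorem EuclideanSpace.cutoff_eq_one {R : ℝ} (hR : 0 < R) {x : EuclideanSpace ℝ (Fin p)}
    (hx : ‖x‖ ≤ R) : cutoff R x = 1 := by
  have : ‖x‖ / R ≤ 1 := (div_le_one hR).2 hx
  rw [cutoff, min_eq_left (by linarith), max_eq_right zero_le_one]

theorem EuclideanSpace.cutoff_eq_zero {R : ℝ} (hR : 0 < R) {x : EuclideanSpace ℝ (Fin p)}
    (hx : 2 * R ≤ ‖x‖) : cutoff R x = 0 := by
  have : 2 ≤ ‖x‖ / R := (le_div_iff₀ hR).2 hx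
  exact max_eq_left ((min_le_right _ _).trans (by linarith))

theorem EuclideanSpace.lipschitzWith_cutoff {R : ℝ} (hR : 1 ≤ R) :
    LipschitzWith 1 (cutoff R : EuclideanSpace ℝ (Fin p) → ℝ) := by
  have h : LipschitzWith 1 (fun x : EuclideanSpace ℝ (Fin p) => 2 - ‖x‖ / R) := by
    refine LipschitzWith.of_dist_le_mul fun x y => ?_
    have hR0 : 0 < R := by linarith
    rw [Real.dist_eq, sub_sub_sub_cancel_left, ← sub_div, abs_div, abs_of_pos hR0, div_le_iff₀ hR0,
      NNReal.coe_one, one_mul, dist_eq_norm, norm_sub_rev]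
    calc |‖y‖ - ‖x‖| ≤ ‖y - x‖ * 1 := by simpa using abs_norm_sub_norm_le y x
      _ ≤ _ := mul_le_mul_of_nonneg_left hR (norm_nonneg _)
  exact (h.const_min 1).const_max 0

theorem EuclideanSpace.exists_lipschitzWith_cutoff_mul {u : EuclideanSpace ℝ (Fin p) → ℝ}
    {R : ℝ} (hR : 1 ≤ R) {K : ℝ≥0} (hu : LipschitzOnWith K u (Metric.closedBall 0 (2 * R))) :
    ∃ C : ℝ≥0, LipschitzWith C (fun x => cutoff R x * u x) := by
  have hR0 : 0 < R := by linarith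
  have hbd : ∀ x ∈ Metric.closedBall (0 : EuclideanSpace ℝ (Fin p)) (2 * R),
      |u x| ≤ |u 0| + K * (2 * R) := by
    intro x hx
    have h := hu.dist_le_mul x hx 0 (by simp; linarith)
    rw [Real.dist_eq] at h
    have hx' : dist x 0 ≤ 2 * R := hx
    have h3 : (K : ℝ) * dist x 0 ≤ K * (2 * R) := by gcongr
    have h2 : |u x| ≤ |u x - u 0| + |u 0| := by
      simpa using abs_add_le (u x - u 0) (u 0)
    linarith
  set D : ℝ := |u 0| + K * (2 * R)
  have hD : 0 ≤ D := by positivity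
  refine ⟨K + ⟨D, hD⟩, ?_⟩
  -- Only y has to lie in the ball. The difference is χ(x)(u(x) - u(y)) + (χ(x) - χ(y))u(y), and its
  -- first part vanishes when x is outside.
  have key : ∀ x y : EuclideanSpace ℝ (Fin p), y ∈ Metric.closedBall 0 (2 * R) →
      |cutoff R x * u x - cutoff R y * u y| ≤ (K + D) * dist x y := by
    intro x y hy
    have h1 : |cutoff R x - cutoff R y| ≤ dist x y := by
      simpa [Real.dist_eq] using (lipschitzWith_cutoff hR).dist_le_mul x y
    have h2 : |cutoff R x| * |u x - u y| ≤ K * dist x y := by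
      by_cases hx : x ∈ Metric.closedBall (0 : EuclideanSpace ℝ (Fin p)) (2 * R)
      · have h := hu.dist_le_mul x hx y hy
        rw [Real.dist_eq] at h
        rw [abs_of_nonneg (cutoff_nonneg R x)]
        calc _ ≤ 1 * |u x - u y| := by gcongr; exact cutoff_le_one R x
          _ ≤ _ := by rwa [one_mul]
      · have : 2 * R ≤ ‖x‖ := by
          rw [mem_closedBall_zero_iff, not_le] at hx; exact hx.le
        rw [cutoff_eq_zero hR0 this]
        simp only [abs_zero, zero_mul]
        positivity
    calc |cutoff R x * u x - cutoff R y * u y|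
        = |cutoff R x * (u x - u y) + (cutoff R x - cutoff R y) * u y| := by ring_nf
      _ ≤ |cutoff R x| * |u x - u y| + |cutoff R x - cutoff R y| * |u y| := by
          rw [← abs_mul, ← abs_mul]; exact abs_add_le _ _
      _ ≤ K * dist x y + dist x y * D := by
          gcongr
          exact hbd y hy
      _ = _ := by ring
  refine LipschitzWith.of_dist_le_mul fun x y => ?_
  rw [Real.dist_eq]
  change _ ≤ ((K : ℝ) + D) * dist x y
  by_cases hy : y ∈ Metric.closedBall (0 : EuclideanSpace ℝ (Fin p)) (2 * R)
  · exact key x y hy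
  by_cases hx : x ∈ Metric.closedBall (0 : EuclideanSpace ℝ (Fin p)) (2 * R)
  · rw [abs_sub_comm, dist_comm]
    exact key y x hx
  · rw [mem_closedBall_zero_iff, not_le] at hx hy
    rw [cutoff_eq_zero hR0 hx.le, cutoff_eq_zero hR0 hy.le]
    simp only [zero_mul, sub_self, abs_zero]
    positivity

/-- The partial derivatives are the coordinates of the Riesz representative of the derivative, so
the bound is free of the dimension p. A coordinatewise estimate would lose a factor p. -/
theorem EuclideanSpace.sum_sq_partialDeriv_le_of_lipschitzWith
    {u : EuclideanSpace ℝ (Fin p) → ℝ} (hu : LipschitzWith 1 u) (x : EuclideanSpace ℝ (Fin p)) :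
    ∑ k, partialDeriv k u x ^ 2 ≤ 1 := by
  have h1 : ‖fderiv ℝ u x‖ ≤ 1 := by simpa using norm_fderiv_le_of_lipschitz ℝ hu (x₀ := x)
  set v := (InnerProductSpace.toDual ℝ (EuclideanSpace ℝ (Fin p))).symm (fderiv ℝ u x)
  have hv : ‖v‖ ≤ 1 := by simpa [v] using h1
  have h2 : ∀ k, partialDeriv k u x = v k := by
    intro k
    have : inner ℝ v (EuclideanSpace.single k (1 : ℝ)) = partialDeriv k u x := by
      rw [partialDeriv]
      exact InnerProductSpace.toDual_symm_apply
    rw [← this, EuclideanSpace.inner_single_right]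
    simp
  simp_rw [h2]
  rw [← EuclideanSpace.real_norm_sq_eq]
  exact pow_le_one₀ (norm_nonneg _) hv

/-- The second order Stein inequality for locally Lipschitz vector fields. -/
theorem EuclideanSpace.lintegral_sq_gaussianDivergence_le
    {f : Fin p → EuclideanSpace ℝ (Fin p) → ℝ}
    (hf : ∀ R : ℝ, ∃ K : ℝ≥0, ∀ j, LipschitzOnWith K (f j) (Metric.closedBall 0 R)) :
    ∫⁻ x, ENNReal.ofReal ((∑ j, gaussianAdjoint j (f j) x) ^ 2)
        ∂stdGaussian (EuclideanSpace ℝ (Fin p)) ≤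
      ∫⁻ x, ENNReal.ofReal (3 * (∑ j, f j x ^ 2 + ∑ j, ∑ k, partialDeriv k (f j) x ^ 2))
        ∂stdGaussian (EuclideanSpace ℝ (Fin p)) := by
  let F : ℕ → Fin p → EuclideanSpace ℝ (Fin p) → ℝ := fun m j x => cutoff ((m : ℝ) + 1) x * f j x
  have hm1 : ∀ m : ℕ, (1 : ℝ) ≤ (m : ℝ) + 1 := fun m => by simp
  have hm0 : ∀ m : ℕ, (0 : ℝ) < (m : ℝ) + 1 := fun m => by positivity
  have hFlip : ∀ m, ∃ C : ℝ≥0, ∀ j, LipschitzWith C (F m j) := by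
    intro m
    obtain ⟨K, hK⟩ := hf (2 * ((m : ℝ) + 1))
    choose C hC using fun j => exists_lipschitzWith_cutoff_mul (hm1 m) (hK j)
    exact ⟨∑ j, C j, fun j => (hC j).weaken
      (Finset.single_le_sum (f := C) (fun _ _ => zero_le) (Finset.mem_univ j))⟩
  have hFc : ∀ m j, HasCompactSupport (F m j) := by
    intro m j
    refine HasCompactSupport.intro (isCompact_closedBall 0 (2 * ((m : ℝ) + 1))) fun x hx => ?_
    rw [mem_closedBall_zero_iff, not_le] at hx
    simp only [F, cutoff_eq_zero (hm0 m) hx.le, zero_mul]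
  have hdf : ∀ᵐ x ∂stdGaussian (EuclideanSpace ℝ (Fin p)), ∀ j, DifferentiableAt ℝ (f j) x := by
    refine (stdGaussian_absolutelyContinuous p).ae_le (ae_all_iff.2 fun j => ?_)
    have h : ∀ᵐ x, ∀ m : ℕ, DifferentiableAt ℝ (F m j) x :=
      ae_all_iff.2 fun m => ((hFlip m).choose_spec j).ae_differentiableAt
    filter_upwards [h] with x hx
    obtain ⟨m, hm⟩ := exists_nat_gt ‖x‖
    refine (hx m).congr_of_eventuallyEq ?_
    have : ∀ᶠ y in 𝓝 x, ‖y‖ < (m : ℝ) + 1 :=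
      continuous_norm.continuousAt.eventually_lt_const (by linarith)
    filter_upwards [this] with y hy
    simp only [F, cutoff_eq_one (hm0 m) hy.le, one_mul]
  have hdc : ∀ᵐ x ∂stdGaussian (EuclideanSpace ℝ (Fin p)), ∀ m : ℕ,
      DifferentiableAt ℝ (cutoff ((m : ℝ) + 1)) x :=
    (stdGaussian_absolutelyContinuous p).ae_le
      (ae_all_iff.2 fun m => (lipschitzWith_cutoff (hm1 m)).ae_differentiableAt)
  -- The factor 3 arises here: (χ∂f + f∂χ)² ≤ 2(∂f)² + 2f²(∂χ)² and |∇χ| ≤ 1 give 2f², to which the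
  -- term (χf)² ≤ f² is added.
  have hbound : ∀ m, ∀ᵐ x ∂stdGaussian (EuclideanSpace ℝ (Fin p)),
      ∑ j, F m j x ^ 2 + ∑ j, ∑ k, partialDeriv k (F m j) x ^ 2 ≤
        3 * (∑ j, f j x ^ 2 + ∑ j, ∑ k, partialDeriv k (f j) x ^ 2) := by
    intro m
    filter_upwards [hdf, hdc] with x hx hxc
    set χ := cutoff ((m : ℝ) + 1) x
    have hχ0 : 0 ≤ χ := cutoff_nonneg _ _
    have hχ1 : χ ≤ 1 := cutoff_le_one _ _
    have hχ2 : χ ^ 2 ≤ 1 := pow_le_one₀ hχ0 hχ1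
    have hpd : ∀ j k, partialDeriv k (F m j) x ^ 2 ≤
        2 * partialDeriv k (f j) x ^ 2 +
          2 * (f j x ^ 2 * partialDeriv k (cutoff ((m : ℝ) + 1)) x ^ 2) := by
      intro j k
      have : partialDeriv k (F m j) x =
          χ * partialDeriv k (f j) x + f j x * partialDeriv k (cutoff ((m : ℝ) + 1)) x := by
        simp only [partialDeriv, F, χ]
        rw [fderiv_fun_mul (hxc m) (hx j)]
        simp
      rw [this]
      nlinarith [sq_nonneg (χ * partialDeriv k (f j) x -
        f j x * partialDeriv k (cutoff ((m : ℝ) + 1)) x),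
        mul_le_mul_of_nonneg_right hχ2 (sq_nonneg (partialDeriv k (f j) x))]
    have h1 : ∑ j, F m j x ^ 2 ≤ ∑ j, f j x ^ 2 := by
      refine Finset.sum_le_sum fun j _ => ?_
      simp only [F, mul_pow]
      exact mul_le_of_le_one_left (sq_nonneg _) hχ2
    have h2 : ∑ j, ∑ k, partialDeriv k (F m j) x ^ 2 ≤
        2 * ∑ j, ∑ k, partialDeriv k (f j) x ^ 2 + 2 * ∑ j, f j x ^ 2 := by
      rw [Finset.mul_sum, Finset.mul_sum, ← Finset.sum_add_distrib]
      refine Finset.sum_le_sum fun j _ => ?_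
      calc _ ≤ ∑ k, (2 * partialDeriv k (f j) x ^ 2 +
          2 * (f j x ^ 2 * partialDeriv k (cutoff ((m : ℝ) + 1)) x ^ 2)) :=
            Finset.sum_le_sum fun k _ => hpd j k
        _ = 2 * ∑ k, partialDeriv k (f j) x ^ 2 +
            2 * (f j x ^ 2 * ∑ k, partialDeriv k (cutoff ((m : ℝ) + 1)) x ^ 2) := by
            rw [Finset.sum_add_distrib, Finset.mul_sum, Finset.mul_sum, Finset.mul_sum]
        _ ≤ _ := by
            gcongr
            exact mul_le_of_le_one_right (sq_nonneg _)
              (sum_sq_partialDeriv_le_of_lipschitzWith (lipschitzWith_cutoff (hm1 m)) x)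
    have h3 : 0 ≤ ∑ j, ∑ k, partialDeriv k (f j) x ^ 2 := by positivity
    linarith
  -- At each point the sequence is eventually constant, since the cutoff equals 1 in a neighbourhood
  -- of x. Fatou's lemma then applies without any integrability of the limit.
  have hL : ∀ x : EuclideanSpace ℝ (Fin p),
      ENNReal.ofReal ((∑ j, gaussianAdjoint j (f j) x) ^ 2) =
        liminf (fun m => ENNReal.ofReal ((∑ j, gaussianAdjoint j (F m j) x) ^ 2)) atTop := by
    intro x
    refine (Tendsto.liminf_eq (tendsto_const_nhds.congr' ?_)).symm
    obtain ⟨m₀, hm₀⟩ := exists_nat_gt ‖x‖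
    filter_upwards [eventually_ge_atTop m₀] with m hm
    have hmm : (m₀ : ℝ) ≤ m := by exact_mod_cast hm
    have : ∀ᶠ y in 𝓝 x, ‖y‖ < (m : ℝ) + 1 :=
      continuous_norm.continuousAt.eventually_lt_const (by linarith)
    have heq : ∀ j, F m j =ᶠ[𝓝 x] f j := fun j => by
      filter_upwards [this] with y hy
      simp only [F, cutoff_eq_one (hm0 m) hy.le, one_mul]
    simp only [gaussianAdjoint, partialDeriv]
    congr 2
    refine Finset.sum_congr rfl fun j _ => ?_
    rw [(heq j).fderiv_eq, (heq j).eq_of_nhds]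
  simp_rw [hL]
  have hFcont : ∀ m j, Continuous (F m j) := fun m j => ((hFlip m).choose_spec j).continuous
  have hFpd : ∀ m j k, Measurable (partialDeriv k (F m j)) := fun m j k =>
    measurable_partialDeriv k (F m j)
  refine (lintegral_liminf_le fun m => ?_).trans ?_
  · refine (Measurable.pow_const (Finset.measurable_sum _ fun j _ => ?_) 2).ennreal_ofReal
    have h1 := (hFcont m j).measurable
    have h2 := hFpd m j j
    unfold gaussianAdjoint
    fun_prop
  · refine (liminf_le_liminf (v := fun _ => _) (Eventually.of_forall fun m => ?_)).trans
      (liminf_const _).le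
    obtain ⟨C, hC⟩ := hFlip m
    refine (lintegral_sq_gaussianDivergence_le_of_lipschitzWith hC (hFc m)).trans ?_
    have hmeas : Measurable
        (fun x => ∑ j, F m j x ^ 2 + ∑ j, ∑ k, partialDeriv k (F m j) x ^ 2) := by
      have h1 := fun j => (hFcont m j).measurable
      have h2 := hFpd m
      fun_prop
    have hint : Integrable (fun x => ∑ j, F m j x ^ 2 + ∑ j, ∑ k, partialDeriv k (F m j) x ^ 2)
        (stdGaussian (EuclideanSpace ℝ (Fin p))) := by
      choose D hD using fun j => (hFc m j).exists_bound_of_continuous (hFcont m j)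
      refine (integrable_const (∑ j : Fin p, D j ^ 2 +
        ∑ _j : Fin p, ∑ _k : Fin p, (C : ℝ) ^ 2)).mono' hmeas.aestronglyMeasurable
        (ae_of_all _ fun x => ?_)
      rw [Real.norm_eq_abs, abs_of_nonneg (by positivity)]
      refine add_le_add (Finset.sum_le_sum fun j _ => ?_)
        (Finset.sum_le_sum fun j _ => Finset.sum_le_sum fun k _ => ?_)
      · exact sq_le_sq' (neg_le_of_abs_le (hD j x)) (le_of_abs_le (hD j x))
      · have := abs_partialDeriv_le_of_lipschitzWith (hC j) k x
        exact sq_le_sq' (neg_le_of_abs_le this) (le_of_abs_le this)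
    rw [ofReal_integral_eq_lintegral_ofReal hint (ae_of_all _ fun x => by positivity)]
    refine lintegral_mono_ae ?_
    filter_upwards [hbound m] with x hx
    exact ENNReal.ofReal_le_ofReal hx

end Cutoff

/-! ### The square root of Σ and its inverse. -/

section SquareRoot

variable {p : ℕ} {S : Matrix (Fin p) (Fin p) ℝ}

theorem RobustSelection.act_mul (A B : Matrix (Fin p) (Fin p) ℝ) (x : EuclideanSpace ℝ (Fin p)) :
    act (A * B) x = act A (act B x) := by
  simp only [act, map_mul]
  rfl

theorem RobustSelection.act_sqrt_act_sqrt (hS : S.PosDef) (x : EuclideanSpace ℝ (Fin p)) :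
    act (CFC.sqrt S) (act (CFC.sqrt S) x) = act S x := by
  rw [← act_mul, CFC.sqrt_mul_sqrt_self _ hS.posSemidef.nonneg]

theorem RobustSelection.inner_act_sqrt (S : Matrix (Fin p) (Fin p) ℝ)
    (x y : EuclideanSpace ℝ (Fin p)) :
    inner ℝ (act (CFC.sqrt S) x) y = inner ℝ x (act (CFC.sqrt S) y) := by
  have h : IsSelfAdjoint (act (CFC.sqrt S)) :=
    IsSelfAdjoint.map (IsSelfAdjoint.of_nonneg (CFC.sqrt_nonneg S)) Matrix.toEuclideanCLM
  exact h.isSymmetric x y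

theorem RobustSelection.inner_act_eq_norm_sq (hS : S.PosDef) (x : EuclideanSpace ℝ (Fin p)) :
    inner ℝ x (act S x) = ‖act (CFC.sqrt S) x‖ ^ 2 := by
  rw [← act_sqrt_act_sqrt hS, ← inner_act_sqrt, real_inner_self_eq_norm_sq]

theorem RobustSelection.isUnit_sqrt (hS : S.PosDef) : IsUnit (CFC.sqrt S) := by
  have h : IsUnit (CFC.sqrt S * CFC.sqrt S) := by
    rw [CFC.sqrt_mul_sqrt_self _ hS.posSemidef.nonneg]
    exact hS.isUnit
  exact isUnit_of_mul_isUnit_left h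

/-- The inverse square root of a positive definite matrix. -/
noncomputable def RobustSelection.invSqrt (S : Matrix (Fin p) (Fin p) ℝ) :
    Matrix (Fin p) (Fin p) ℝ := (CFC.sqrt S)⁻¹

theorem RobustSelection.act_invSqrt_act_sqrt (hS : S.PosDef) (x : EuclideanSpace ℝ (Fin p)) :
    act (invSqrt S) (act (CFC.sqrt S) x) = x := by
  rw [← act_mul, invSqrt, Matrix.nonsing_inv_mul _
    ((Matrix.isUnit_iff_isUnit_det _).1 (isUnit_sqrt hS))]
  simp [act]

theorem RobustSelection.act_sqrt_act_invSqrt (hS : S.PosDef) (x : EuclideanSpace ℝ (Fin p)) :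
    act (CFC.sqrt S) (act (invSqrt S) x) = x := by
  rw [← act_mul, invSqrt, Matrix.mul_nonsing_inv _
    ((Matrix.isUnit_iff_isUnit_det _).1 (isUnit_sqrt hS))]
  simp [act]

theorem RobustSelection.norm_le_mul_norm_act_sqrt (hS : S.PosDef)
    (x : EuclideanSpace ℝ (Fin p)) :
    ‖x‖ ≤ ‖act (invSqrt S)‖ * ‖act (CFC.sqrt S) x‖ := by
  conv_lhs => rw [← act_invSqrt_act_sqrt hS x]
  exact (act (invSqrt S)).le_opNorm _

theorem RobustSelection.abs_inner_act_sqrt_le (S : Matrix (Fin p) (Fin p) ℝ)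
    (x y : EuclideanSpace ℝ (Fin p)) :
    |inner ℝ (act (CFC.sqrt S) x) y| ≤ ‖x‖ * ‖act (CFC.sqrt S) y‖ := by
  rw [inner_act_sqrt]
  exact abs_real_inner_le_norm _ _

theorem RobustSelection.abs_inner_le_norm_mul_norm_act_sqrt (hS : S.PosDef)
    (x y : EuclideanSpace ℝ (Fin p)) :
    |inner ℝ x y| ≤ ‖act (invSqrt S) x‖ * ‖act (CFC.sqrt S) y‖ := by
  conv_lhs => rw [← act_sqrt_act_invSqrt hS x]
  exact abs_inner_act_sqrt_le S _ _

end SquareRoot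

/-! ### Consequences of convexity for the loss and the penalty. -/

section LossAndPenalty

variable {M : ℝ} {ρ : ℝ → ℝ}

theorem RobustSelection.IsAdmissibleLoss.hasDerivAt (hρ : IsAdmissibleLoss M ρ) (u : ℝ) :
    HasDerivAt ρ (deriv ρ u) u :=
  (hρ.contDiff.differentiable one_ne_zero u).hasDerivAt

theorem RobustSelection.IsAdmissibleLoss.monotone_deriv (hρ : IsAdmissibleLoss M ρ) :
    Monotone (deriv ρ) :=
  monotoneOn_univ.1 (hρ.convex.monotoneOn_deriv fun u _ => (hρ.hasDerivAt u).differentiableAt)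

theorem RobustSelection.IsAdmissibleLoss.min_zero (hρ : IsAdmissibleLoss M ρ) (u : ℝ) :
    ρ 0 ≤ ρ u := by
  rcases eq_or_ne u 0 with rfl | h
  · exact le_rfl
  · exact (hρ.unique_min u h).le

/-- A critical point of a convex function is a minimizer, and 0 is the only one. Hence a nonzero
residual has a nonzero score. -/
theorem RobustSelection.IsAdmissibleLoss.deriv_ne_zero (hρ : IsAdmissibleLoss M ρ) {u : ℝ}
    (hu : u ≠ 0) : deriv ρ u ≠ 0 := by
  intro h
  have hmin : IsMinOn ρ Set.univ u := by
    refine hρ.convex.isMinOn_of_rightDeriv_eq_zero (by simp) ?_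
    rw [(hρ.hasDerivAt u).hasDerivWithinAt.derivWithin (uniqueDiffWithinAt_Ioi u), h]
  exact absurd (hmin (Set.mem_univ (0 : ℝ))) (not_le.2 (hρ.unique_min u hu))

theorem RobustSelection.IsAdmissibleLoss.deriv_deriv_nonneg (hρ : IsAdmissibleLoss M ρ) (u : ℝ) :
    0 ≤ deriv (deriv ρ) u := hρ.monotone_deriv.deriv_nonneg

theorem RobustSelection.IsAdmissibleLoss.abs_deriv_deriv_le (hρ : IsAdmissibleLoss M ρ) (u : ℝ) :
    |deriv (deriv ρ) u| ≤ 1 := by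
  simpa using norm_deriv_le_of_lipschitz hρ.lipschitz_deriv (x₀ := u)

variable {p : ℕ} {μ : ℝ} {S : Matrix (Fin p) (Fin p) ℝ} {g : EuclideanSpace ℝ (Fin p) → ℝ}

theorem RobustSelection.IsAdmissiblePenalty.continuous (hg : IsAdmissiblePenalty μ S g) :
    Continuous g := by
  have h := hg.strongConvex.continuousOn isOpen_univ
  rw [continuousOn_univ] at h
  have h2 : Continuous fun b : EuclideanSpace ℝ (Fin p) => μ / 2 * inner ℝ b (act S b) := by
    fun_prop
  exact (h.add h2).congr fun b => by simp

theorem RobustSelection.IsAdmissiblePenalty.segment_le (hS : S.PosDef)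
    (hg : IsAdmissiblePenalty μ S g) (b Δ : EuclideanSpace ℝ (Fin p)) {t : ℝ} (h0 : 0 ≤ t)
    (h1 : t ≤ 1) :
    g (b + t • Δ) ≤ (1 - t) * g b + t * g (b + Δ) -
      μ / 2 * (t * (1 - t)) * ‖act (CFC.sqrt S) Δ‖ ^ 2 := by
  have h := hg.strongConvex.2 (Set.mem_univ b) (Set.mem_univ (b + Δ))
    (sub_nonneg.2 h1) h0 (by ring)
  have hb : (1 - t) • b + t • (b + Δ) = b + t • Δ := by module
  rw [hb] at h
  simp only [inner_act_eq_norm_sq hS] at h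
  simp only [smul_eq_mul, map_add, map_smul] at h
  simp only [← real_inner_self_eq_norm_sq, inner_add_left, inner_add_right, inner_smul_left,
    inner_smul_right, RCLike.conj_to_real] at h ⊢
  rw [real_inner_comm (act (CFC.sqrt S) b) (act (CFC.sqrt S) Δ)] at h
  linarith

/-- This replaces the subgradient condition for the nonsmooth g: compare b with b + tΔ, divide by t
and let t decrease to 0. The strong convexity gain t(1 - t)μ/2 keeps the full μ/2 in the limit. Only
a directional derivative of F is needed. -/
theorem RobustSelection.IsAdmissiblePenalty.le_of_isMinOn_add (hS : S.PosDef)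
    (hg : IsAdmissiblePenalty μ S g) {F : EuclideanSpace ℝ (Fin p) → ℝ}
    {b Δ : EuclideanSpace ℝ (Fin p)} {c : ℝ} (hF : HasDerivAt (fun t : ℝ => F (b + t • Δ)) c 0)
    (hmin : ∀ b', F b + g b ≤ F b' + g b') :
    g b - c + μ / 2 * ‖act (CFC.sqrt S) Δ‖ ^ 2 ≤ g (b + Δ) := by
  have hlim : Tendsto (fun t : ℝ => t⁻¹ • (F (b + (0 + t) • Δ) - F (b + (0 : ℝ) • Δ)) +
      (g (b + Δ) - g b) - μ / 2 * (1 - t) * ‖act (CFC.sqrt S) Δ‖ ^ 2) (𝓝[>] 0)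
      (𝓝 (c + (g (b + Δ) - g b) - μ / 2 * (1 - 0) * ‖act (CFC.sqrt S) Δ‖ ^ 2)) := by
    refine (hF.tendsto_slope_zero_right.add_const _).sub ?_
    refine Tendsto.mono_left (Continuous.tendsto ?_ 0) nhdsWithin_le_nhds
    fun_prop
  have hpos : ∀ᶠ t : ℝ in 𝓝[>] 0, 0 ≤ t⁻¹ • (F (b + (0 + t) • Δ) - F (b + (0 : ℝ) • Δ)) +
      (g (b + Δ) - g b) - μ / 2 * (1 - t) * ‖act (CFC.sqrt S) Δ‖ ^ 2 := by
    filter_upwards [Ioc_mem_nhdsGT (zero_lt_one' ℝ)] with t ht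
    have h1 := hmin (b + t • Δ)
    have h2 := hg.segment_le hS b Δ ht.1.le ht.2
    have h3 : 0 ≤ t⁻¹ * ((F (b + t • Δ) - F b) + t * (g (b + Δ) - g b) -
        μ / 2 * (t * (1 - t)) * ‖act (CFC.sqrt S) Δ‖ ^ 2) :=
      mul_nonneg (inv_nonneg.2 ht.1.le) (by linarith)
    have ht0 : t ≠ 0 := ht.1.ne'
    rw [zero_add, zero_smul, add_zero, smul_eq_mul]
    refine h3.trans (le_of_eq ?_)
    field_simp
  have := ge_of_tendsto hlim hpos
  linarith

theorem RobustSelection.IsAdmissiblePenalty.quadratic_growth (hS : S.PosDef)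
    (hg : IsAdmissiblePenalty μ S g) (b : EuclideanSpace ℝ (Fin p)) :
    g 0 + μ / 2 * ‖act (CFC.sqrt S) b‖ ^ 2 ≤ g b := by
  have h := hg.le_of_isMinOn_add hS (F := fun _ => 0) (b := 0) (Δ := b) (c := 0)
    (hasDerivAt_const _ _) (fun b' => by simpa using hg.min_zero b')
  simpa using h

end LossAndPenalty

/-! ### Optimality conditions of the M-estimator. -/

section Estimator

variable {n p : ℕ} {μ M : ℝ} {ρ : ℝ → ℝ} {S : Matrix (Fin p) (Fin p) ℝ}
  {g : EuclideanSpace ℝ (Fin p) → ℝ}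

theorem RobustSelection.design_apply (X : Fin n → EuclideanSpace ℝ (Fin p))
    (b : EuclideanSpace ℝ (Fin p)) (i : Fin n) : design X b i = inner ℝ (X i) b := rfl

theorem RobustSelection.residual_apply (ρ : ℝ → ℝ) (g : EuclideanSpace ℝ (Fin p) → ℝ)
    (d : Data n p) (i : Fin n) :
    residual ρ g d i = d.1 i - inner ℝ (d.2 i) (mEstimator ρ g d) := rfl

/-- The objective is continuous, and coercive by the quadratic growth of g, so a minimizer exists
and the choice in the definition picks one. -/
theorem RobustSelection.isMinOn_mEstimator (hμ : 0 < μ) (hS : S.PosDef)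
    (hρ : IsAdmissibleLoss M ρ) (hg : IsAdmissiblePenalty μ S g) (d : Data n p) :
    IsMinOn (objective ρ g d) Set.univ (mEstimator ρ g d) := by
  have hcont : Continuous (objective ρ g d) := by
    have hρc : Continuous ρ := hρ.contDiff.continuous
    have hgc := hg.continuous
    have : ∀ i, Continuous fun b => (d.1 - design d.2 b) i := fun i => by
      change Continuous fun b => d.1 i - inner ℝ (d.2 i) b
      exact continuous_const.sub (continuous_const.inner continuous_id)
    exact (continuous_const.mul (continuous_finsetSum _ fun i _ => hρc.comp (this i))).add hgc
  have hex : ∃ b, ∀ b', objective ρ g d b ≤ objective ρ g d b' := by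
    refine hcont.exists_forall_le ?_
    set c := ‖act (invSqrt S)‖
    have hlb : ∀ b, (1 / (n : ℝ)) * ∑ _i : Fin n, ρ 0 + g 0 + μ / 2 * (‖b‖ / (c + 1)) ^ 2 ≤
        objective ρ g d b := by
      intro b
      have h1 := hg.quadratic_growth hS b
      have h2 : ‖b‖ / (c + 1) ≤ ‖act (CFC.sqrt S) b‖ := by
        have hc : 0 ≤ c := norm_nonneg _
        rw [div_le_iff₀ (by positivity)]
        have := norm_le_mul_norm_act_sqrt hS b
        nlinarith [norm_nonneg (act (CFC.sqrt S) b)]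
      have h3 : (1 / (n : ℝ)) * ∑ _i : Fin n, ρ 0 ≤
          (1 / (n : ℝ)) * ∑ i, ρ ((d.1 - design d.2 b) i) := by
        gcongr with i
        exact hρ.min_zero _
      have h4 : (‖b‖ / (c + 1)) ^ 2 ≤ ‖act (CFC.sqrt S) b‖ ^ 2 := by gcongr
      have h5 : μ / 2 * (‖b‖ / (c + 1)) ^ 2 ≤ μ / 2 * ‖act (CFC.sqrt S) b‖ ^ 2 := by gcongr
      unfold objective
      linarith
    refine tendsto_atTop_mono hlb (tendsto_atTop_add_const_left _ _ ?_)
    refine Tendsto.const_mul_atTop (by positivity) ?_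
    refine (tendsto_pow_atTop two_ne_zero).comp ?_
    exact (tendsto_norm_cocompact_atTop).atTop_div_const (by positivity)
  obtain ⟨b, hb⟩ := hex
  exact Classical.epsilon_spec (p := fun b => IsMinOn (objective ρ g d) Set.univ b)
    ⟨b, fun b' _ => hb b'⟩

theorem RobustSelection.variational_inequality (hμ : 0 < μ) (hS : S.PosDef)
    (hρ : IsAdmissibleLoss M ρ) (hg : IsAdmissiblePenalty μ S g) (d : Data n p)
    (b : EuclideanSpace ℝ (Fin p)) :
    g (mEstimator ρ g d) + (1 / (n : ℝ)) * ∑ i, deriv ρ (residual ρ g d i) *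
        inner ℝ (d.2 i) (b - mEstimator ρ g d) +
      μ / 2 * ‖act (CFC.sqrt S) (b - mEstimator ρ g d)‖ ^ 2 ≤ g b := by
  set β := mEstimator ρ g d
  have hmin := isMinOn_mEstimator hμ hS hρ hg d
  have hF : HasDerivAt (fun t : ℝ => (1 / (n : ℝ)) *
      ∑ i, ρ ((d.1 - design d.2 (β + t • (b - β))) i))
      (-((1 / (n : ℝ)) * ∑ i, deriv ρ (residual ρ g d i) * inner ℝ (d.2 i) (b - β))) 0 := by
    have hi : ∀ i, HasDerivAt (fun t : ℝ => ρ ((d.1 - design d.2 (β + t • (b - β))) i))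
        (-(deriv ρ (residual ρ g d i) * inner ℝ (d.2 i) (b - β))) 0 := by
      intro i
      have hl : HasDerivAt (fun t : ℝ => (d.1 - design d.2 (β + t • (b - β))) i)
          (-inner ℝ (d.2 i) (b - β)) 0 := by
        have heq : (fun t : ℝ => (d.1 - design d.2 (β + t • (b - β))) i) =
            fun t => residual ρ g d i - t * inner ℝ (d.2 i) (b - β) := by
          ext t
          change d.1 i - inner ℝ (d.2 i) (β + t • (b - β)) = d.1 i - inner ℝ (d.2 i) β - _
          rw [inner_add_right, inner_smul_right]
          ring
        rw [heq]
        simpa using ((hasDerivAt_id (0 : ℝ)).mul_const (inner ℝ (d.2 i) (b - β))).const_sub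
          (residual ρ g d i)
      have h0 : (d.1 - design d.2 (β + (0 : ℝ) • (b - β))) i = residual ρ g d i := by
        rw [zero_smul, add_zero]; rfl
      have hρ' := hρ.hasDerivAt ((d.1 - design d.2 (β + (0 : ℝ) • (b - β))) i)
      have := hρ'.comp (0 : ℝ) hl
      rw [h0] at this
      convert! this using 1
      ring
    convert! (HasDerivAt.fun_sum fun i (_ : i ∈ Finset.univ) => hi i).const_mul (1 / (n : ℝ))
      using 1
    rw [Finset.sum_neg_distrib, mul_neg]
  have h := hg.le_of_isMinOn_add hS
    (F := fun b => (1 / (n : ℝ)) * ∑ i, ρ ((d.1 - design d.2 b) i)) (b := β) (Δ := b - β) hF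
    (fun b' => hmin (Set.mem_univ b'))
  rw [add_sub_cancel] at h
  linarith

/-- Test the variational inequality of each data set at the minimizer of the other and add. The
penalty values cancel and the two μ/2 add up to μ. -/
theorem RobustSelection.strong_monotonicity (hμ : 0 < μ) (hS : S.PosDef)
    (hρ : IsAdmissibleLoss M ρ) (hg : IsAdmissiblePenalty μ S g) (d d' : Data n p) :
    n * μ * ‖act (CFC.sqrt S) (mEstimator ρ g d - mEstimator ρ g d')‖ ^ 2 ≤
      ∑ i, (deriv ρ (residual ρ g d i) * inner ℝ (d.2 i) (mEstimator ρ g d - mEstimator ρ g d') -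
        deriv ρ (residual ρ g d' i) *
          inner ℝ (d'.2 i) (mEstimator ρ g d - mEstimator ρ g d')) := by
  rcases Nat.eq_zero_or_pos n with rfl | hn
  · simp
  have h1 := variational_inequality hμ hS hρ hg d (mEstimator ρ g d')
  have h2 := variational_inequality hμ hS hρ hg d' (mEstimator ρ g d)
  rw [← neg_sub (mEstimator ρ g d)] at h1
  simp only [inner_neg_right, map_neg, norm_neg, mul_neg, Finset.sum_neg_distrib] at h1
  rw [Finset.sum_sub_distrib]
  have hn' : (0 : ℝ) < n := by exact_mod_cast hn
  have h3 : μ * ‖act (CFC.sqrt S) (mEstimator ρ g d - mEstimator ρ g d')‖ ^ 2 ≤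
      (1 / (n : ℝ)) * (∑ i, deriv ρ (residual ρ g d i) *
          inner ℝ (d.2 i) (mEstimator ρ g d - mEstimator ρ g d') -
        ∑ i, deriv ρ (residual ρ g d' i) *
          inner ℝ (d'.2 i) (mEstimator ρ g d - mEstimator ρ g d')) := by
    linarith
  rw [one_div, ← div_eq_inv_mul, le_div_iff₀ hn'] at h3
  linarith

/-- The variational inequality at b = 0 and the quadratic growth of g contribute μ/2 each. The
bounded score removes the responses from the right-hand side, so no noise moment enters the size of
the estimator. -/
theorem RobustSelection.norm_sq_mEstimator_le (hμ : 0 < μ) (hS : S.PosDef)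
    (hρ : IsAdmissibleLoss M ρ) (hg : IsAdmissiblePenalty μ S g) (d : Data n p) :
    n * μ * ‖act (CFC.sqrt S) (mEstimator ρ g d)‖ ^ 2 ≤
      M * ∑ i, |inner ℝ (d.2 i) (mEstimator ρ g d)| := by
  rcases Nat.eq_zero_or_pos n with rfl | hn
  · simp
  have h1 := variational_inequality hμ hS hρ hg d 0
  have h2 := hg.quadratic_growth hS (mEstimator ρ g d)
  simp only [zero_sub, inner_neg_right, map_neg, norm_neg, mul_neg, Finset.sum_neg_distrib] at h1
  have hn' : (0 : ℝ) < n := by exact_mod_cast hn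
  have h3 : μ * ‖act (CFC.sqrt S) (mEstimator ρ g d)‖ ^ 2 ≤
      (1 / (n : ℝ)) * ∑ i, deriv ρ (residual ρ g d i) * inner ℝ (d.2 i) (mEstimator ρ g d) := by
    linarith
  rw [one_div, ← div_eq_inv_mul, le_div_iff₀ hn'] at h3
  have h4 : ∑ i, deriv ρ (residual ρ g d i) * inner ℝ (d.2 i) (mEstimator ρ g d) ≤
      M * ∑ i, |inner ℝ (d.2 i) (mEstimator ρ g d)| := by
    rw [Finset.mul_sum]
    refine Finset.sum_le_sum fun i _ => (le_abs_self _).trans ?_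
    rw [abs_mul]
    gcongr
    exact hρ.abs_deriv_le _
  linarith

end Estimator

/-- Rademacher's theorem and the null set arguments on the data space are about Haar measures. -/
instance RobustSelection.isAddHaarMeasure_volume_data (n p : ℕ) :
    (volume : Measure (Data n p)).IsAddHaarMeasure :=
  Measure.prod.instIsAddHaarMeasure _ _

/-! ### Stability of the M-estimator and its almost everywhere differentiability. -/

section Perturbation

open scoped NNReal

variable {n p : ℕ} {μ M : ℝ} {ρ : ℝ → ℝ} {S : Matrix (Fin p) (Fin p) ℝ}
  {g : EuclideanSpace ℝ (Fin p) → ℝ}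

/-- Pass through ψ(r' - a). The step from r costs |s| because ψ is 1-Lipschitz, the step to r' has
the favourable sign because ψ is increasing, and replacing a by a' costs the score bound M. Thus no
term quadratic in a survives. -/
theorem RobustSelection.row_term_le (hρ : IsAdmissibleLoss M ρ) {r r' s a a' : ℝ}
    (h : r - r' = s - a) : deriv ρ r * a - deriv ρ r' * a' ≤ |s| * |a| + M * |a - a'| := by
  have hM : 0 ≤ M := (abs_nonneg _).trans (hρ.abs_deriv_le 0)
  have h1 : (deriv ρ r - deriv ρ (r' - a)) * a ≤ |s| * |a| := by
    refine (le_abs_self _).trans ?_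
    rw [abs_mul]
    refine mul_le_mul_of_nonneg_right ?_ (abs_nonneg a)
    have h2 := hρ.lipschitz_deriv.dist_le_mul r (r' - a)
    rw [Real.dist_eq, Real.dist_eq, NNReal.coe_one, one_mul] at h2
    rwa [show r - (r' - a) = s by linarith] at h2
  have h3 : (deriv ρ (r' - a) - deriv ρ r') * a ≤ 0 := by
    rcases le_total 0 a with ha | ha
    · exact mul_nonpos_of_nonpos_of_nonneg
        (sub_nonpos.2 (hρ.monotone_deriv (by linarith))) ha
    · exact mul_nonpos_of_nonneg_of_nonpos
        (sub_nonneg.2 (hρ.monotone_deriv (by linarith))) ha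
  have h4 : deriv ρ r' * (a - a') ≤ M * |a - a'| := by
    refine (le_abs_self _).trans ?_
    rw [abs_mul]
    exact mul_le_mul_of_nonneg_right (hρ.abs_deriv_le _) (abs_nonneg _)
  linarith

theorem RobustSelection.residual_sub_residual (ρ : ℝ → ℝ) (g : EuclideanSpace ℝ (Fin p) → ℝ)
    (d d' : Data n p) (i : Fin n) :
    residual ρ g d i - residual ρ g d' i =
      (d.1 i - d'.1 i - inner ℝ (d.2 i - d'.2 i) (mEstimator ρ g d')) -
        inner ℝ (d.2 i) (mEstimator ρ g d - mEstimator ρ g d') := by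
  rw [residual_apply, residual_apply, inner_sub_left, inner_sub_right]
  ring

/-- Rows on which the data agree contribute nonpositively to the strong monotonicity sum, so only
row i has to be paid for; one power of the norm is then divided out. -/
theorem RobustSelection.norm_sub_le_of_forall_ne_eq (hμ : 0 < μ) (hS : S.PosDef)
    (hρ : IsAdmissibleLoss M ρ) (hg : IsAdmissiblePenalty μ S g) {d d' : Data n p} {i : Fin n}
    {C : ℝ} (hC : 0 ≤ C) (hd1 : ∀ l, l ≠ i → d.1 l = d'.1 l) (hd2 : ∀ l, l ≠ i → d.2 l = d'.2 l)
    (hi : deriv ρ (residual ρ g d i) * inner ℝ (d.2 i) (mEstimator ρ g d - mEstimator ρ g d') -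
      deriv ρ (residual ρ g d' i) * inner ℝ (d'.2 i) (mEstimator ρ g d - mEstimator ρ g d') ≤
      C * ‖act (CFC.sqrt S) (mEstimator ρ g d - mEstimator ρ g d')‖) :
    n * μ * ‖act (CFC.sqrt S) (mEstimator ρ g d - mEstimator ρ g d')‖ ≤ C := by
  have h1 := strong_monotonicity hμ hS hρ hg d d'
  set Δ := mEstimator ρ g d - mEstimator ρ g d'
  have h2 : ∑ l, (deriv ρ (residual ρ g d l) * inner ℝ (d.2 l) Δ -
      deriv ρ (residual ρ g d' l) * inner ℝ (d'.2 l) Δ) ≤ C * ‖act (CFC.sqrt S) Δ‖ := by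
    rw [← Finset.add_sum_erase _ _ (Finset.mem_univ i)]
    have : ∑ l ∈ Finset.univ.erase i, (deriv ρ (residual ρ g d l) * inner ℝ (d.2 l) Δ -
      deriv ρ (residual ρ g d' l) * inner ℝ (d'.2 l) Δ) ≤ 0 := by
      refine Finset.sum_nonpos fun l hl => ?_
      have hl' := Finset.ne_of_mem_erase hl
      have h := row_term_le hρ (a' := inner ℝ (d'.2 l) Δ) (residual_sub_residual ρ g d d' l)
      change _ ≤ |_| * |inner ℝ (d.2 l) Δ| + M * |inner ℝ (d.2 l) Δ - _| at h
      rw [hd1 l hl', hd2 l hl'] at h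
      simpa [hd2 l hl'] using h
    linarith
  rcases (norm_nonneg (act (CFC.sqrt S) Δ)).eq_or_lt with h0 | h0
  · rw [← h0, mul_zero]; exact hC
  · refine le_of_mul_le_mul_right ?_ h0
    calc _ = n * μ * ‖act (CFC.sqrt S) Δ‖ ^ 2 := by ring
      _ ≤ _ := h1.trans h2

/-- Replacing one row of the design by zero moves the M-estimator by a controlled amount. -/
theorem RobustSelection.norm_sub_le_of_row_eq_zero (hμ : 0 < μ) (hS : S.PosDef)
    (hρ : IsAdmissibleLoss M ρ) (hg : IsAdmissiblePenalty μ S g) {d d' : Data n p} {i : Fin n}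
    {x : EuclideanSpace ℝ (Fin p)} (hx : d.2 i = act (CFC.sqrt S) x) (hx' : d'.2 i = 0)
    (hd1 : ∀ l, l ≠ i → d.1 l = d'.1 l) (hd2 : ∀ l, l ≠ i → d.2 l = d'.2 l) :
    n * μ * ‖act (CFC.sqrt S) (mEstimator ρ g d - mEstimator ρ g d')‖ ≤ M * ‖x‖ := by
  have hM : 0 ≤ M := (abs_nonneg _).trans (hρ.abs_deriv_le 0)
  refine norm_sub_le_of_forall_ne_eq hμ hS hρ hg (by positivity) hd1 hd2 ?_
  -- The zero row makes the second product vanish whatever its score is. This is why the i-th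
  -- responses may differ arbitrarily.
  rw [hx', inner_zero_left, mul_zero, sub_zero, hx]
  refine (le_abs_self _).trans ?_
  rw [abs_mul, mul_assoc]
  exact mul_le_mul (hρ.abs_deriv_le _) (abs_inner_act_sqrt_le S _ _) (abs_nonneg _) hM

/-- A change of y_i is the change of r_i plus ⟨x_i, Δ⟩, and Δ is itself controlled by the change of
r_i. So y_i ↦ r_i expands distances up to a constant, which is what pulls null sets back to null
sets. -/
theorem RobustSelection.abs_response_sub_le (hμ : 0 < μ) (hS : S.PosDef)
    (hρ : IsAdmissibleLoss M ρ) (hg : IsAdmissiblePenalty μ S g) (hn : 0 < n) {d d' : Data n p}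
    {i : Fin n} (hd1 : ∀ l, l ≠ i → d.1 l = d'.1 l) (hd2 : d.2 = d'.2) :
    |d.1 i - d'.1 i| ≤ (1 + ‖act (invSqrt S) (d.2 i)‖ ^ 2 / (n * μ)) *
      |residual ρ g d i - residual ρ g d' i| := by
  set Δ := mEstimator ρ g d - mEstimator ρ g d' with hΔ
  set c := ‖act (invSqrt S) (d.2 i)‖ with hc
  set δ := residual ρ g d i - residual ρ g d' i with hδ
  have hn' : (0 : ℝ) < n := by exact_mod_cast hn
  have hin : |inner ℝ (d.2 i) Δ| ≤ c * ‖act (CFC.sqrt S) Δ‖ :=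
    abs_inner_le_norm_mul_norm_act_sqrt hS _ _
  have h1 : n * μ * ‖act (CFC.sqrt S) Δ‖ ≤ |δ| * c := by
    refine norm_sub_le_of_forall_ne_eq hμ hS hρ hg (by positivity) hd1
      (fun l _ => by rw [hd2]) ?_
    rw [← hd2, ← sub_mul, mul_assoc]
    refine (le_abs_self _).trans ?_
    rw [abs_mul]
    refine mul_le_mul ?_ hin (abs_nonneg _) (abs_nonneg _)
    have h := hρ.lipschitz_deriv.dist_le_mul (residual ρ g d i) (residual ρ g d' i)
    rwa [Real.dist_eq, Real.dist_eq, NNReal.coe_one, one_mul] at h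
  have h2 : d.1 i - d'.1 i = δ + inner ℝ (d.2 i) Δ := by
    have := residual_sub_residual ρ g d d' i
    rw [hd2] at this ⊢
    simp only [sub_self, inner_zero_left, sub_zero] at this
    rw [hδ, hΔ]
    linarith
  have h3 : ‖act (CFC.sqrt S) Δ‖ ≤ |δ| * c / (n * μ) := by
    rw [le_div_iff₀ (by positivity)]; linarith
  rw [h2]
  calc |δ + inner ℝ (d.2 i) Δ| ≤ |δ| + c * ‖act (CFC.sqrt S) Δ‖ :=
        (abs_add_le _ _).trans (add_le_add le_rfl hin)
    _ ≤ |δ| + c * (|δ| * c / (n * μ)) := by gcongr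
    _ = _ := by ring

theorem RobustSelection.norm_act_sqrt_mEstimator_le (hμ : 0 < μ) (hS : S.PosDef)
    (hρ : IsAdmissibleLoss M ρ) (hg : IsAdmissiblePenalty μ S g) (d : Data n p) :
    n * μ * ‖act (CFC.sqrt S) (mEstimator ρ g d)‖ ≤
      M * ∑ i, ‖act (invSqrt S) (d.2 i)‖ := by
  have hM : 0 ≤ M := (abs_nonneg _).trans (hρ.abs_deriv_le 0)
  have h1 := norm_sq_mEstimator_le hμ hS hρ hg d
  generalize mEstimator ρ g d = b at h1 ⊢
  rcases (norm_nonneg (act (CFC.sqrt S) b)).eq_or_lt with h0 | h0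
  · rw [← h0, mul_zero]
    exact mul_nonneg hM (Finset.sum_nonneg fun i _ => norm_nonneg _)
  · refine le_of_mul_le_mul_right ?_ h0
    calc _ = n * μ * ‖act (CFC.sqrt S) b‖ ^ 2 := by ring
      _ ≤ M * ∑ i, |inner ℝ (d.2 i) b| := h1
      _ ≤ M * ∑ i, ‖act (invSqrt S) (d.2 i)‖ * ‖act (CFC.sqrt S) b‖ := by
        gcongr with i
        exact abs_inner_le_norm_mul_norm_act_sqrt hS _ _
      _ = _ := by rw [← Finset.sum_mul, mul_assoc]

theorem RobustSelection.exists_lipschitzOnWith_mEstimator (hμ : 0 < μ) (hS : S.PosDef)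
    (hρ : IsAdmissibleLoss M ρ) (hg : IsAdmissiblePenalty μ S g) (hn : 0 < n) (R : ℝ) :
    ∃ K : ℝ≥0, LipschitzOnWith K (fun d : Data n p => mEstimator ρ g d)
      (Metric.closedBall 0 R) := by
  have hM : 0 ≤ M := (abs_nonneg _).trans (hρ.abs_deriv_le 0)
  have hn' : (0 : ℝ) < n := by exact_mod_cast hn
  set c := ‖act (invSqrt S)‖
  have hc : 0 ≤ c := norm_nonneg _
  -- B bounds the estimator on the ball of radius R, and K collects the row constants of
  -- `row_term_le`. The absolute value allows R to be negative.
  set B := c * (M * (n * (c * |R|)) / (n * μ))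
  have hB : 0 ≤ B := by positivity
  set K := c * (n * (c * |R| * (1 + B) + M * c) / (n * μ))
  have hK : 0 ≤ K := by positivity
  refine ⟨⟨K, hK⟩, LipschitzOnWith.of_dist_le_mul fun d hd d' hd' => ?_⟩
  have hrow : ∀ d ∈ Metric.closedBall (0 : Data n p) R, ∀ i, ‖d.2 i‖ ≤ |R| := by
    intro d hd i
    rw [mem_closedBall_zero_iff] at hd
    exact ((norm_le_pi_norm d.2 i).trans (norm_snd_le d)).trans (hd.trans (le_abs_self R))
  have hinv : ∀ x, ‖act (invSqrt S) x‖ ≤ c * ‖x‖ := fun x => (act (invSqrt S)).le_opNorm x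
  have hb' : ‖mEstimator ρ g d'‖ ≤ B := by
    refine (norm_le_mul_norm_act_sqrt hS _).trans ?_
    refine mul_le_mul_of_nonneg_left ?_ hc
    rw [le_div_iff₀ (by positivity), mul_comm]
    refine (norm_act_sqrt_mEstimator_le hμ hS hρ hg d').trans ?_
    refine mul_le_mul_of_nonneg_left ?_ hM
    calc ∑ i, ‖act (invSqrt S) (d'.2 i)‖ ≤ ∑ _i : Fin n, c * |R| :=
          Finset.sum_le_sum fun i _ => (hinv _).trans (by gcongr; exact hrow d' hd' i)
      _ = _ := by simp
  have h1 := strong_monotonicity hμ hS hρ hg d d'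
  set Δ := mEstimator ρ g d - mEstimator ρ g d' with hΔ
  have hterm : ∀ i, deriv ρ (residual ρ g d i) * inner ℝ (d.2 i) Δ -
      deriv ρ (residual ρ g d' i) * inner ℝ (d'.2 i) Δ ≤
      (c * |R| * (1 + B) + M * c) * dist d d' * ‖act (CFC.sqrt S) Δ‖ := by
    intro i
    have hy : |d.1 i - d'.1 i| ≤ dist d d' := by
      rw [dist_eq_norm]
      calc |d.1 i - d'.1 i| = ‖(d.1 - d'.1) i‖ := rfl
        _ ≤ ‖d.1 - d'.1‖ := PiLp.norm_apply_le _ i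
        _ ≤ _ := norm_fst_le (d - d')
    have hx : ‖d.2 i - d'.2 i‖ ≤ dist d d' := by
      rw [dist_eq_norm]
      exact (norm_le_pi_norm (d - d').2 i).trans (norm_snd_le (d - d'))
    have hs : |d.1 i - d'.1 i - inner ℝ (d.2 i - d'.2 i) (mEstimator ρ g d')| ≤
        (1 + B) * dist d d' := by
      refine (abs_sub _ _).trans ?_
      have := abs_real_inner_le_norm (d.2 i - d'.2 i) (mEstimator ρ g d')
      have h3 : ‖d.2 i - d'.2 i‖ * ‖mEstimator ρ g d'‖ ≤ dist d d' * B := by gcongr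
      linarith
    refine (row_term_le hρ (residual_sub_residual ρ g d d' i)).trans ?_
    rw [← inner_sub_left]
    have h4 : |inner ℝ (d.2 i) Δ| ≤ c * |R| * ‖act (CFC.sqrt S) Δ‖ := by
      refine (abs_inner_le_norm_mul_norm_act_sqrt hS _ _).trans ?_
      gcongr
      exact (hinv _).trans (by gcongr; exact hrow d hd i)
    have h5 : |inner ℝ (d.2 i - d'.2 i) Δ| ≤ c * dist d d' * ‖act (CFC.sqrt S) Δ‖ := by
      refine (abs_inner_le_norm_mul_norm_act_sqrt hS _ _).trans ?_
      gcongr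
      exact (hinv _).trans (by gcongr)
    calc _ ≤ (1 + B) * dist d d' * (c * |R| * ‖act (CFC.sqrt S) Δ‖) +
        M * (c * dist d d' * ‖act (CFC.sqrt S) Δ‖) := by gcongr
      _ = _ := by ring
  have h2 : n * μ * ‖act (CFC.sqrt S) Δ‖ ^ 2 ≤
      n * ((c * |R| * (1 + B) + M * c) * dist d d' * ‖act (CFC.sqrt S) Δ‖) := by
    refine h1.trans ((Finset.sum_le_sum fun i _ => hterm i).trans (le_of_eq ?_))
    simp
  have h3 : ‖act (CFC.sqrt S) Δ‖ ≤ n * (c * |R| * (1 + B) + M * c) / (n * μ) * dist d d' := by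
    rcases (norm_nonneg (act (CFC.sqrt S) Δ)).eq_or_lt with h0 | h0
    · rw [← h0]; positivity
    · rw [div_mul_eq_mul_div, le_div_iff₀ (by positivity)]
      refine le_of_mul_le_mul_right ?_ h0
      linarith
  rw [dist_eq_norm, ← hΔ]
  calc ‖Δ‖ ≤ c * ‖act (CFC.sqrt S) Δ‖ := norm_le_mul_norm_act_sqrt hS _
    _ ≤ c * (n * (c * |R| * (1 + B) + M * c) / (n * μ) * dist d d') := by gcongr
    _ = K * dist d d' := by ring

theorem RobustSelection.continuous_mEstimator (hμ : 0 < μ) (hS : S.PosDef)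
    (hρ : IsAdmissibleLoss M ρ) (hg : IsAdmissiblePenalty μ S g) (hn : 0 < n) :
    Continuous (fun d : Data n p => mEstimator ρ g d) := by
  refine continuous_iff_continuousAt.2 fun d => ?_
  obtain ⟨K, hK⟩ := exists_lipschitzOnWith_mEstimator (p := p) hμ hS hρ hg hn (‖d‖ + 1)
  refine hK.continuousOn.continuousAt (Metric.closedBall_mem_nhds_of_mem ?_)
  simp

/-- Rademacher's theorem on balls of integer radius; every point is interior to one of them. -/
theorem RobustSelection.ae_differentiableAt_mEstimator (hμ : 0 < μ) (hS : S.PosDef)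
    (hρ : IsAdmissibleLoss M ρ) (hg : IsAdmissiblePenalty μ S g) (hn : 0 < n) :
    ∀ᵐ d : Data n p, DifferentiableAt ℝ (fun d : Data n p => mEstimator ρ g d) d := by
  have h : ∀ᵐ d : Data n p, ∀ m : ℕ, d ∈ Metric.closedBall (0 : Data n p) m →
      DifferentiableWithinAt ℝ (fun d : Data n p => mEstimator ρ g d)
        (Metric.closedBall 0 m) d := by
    refine ae_all_iff.2 fun m => ?_
    obtain ⟨K, hK⟩ := exists_lipschitzOnWith_mEstimator (p := p) hμ hS hρ hg hn m
    exact hK.ae_differentiableWithinAt_of_mem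
  filter_upwards [h] with d hd
  obtain ⟨m, hm⟩ := exists_nat_gt ‖d‖
  refine (hd m (mem_closedBall_zero_iff.2 hm.le)).differentiableAt
    (Metric.closedBall_mem_nhds_of_mem ?_)
  simpa using hm

theorem RobustSelection.continuous_residual (hμ : 0 < μ) (hS : S.PosDef)
    (hρ : IsAdmissibleLoss M ρ) (hg : IsAdmissiblePenalty μ S g) (hn : 0 < n) (i : Fin n) :
    Continuous (fun d : Data n p => residual ρ g d i) := by
  have h := continuous_mEstimator (p := p) hμ hS hρ hg hn
  simp_rw [residual_apply]
  have h1 : Continuous fun d : Data n p => d.1 i := by fun_prop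
  have h2 : Continuous fun d : Data n p => d.2 i := by fun_prop
  exact h1.sub (h2.inner h)

/-- Along each line in the direction of y_i the residual is antilipschitz, so the preimage of a set
of zero one-dimensional Hausdorff measure is null. Fubini over the lines then gives the claim. -/
theorem RobustSelection.ae_residual_notMem (hμ : 0 < μ) (hS : S.PosDef)
    (hρ : IsAdmissibleLoss M ρ) (hg : IsAdmissiblePenalty μ S g) (hn : 0 < n) {N : Set ℝ}
    (hN : MeasurableSet N) (hN0 : volume N = 0) (i : Fin n) :
    ∀ᵐ d : Data n p, residual ρ g d i ∉ N := by
  let e : Data n p := (EuclideanSpace.single i 1, 0)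
  let L : ℝ →ₗ[ℝ] Data n p := LinearMap.toSpanSingleton ℝ (Data n p) e
  have hmeas : MeasurableSet {d : Data n p | residual ρ g d i ∉ N} :=
    (((continuous_residual (p := p) hμ hS hρ hg hn i).measurable) hN).compl
  refine ae_mem_of_ae_add_linearMap_mem L volume volume hmeas fun d => ?_
  let f : ℝ → ℝ := fun t => residual ρ g (d + L t) i
  have hanti : AntilipschitzWith
      ⟨1 + ‖act (invSqrt S) (d.2 i)‖ ^ 2 / (n * μ), by positivity⟩ f := by
    refine AntilipschitzWith.of_le_mul_dist fun t t' => ?_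
    have h := abs_response_sub_le hμ hS hρ hg hn (d := d + L t) (d' := d + L t') (i := i)
      (fun l hl => by simp [L, e, hl]) (by simp [L, e])
    have h1 : (d + L t).1 i - (d + L t').1 i = t - t' := by simp [L, e]
    have h2 : (d + L t).2 i = d.2 i := by simp [L, e]
    rw [h1, h2] at h
    rw [Real.dist_eq, Real.dist_eq]
    exact h
  have h0 : volume (f ⁻¹' N) = 0 := by
    rw [← hausdorffMeasure_real] at hN0 ⊢
    have := hanti.hausdorffMeasure_preimage_le zero_le_one N
    rw [hN0, mul_zero] at this
    exact le_antisymm this zero_le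
  exact measure_eq_zero_iff_ae_notMem.1 h0

end Perturbation

/-! ### Existence of the derivative matrix. -/

section DerivativeMatrix

variable {n p : ℕ} {μ M : ℝ} {ρ : ℝ → ℝ} {S : Matrix (Fin p) (Fin p) ℝ}
  {g : EuclideanSpace ℝ (Fin p) → ℝ}

/-- The linear map through which the derivative of the M-estimator factors. -/
noncomputable def RobustSelection.scoreVariation (ρ : ℝ → ℝ) (g : EuclideanSpace ℝ (Fin p) → ℝ)
    (d : Data n p) : Data n p →ₗ[ℝ] EuclideanSpace ℝ (Fin p) where
  toFun v := ∑ i, (deriv ρ (residual ρ g d i) • v.2 i +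
    (deriv (deriv ρ) (residual ρ g d i) * (v.1 i - inner ℝ (v.2 i) (mEstimator ρ g d))) • d.2 i)
  map_add' v w := by
    rw [← Finset.sum_add_distrib]
    refine Finset.sum_congr rfl fun i _ => ?_
    simp only [Prod.fst_add, Prod.snd_add, Pi.add_apply, PiLp.add_apply, inner_add_left]
    module
  map_smul' c v := by
    rw [RingHom.id_apply, Finset.smul_sum]
    refine Finset.sum_congr rfl fun i _ => ?_
    simp only [Prod.smul_fst, Prod.smul_snd, Pi.smul_apply, PiLp.smul_apply, inner_smul_left,
      smul_eq_mul, RCLike.conj_to_real]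
    module

theorem RobustSelection.scoreVariation_apply (ρ : ℝ → ℝ) (g : EuclideanSpace ℝ (Fin p) → ℝ)
    (d v : Data n p) : scoreVariation ρ g d v = ∑ i, (deriv ρ (residual ρ g d i) • v.2 i +
    (deriv (deriv ρ) (residual ρ g d i) * (v.1 i - inner ℝ (v.2 i) (mEstimator ρ g d))) • d.2 i) :=
  rfl

/-- Moving x_i by z and y_i by ⟨z, β̂⟩ leaves the second summand zero, so the image is ψ(r_i)z, an
arbitrary vector. -/
theorem RobustSelection.scoreVariation_surjective {d : Data n p} {i : Fin n}
    (hi : deriv ρ (residual ρ g d i) ≠ 0) : Function.Surjective (scoreVariation ρ g d) := by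
  intro u
  set z := (deriv ρ (residual ρ g d i))⁻¹ • u
  refine ⟨(EuclideanSpace.single i (inner ℝ z (mEstimator ρ g d)), Pi.single i z), ?_⟩
  rw [scoreVariation_apply, Finset.sum_eq_single i]
  · simp [z, smul_smul, mul_inv_cancel₀ hi]
  · intro l _ hl
    simp [hl]
  · simp

/-- This is strong monotonicity between d + tv and d, divided by t², in the limit t → 0. The term
-ψ'(r_i)⟨x_i, ℓ⟩² that appears is dropped since ψ' ≥ 0. -/
theorem RobustSelection.norm_sq_fderiv_mEstimator_le (hμ : 0 < μ) (hS : S.PosDef)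
    (hρ : IsAdmissibleLoss M ρ) (hg : IsAdmissiblePenalty μ S g) {d : Data n p}
    (hd : DifferentiableAt ℝ (fun d' : Data n p => mEstimator ρ g d') d)
    (hψ : ∀ i, DifferentiableAt ℝ (deriv ρ) (residual ρ g d i)) (v : Data n p) :
    n * μ * ‖act (CFC.sqrt S) (fderiv ℝ (fun d' : Data n p => mEstimator ρ g d') d v)‖ ^ 2 ≤
      inner ℝ (scoreVariation ρ g d v)
        (fderiv ℝ (fun d' : Data n p => mEstimator ρ g d') d v) := by
  set β : Data n p → EuclideanSpace ℝ (Fin p) := fun d' => mEstimator ρ g d' with hβ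
  set ℓ := fderiv ℝ β d v with hℓ
  have hline : HasDerivAt (fun t : ℝ => d + t • v) v 0 := by
    simpa using ((hasDerivAt_id (0 : ℝ)).smul_const v).const_add d
  have hd0 : d + (0 : ℝ) • v = d := by simp
  have hb : HasDerivAt (fun t : ℝ => β (d + t • v)) ℓ 0 := by
    have h : HasFDerivAt β (fderiv ℝ β d) (d + (0 : ℝ) • v) := by
      rw [hd0]; exact hd.hasFDerivAt
    exact h.comp_hasDerivAt 0 hline
  have hx : ∀ i, HasDerivAt (fun t : ℝ => (d + t • v).2 i) (v.2 i) 0 := fun i => by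
    simpa using ((hasDerivAt_id (0 : ℝ)).smul_const (v.2 i)).const_add (d.2 i)
  have hy : ∀ i, HasDerivAt (fun t : ℝ => (d + t • v).1 i) (v.1 i) 0 := fun i => by
    simpa using ((hasDerivAt_id (0 : ℝ)).mul_const (v.1 i)).const_add (d.1 i)
  have hr : ∀ i, HasDerivAt (fun t : ℝ => residual ρ g (d + t • v) i)
      (v.1 i - (inner ℝ (d.2 i) ℓ + inner ℝ (v.2 i) (β d))) 0 := fun i => by
    have := (hy i).sub ((hx i).inner ℝ hb)
    simp only [hd0] at this
    exact this
  have hm : ∀ i, HasDerivAt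
      (fun t : ℝ => deriv ρ (residual ρ g (d + t • v) i) • (d + t • v).2 i)
      (deriv ρ (residual ρ g d i) • v.2 i + (deriv (deriv ρ) (residual ρ g d i) *
        (v.1 i - (inner ℝ (d.2 i) ℓ + inner ℝ (v.2 i) (β d)))) • d.2 i) 0 := fun i => by
    have h1 : HasDerivAt (deriv ρ) (deriv (deriv ρ) (residual ρ g d i))
        (residual ρ g (d + (0 : ℝ) • v) i) := by
      rw [hd0]; exact (hψ i).hasDerivAt
    have := (h1.comp 0 (hr i)).smul (hx i)
    simp only [Function.comp_def, hd0] at this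
    exact this
  have hlimL : Tendsto (fun t : ℝ => n * μ * ‖act (CFC.sqrt S)
      (t⁻¹ • (β (d + (0 + t) • v) - β (d + (0 : ℝ) • v)))‖ ^ 2) (𝓝[≠] 0)
      (𝓝 (n * μ * ‖act (CFC.sqrt S) ℓ‖ ^ 2)) :=
    ((((act (CFC.sqrt S)).continuous.tendsto _).comp hb.tendsto_slope_zero).norm.pow 2).const_mul _
  have hlimR : Tendsto (fun t : ℝ => ∑ i, inner ℝ
      (t⁻¹ • (deriv ρ (residual ρ g (d + (0 + t) • v) i) • (d + (0 + t) • v).2 i -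
        deriv ρ (residual ρ g (d + (0 : ℝ) • v) i) • (d + (0 : ℝ) • v).2 i))
      (t⁻¹ • (β (d + (0 + t) • v) - β (d + (0 : ℝ) • v)))) (𝓝[≠] 0)
      (𝓝 (∑ i, inner ℝ (deriv ρ (residual ρ g d i) • v.2 i +
        (deriv (deriv ρ) (residual ρ g d i) *
        (v.1 i - (inner ℝ (d.2 i) ℓ + inner ℝ (v.2 i) (β d)))) • d.2 i) ℓ)) :=
    tendsto_finsetSum _ fun i _ => (hm i).tendsto_slope_zero.inner hb.tendsto_slope_zero
  have hle : ∀ t : ℝ, n * μ * ‖act (CFC.sqrt S)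
      (t⁻¹ • (β (d + (0 + t) • v) - β (d + (0 : ℝ) • v)))‖ ^ 2 ≤ ∑ i, inner ℝ
      (t⁻¹ • (deriv ρ (residual ρ g (d + (0 + t) • v) i) • (d + (0 + t) • v).2 i -
        deriv ρ (residual ρ g (d + (0 : ℝ) • v) i) • (d + (0 : ℝ) • v).2 i))
      (t⁻¹ • (β (d + (0 + t) • v) - β (d + (0 : ℝ) • v))) := by
    intro t
    have h := strong_monotonicity hμ hS hρ hg (d + (0 + t) • v) (d + (0 : ℝ) • v)
    have h' := mul_le_mul_of_nonneg_left h (sq_nonneg t⁻¹)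
    rw [map_smul, norm_smul, mul_pow, Real.norm_eq_abs, sq_abs]
    simp only [inner_smul_left, inner_smul_right, inner_sub_left, RCLike.conj_to_real]
    calc _ = t⁻¹ ^ 2 * (n * μ * ‖act (CFC.sqrt S)
          (β (d + (0 + t) • v) - β (d + (0 : ℝ) • v))‖ ^ 2) := by ring
      _ ≤ _ := h'
      _ = _ := by
        rw [Finset.mul_sum]
        refine Finset.sum_congr rfl fun i _ => ?_
        simp only [hβ]
        ring
  have hfin := le_of_tendsto_of_tendsto' hlimL hlimR hle
  refine hfin.trans ?_
  rw [scoreVariation_apply, sum_inner]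
  refine Finset.sum_le_sum fun i _ => ?_
  have h0 := hρ.deriv_deriv_nonneg (residual ρ g d i)
  simp only [inner_add_left, inner_smul_left, RCLike.conj_to_real]
  change _ ≤ _ + deriv (deriv ρ) (residual ρ g d i) * (v.1 i - inner ℝ (v.2 i) (β d)) *
    inner ℝ (d.2 i) ℓ
  nlinarith [mul_nonneg h0 (sq_nonneg (inner ℝ (d.2 i) ℓ))]

/-- The M-estimator has a derivative matrix at every point of differentiability at which the chain
rule applies to the scores and some residual does not vanish. -/
theorem RobustSelection.exists_isDerivativeMatrix (hμ : 0 < μ) (hS : S.PosDef)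
    (hρ : IsAdmissibleLoss M ρ) (hg : IsAdmissiblePenalty μ S g) {d : Data n p}
    (hd : DifferentiableAt ℝ (fun d' : Data n p => mEstimator ρ g d') d)
    (hψ : ∀ i, DifferentiableAt ℝ (deriv ρ) (residual ρ g d i)) {i₀ : Fin n}
    (hi₀ : deriv ρ (residual ρ g d i₀) ≠ 0) :
    ∃ A, IsDerivativeMatrix μ S ρ g d A := by
  set β : Data n p → EuclideanSpace ℝ (Fin p) := fun d' => mEstimator ρ g d'
  set w := scoreVariation ρ g d
  have hn : 0 < n := Fin.pos i₀
  have hn' : (0 : ℝ) < n := by exact_mod_cast hn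
  have key := norm_sq_fderiv_mEstimator_le hμ hS hρ hg hd hψ
  -- The derivative kills the kernel of the surjection w, hence factors through it. The factor is
  -- the required matrix A, computed with any right inverse R of w.
  have hker : ∀ v, w v = 0 → fderiv ℝ β d v = 0 := by
    intro v hv
    have h := key v
    change _ ≤ inner ℝ (w v) _ at h
    rw [hv, inner_zero_left] at h
    have h1 : ‖act (CFC.sqrt S) (fderiv ℝ β d v)‖ ^ 2 ≤ 0 := by
      by_contra hcon
      push Not at hcon
      have : 0 < n * μ * ‖act (CFC.sqrt S) (fderiv ℝ β d v)‖ ^ 2 := by positivity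
      exact absurd h (not_le.2 this)
    have h2 : ‖act (CFC.sqrt S) (fderiv ℝ β d v)‖ = 0 :=
      pow_eq_zero_iff two_ne_zero |>.1 (le_antisymm h1 (sq_nonneg _))
    have h3 := norm_le_mul_norm_act_sqrt hS (fderiv ℝ β d v)
    rw [h2, mul_zero] at h3
    exact norm_le_zero_iff.1 h3
  obtain ⟨R, hR⟩ := w.exists_rightInverse_of_surjective
    (LinearMap.range_eq_top.2 (scoreVariation_surjective hi₀))
  have hwR : ∀ u, w (R u) = u := fun u => by
    have := congrArg (fun f => f u) hR
    simpa using this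
  let a : EuclideanSpace ℝ (Fin p) →L[ℝ] EuclideanSpace ℝ (Fin p) :=
    LinearMap.toContinuousLinearMap ((fderiv ℝ β d).toLinearMap ∘ₗ R)
  let A : Matrix (Fin p) (Fin p) ℝ := (Matrix.toEuclideanCLM (𝕜 := ℝ)).symm a
  have hA : ∀ u, act A u = fderiv ℝ β d (R u) := by
    intro u
    have : act A = a := StarAlgEquiv.apply_symm_apply _ _
    rw [this]; rfl
  have hfac : ∀ v, fderiv ℝ β d v = act A (w v) := by
    intro v
    rw [hA, ← sub_eq_zero, ← map_sub]
    exact hker _ (by rw [map_sub, hwR, sub_self])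
  refine ⟨A, hd, ?_, fun i => ?_, fun i j => ?_⟩
  -- For v = R Σ^{1/2}u and z = Σ^{1/2}AΣ^{1/2}u the energy inequality reads nμ‖z‖² ≤ ⟨u, z⟩.
  · refine ContinuousLinearMap.opNorm_le_bound _ (by positivity) fun u => ?_
    rw [act_mul, act_mul]
    have h := key (R (act (CFC.sqrt S) u))
    change _ ≤ inner ℝ (w _) _ at h
    rw [hwR, inner_act_sqrt] at h
    change n * μ * ‖act (CFC.sqrt S) (fderiv ℝ β d _)‖ ^ 2 ≤
      inner ℝ u (act (CFC.sqrt S) (fderiv ℝ β d _)) at h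
    rw [← hA] at h
    set z := act (CFC.sqrt S) (act A (act (CFC.sqrt S) u))
    have h2 : n * μ * ‖z‖ ^ 2 ≤ ‖u‖ * ‖z‖ := h.trans (real_inner_le_norm _ _)
    rw [← div_eq_inv_mul, le_div_iff₀ (by positivity)]
    rcases (norm_nonneg z).eq_or_lt with h0 | h0
    · rw [← h0, zero_mul]; exact norm_nonneg u
    · refine le_of_mul_le_mul_right ?_ h0
      linarith
  · change fderiv ℝ β d _ = _
    rw [hfac, ← map_smul]
    congr 1
    change scoreVariation ρ g d _ = _
    rw [scoreVariation_apply, Finset.sum_eq_single i]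
    · simp
    · intro l _ hl
      simp [hl]
    · simp
  · change fderiv ℝ β d _ = _
    rw [hfac, ← map_smul, ← map_smul, ← map_sub]
    congr 1
    change scoreVariation ρ g d _ = _
    rw [scoreVariation_apply, Finset.sum_eq_single i]
    · simp [EuclideanSpace.inner_single_left, sub_eq_add_neg]
    · intro l _ hl
      simp [hl]
    · simp

/-- Almost surely no residual meets the null set of nondifferentiability points of ψ, nor the point
0. The first justifies the chain rule; the second gives a nonzero score, already in the first row.
-/
theorem RobustSelection.ae_isDerivativeMatrix (hμ : 0 < μ) (hS : S.PosDef)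
    (hρ : IsAdmissibleLoss M ρ) (hg : IsAdmissiblePenalty μ S g) (hn : 0 < n) :
    ∀ᵐ d : Data n p, IsDerivativeMatrix μ S ρ g d (derivativeMatrix μ S ρ g d) := by
  set N : Set ℝ := {u | ¬ DifferentiableAt ℝ (deriv ρ) u} ∪ {0} with hNdef
  have hN : MeasurableSet N :=
    (measurableSet_of_differentiableAt ℝ (deriv ρ)).compl.union (measurableSet_singleton 0)
  have hN0 : volume N = 0 :=
    measure_union_null (ae_iff.1 hρ.lipschitz_deriv.ae_differentiableAt_real) (by simp)
  filter_upwards [ae_differentiableAt_mEstimator (p := p) hμ hS hρ hg hn,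
    ae_all_iff.2 fun i => ae_residual_notMem (p := p) hμ hS hρ hg hn hN hN0 i] with d hd hr
  have h1 : ∀ i, DifferentiableAt ℝ (deriv ρ) (residual ρ g d i) := fun i => by
    by_contra h
    exact hr i (Or.inl h)
  have h2 : deriv ρ (residual ρ g d ⟨0, hn⟩) ≠ 0 :=
    hρ.deriv_ne_zero fun h => hr ⟨0, hn⟩ (Or.inr h)
  exact Classical.epsilon_spec (exists_isDerivativeMatrix hμ hS hρ hg hd h1 h2)

end DerivativeMatrix

/-! ### Functions of polynomial growth and integration over independent Gaussian rows. -/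

section PolynomialGrowth

/-- A continuous function of at most polynomial growth. -/
@[fun_prop]
def PolyGrowth {V W : Type*} [NormedAddCommGroup V] [NormedAddCommGroup W] (f : V → W) : Prop :=
  Continuous f ∧ ∃ C : ℝ, ∃ k : ℕ, 0 ≤ C ∧ ∀ x, ‖f x‖ ≤ C * (1 + ‖x‖) ^ k

namespace PolyGrowth

variable {V W U : Type*} [NormedAddCommGroup V] [NormedAddCommGroup W] [NormedAddCommGroup U]

theorem of_bound {f : V → W} (hf : Continuous f) (C : ℝ) (k : ℕ)
    (h : ∀ x, ‖f x‖ ≤ C * (1 + ‖x‖) ^ k) : PolyGrowth f :=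
  ⟨hf, |C|, k, abs_nonneg C, fun x => (h x).trans (by gcongr; exact le_abs_self C)⟩

@[fun_prop]
theorem id : PolyGrowth (fun x : V => x) :=
  of_bound continuous_id 1 1 fun x => by simp

@[fun_prop]
theorem const (w : W) : PolyGrowth (fun _ : V => w) :=
  of_bound continuous_const ‖w‖ 0 fun x => by simp

@[fun_prop]
theorem comp {f : W → U} {h : V → W} (hf : PolyGrowth f) (hh : PolyGrowth h) :
    PolyGrowth (fun x => f (h x)) := by
  obtain ⟨hfc, C, k, hC, hf⟩ := hf
  obtain ⟨hhc, D, m, hD, hh⟩ := hh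
  refine of_bound (hfc.comp hhc) (C * (1 + D) ^ k) (m * k) fun x => ?_
  have h1 : 1 ≤ (1 + ‖x‖) ^ m := one_le_pow₀ (by simp)
  calc ‖f (h x)‖ ≤ C * (1 + ‖h x‖) ^ k := hf _
    _ ≤ C * ((1 + ‖x‖) ^ m + D * (1 + ‖x‖) ^ m) ^ k := by
        gcongr
        exact hh x
    _ = C * (1 + D) ^ k * (1 + ‖x‖) ^ (m * k) := by rw [pow_mul, ← one_add_mul, mul_pow]; ring

@[fun_prop]
theorem add {f h : V → W} (hf : PolyGrowth f) (hh : PolyGrowth h) :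
    PolyGrowth (fun x => f x + h x) := by
  obtain ⟨hfc, C, k, hC, hf⟩ := hf
  obtain ⟨hhc, D, m, hD, hh⟩ := hh
  refine of_bound (hfc.add hhc) (C + D) (max k m) fun x => ?_
  have h1 : (1 + ‖x‖) ^ k ≤ (1 + ‖x‖) ^ max k m := pow_le_pow_right₀ (by simp) (le_max_left _ _)
  have h2 : (1 + ‖x‖) ^ m ≤ (1 + ‖x‖) ^ max k m := pow_le_pow_right₀ (by simp) (le_max_right _ _)
  calc ‖f x + h x‖ ≤ C * (1 + ‖x‖) ^ k + D * (1 + ‖x‖) ^ m :=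
        (norm_add_le _ _).trans (add_le_add (hf x) (hh x))
    _ ≤ C * (1 + ‖x‖) ^ max k m + D * (1 + ‖x‖) ^ max k m := by gcongr
    _ = _ := by ring

@[fun_prop]
theorem neg {f : V → W} (hf : PolyGrowth f) : PolyGrowth (fun x => -f x) := by
  obtain ⟨hfc, C, k, hC, hf⟩ := hf
  exact of_bound hfc.neg C k fun x => by simpa using hf x

@[fun_prop]
theorem sub {f h : V → W} (hf : PolyGrowth f) (hh : PolyGrowth h) :
    PolyGrowth (fun x => f x - h x) := by
  simp_rw [sub_eq_add_neg]
  exact hf.add hh.neg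

theorem of_le_mul {X : Type*} [NormedAddCommGroup X] {f : V → W} {h : V → U} {e : V → X} (he : Continuous e) (hf : PolyGrowth f)
    (hh : PolyGrowth h) (hle : ∀ x, ‖e x‖ ≤ ‖f x‖ * ‖h x‖) : PolyGrowth e := by
  obtain ⟨hfc, C, k, hC, hf⟩ := hf
  obtain ⟨hhc, D, m, hD, hh⟩ := hh
  refine of_bound he (C * D) (k + m) fun x => (hle x).trans ?_
  calc ‖f x‖ * ‖h x‖ ≤ (C * (1 + ‖x‖) ^ k) * (D * (1 + ‖x‖) ^ m) := by
        gcongr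
        · exact hf x
        · exact hh x
    _ = _ := by ring

@[fun_prop]
theorem mul {f h : V → ℝ} (hf : PolyGrowth f) (hh : PolyGrowth h) :
    PolyGrowth (fun x => f x * h x) :=
  of_le_mul (X := ℝ) (hf.1.mul hh.1) hf hh fun _ => (norm_mul _ _).le

@[fun_prop]
theorem pow {f : V → ℝ} (hf : PolyGrowth f) (k : ℕ) : PolyGrowth (fun x => f x ^ k) := by
  induction k with
  | zero => simpa using const (V := V) (1 : ℝ)
  | succ k ih => simpa [pow_succ] using ih.mul hf

@[fun_prop]
theorem norm {f : V → W} (hf : PolyGrowth f) : PolyGrowth (fun x => ‖f x‖) := by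
  obtain ⟨hfc, C, k, hC, hf⟩ := hf
  exact of_bound hfc.norm C k fun x => by simpa using hf x

@[fun_prop]
theorem inner {F : Type*} [NormedAddCommGroup F] [InnerProductSpace ℝ F] {f h : V → F}
    (hf : PolyGrowth f) (hh : PolyGrowth h) : PolyGrowth (fun x => Inner.inner ℝ (f x) (h x)) :=
  of_le_mul (X := ℝ) (hf.1.inner hh.1) hf hh fun _ => norm_inner_le_norm _ _

@[fun_prop]
theorem sum {ι : Type*} (s : Finset ι) {f : ι → V → W} (hf : ∀ i, PolyGrowth (f i)) :
    PolyGrowth (fun x => ∑ i ∈ s, f i x) := by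
  classical
  induction s using Finset.induction_on with
  | empty => simpa using const (V := V) (0 : W)
  | insert a s ha ih =>
    simp_rw [Finset.sum_insert ha]
    exact (hf a).add ih

variable {ι : Type*} [Fintype ι]

@[fun_prop]
theorem apply (i : ι) : PolyGrowth (fun x : ι → V => x i) :=
  of_bound (continuous_apply i) 1 1 fun x => by
    have := norm_le_pi_norm x i
    simp only [pow_one, one_mul]
    linarith

theorem norm_update_zero_le [DecidableEq ι] (x : ι → V) (i : ι) :
    ‖Function.update x i 0‖ ≤ ‖x‖ := by
  rw [pi_norm_le_iff_of_nonneg (norm_nonneg x)]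
  intro j
  rcases eq_or_ne j i with rfl | h
  · simp
  · simpa [h] using norm_le_pi_norm x j

@[fun_prop]
theorem update_zero [DecidableEq ι] (i : ι) :
    PolyGrowth (fun x : ι → V => Function.update x i 0) :=
  of_bound (continuous_id.update i continuous_const) 1 1 fun x => by
    have := norm_update_zero_le x i
    simp only [pow_one, one_mul]
    linarith

end PolyGrowth

variable {n p : ℕ}

/-- The law of `n` independent standard Gaussian rows. -/
noncomputable abbrev gaussianRows (n p : ℕ) : Measure (Fin n → EuclideanSpace ℝ (Fin p)) :=
  Measure.pi fun _ => stdGaussian (EuclideanSpace ℝ (Fin p))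

theorem integrable_eval_gaussianRows {f : EuclideanSpace ℝ (Fin p) → ℝ}
    (hf : Integrable f (stdGaussian (EuclideanSpace ℝ (Fin p)))) (i : Fin n) :
    Integrable (fun G => f (G i)) (gaussianRows n p) :=
  (measurePreserving_eval (fun _ : Fin n => stdGaussian (EuclideanSpace ℝ (Fin p))) i
    ).integrable_comp_of_integrable hf

theorem integral_eval_gaussianRows {f : EuclideanSpace ℝ (Fin p) → ℝ}
    (hf : Continuous f) (i : Fin n) :
    ∫ G, f (G i) ∂gaussianRows n p = ∫ x, f x ∂stdGaussian (EuclideanSpace ℝ (Fin p)) := by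
  have h := measurePreserving_eval (fun _ : Fin n => stdGaussian (EuclideanSpace ℝ (Fin p))) i
  conv_rhs => rw [← h.map_eq]
  rw [integral_map h.measurable.aemeasurable hf.aestronglyMeasurable]

theorem PolyGrowth.integrable {f : (Fin n → EuclideanSpace ℝ (Fin p)) → ℝ} (hf : PolyGrowth f) :
    Integrable f (gaussianRows n p) := by
  obtain ⟨hfc, C, k, hC, hf⟩ := hf
  have hpow : ∀ m : ℕ, Integrable (fun G : Fin n → EuclideanSpace ℝ (Fin p) => ‖G‖ ^ m)
      (gaussianRows n p) := by
    intro m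
    -- The sup norm of G is attained at some row, so its powers are dominated by the sum over rows.
    -- The summand 1 covers the case of no rows.
    have hsum : Integrable (fun G : Fin n → EuclideanSpace ℝ (Fin p) => 1 + ∑ i, ‖G i‖ ^ m)
        (gaussianRows n p) :=
      (integrable_const _).add (integrable_finsetSum _ fun i _ =>
        integrable_eval_gaussianRows (integrable_norm_pow_stdGaussian m) i)
    refine hsum.mono' (by fun_prop) (ae_of_all _ fun G => ?_)
    rw [Real.norm_eq_abs, abs_of_nonneg (by positivity)]
    have h0 : 0 ≤ ∑ i, ‖G i‖ ^ m := by positivity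
    rcases isEmpty_or_nonempty (Fin n) with hn | hn
    · have : ‖G‖ = 0 := by simp [Subsingleton.elim G 0]
      rw [this]
      exact (pow_le_one₀ le_rfl zero_le_one).trans (by linarith)
    · obtain ⟨i, hi⟩ := Finite.exists_max fun i => ‖G i‖
      have hGi : ‖G‖ ^ m ≤ ‖G i‖ ^ m := by
        gcongr
        exact (pi_norm_le_iff_of_nonneg (norm_nonneg _)).2 hi
      have := Finset.single_le_sum (f := fun i => ‖G i‖ ^ m) (fun _ _ => by positivity)
        (Finset.mem_univ i)
      linarith
  have : Integrable (fun G : Fin n → EuclideanSpace ℝ (Fin p) => C * (1 + ‖G‖) ^ k)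
      (gaussianRows n p) := by
    refine Integrable.const_mul ?_ C
    simp_rw [add_pow]
    refine integrable_finsetSum _ fun i _ => ?_
    simpa using (hpow (k - i)).mul_const (k.choose i : ℝ)
  exact this.mono' hfc.aestronglyMeasurable (ae_of_all _ hf)

theorem integral_norm_sq_gaussianRows (i : Fin n) :
    ∫ G, ‖G i‖ ^ 2 ∂gaussianRows n p = p := by
  rw [integral_eval_gaussianRows (f := fun x => ‖x‖ ^ 2) (by fun_prop),
    integral_norm_sq_stdGaussian]

theorem integral_norm_pow_four_gaussianRows_le (i : Fin n) :
    ∫ G, ‖G i‖ ^ 4 ∂gaussianRows n p ≤ gaussianFourthMoment * p ^ 2 := by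
  rw [integral_eval_gaussianRows (f := fun x => ‖x‖ ^ 4) (by fun_prop)]
  exact integral_norm_pow_four_stdGaussian_le p

theorem integral_row_gaussianRows (i : Fin n)
    {φ : EuclideanSpace ℝ (Fin p) → (Fin n → EuclideanSpace ℝ (Fin p)) → ℝ}
    (hφ : PolyGrowth fun G : Fin n → EuclideanSpace ℝ (Fin p) =>
      φ (G i) (Function.update G i 0)) :
    ∫ G, φ (G i) (Function.update G i 0) ∂gaussianRows n p =
      ∫ G, ∫ x, φ x (Function.update G i 0) ∂stdGaussian (EuclideanSpace ℝ (Fin p))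
        ∂gaussianRows n p := by
  rw [integral_pi_eq_integral_update _ i hφ.integrable]
  simp

theorem integral_mul_eq_zero_of_row (i : Fin n)
    {A T : (Fin n → EuclideanSpace ℝ (Fin p)) → ℝ} (hA : PolyGrowth A) (hT : PolyGrowth T)
    (hAi : ∀ G x, A (Function.update G i x) = A G)
    (hTi : ∀ G, ∫ x, T (Function.update G i x) ∂stdGaussian (EuclideanSpace ℝ (Fin p)) = 0) :
    ∫ G, A G * T G ∂gaussianRows n p = 0 := by
  rw [integral_pi_eq_integral_update _ i (hA.mul hT).integrable]
  simp_rw [hAi, integral_const_mul, hTi, mul_zero, integral_zero]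

/-- Let T_i^(l) be T_i with row l set to zero. Since T_l has mean zero given the other rows, and T_i
likewise, the mean of T_i T_l equals that of (T_i - T_i^(l))(T_l - T_l^(i)), which is at most D. The
off-diagonal part thus costs (∑|a_i|)² D ≤ n D ∑ a_i², which is harmless when D = O(1/n). -/
theorem integral_sq_sum_mul_le {T : Fin n → (Fin n → EuclideanSpace ℝ (Fin p)) → ℝ}
    (hT : ∀ i, PolyGrowth (T i))
    (hT0 : ∀ i G, ∫ x, T i (Function.update G i x) ∂stdGaussian (EuclideanSpace ℝ (Fin p)) = 0)
    {v D : ℝ} (hv : ∀ i, ∫ G, T i G ^ 2 ∂gaussianRows n p ≤ v)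
    (hD : ∀ i l, i ≠ l →
      ∫ G, (T i G - T i (Function.update G l 0)) ^ 2 ∂gaussianRows n p ≤ D)
    (hD0 : 0 ≤ D) (a : Fin n → ℝ) :
    ∫ G, (∑ i, a i * T i G) ^ 2 ∂gaussianRows n p ≤ (∑ i, a i ^ 2) * (v + n * D) := by
  have hTu : ∀ i l, PolyGrowth fun G => T i (Function.update G l 0) := fun i l => by
    have := hT i
    fun_prop
  have hcross : ∀ i l, i ≠ l → |∫ G, T i G * T l G ∂gaussianRows n p| ≤ D := by
    intro i l hil
    have h1 : ∫ G, T i (Function.update G l 0) * T l G ∂gaussianRows n p = 0 :=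
      integral_mul_eq_zero_of_row l (hTu i l) (hT l) (fun G x => by simp) (hT0 l)
    have h2 : ∫ G, T l (Function.update G i 0) * T i G ∂gaussianRows n p = 0 :=
      integral_mul_eq_zero_of_row i (hTu l i) (hT i) (fun G x => by simp) (hT0 i)
    have h3 : ∫ G, T i (Function.update G l 0) * T l (Function.update G i 0)
        ∂gaussianRows n p = 0 :=
      integral_mul_eq_zero_of_row l (hTu i l) (hTu l i) (fun G x => by simp) (fun G => by
        simp_rw [Function.update_comm hil.symm]
        exact hT0 l _)
    have hi1 := ((hTu i l).mul (hT l)).integrable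
    have hi2 := ((hTu l i).mul (hT i)).integrable
    have hi3 := ((hTu i l).mul (hTu l i)).integrable
    have hi4 := ((hT i).mul (hT l)).integrable
    have h4 : ∫ G, T i G * T l G ∂gaussianRows n p =
        ∫ G, (T i G - T i (Function.update G l 0)) * (T l G - T l (Function.update G i 0))
          ∂gaussianRows n p := by
      have : ∀ G, (T i G - T i (Function.update G l 0)) * (T l G - T l (Function.update G i 0)) =
          T i G * T l G - T i (Function.update G l 0) * T l G -
            T l (Function.update G i 0) * T i G +
            T i (Function.update G l 0) * T l (Function.update G i 0) := fun G => by ring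
      have hi5 : Integrable (fun G => T i G * T l G - T i (Function.update G l 0) * T l G)
        (gaussianRows n p) := hi4.sub hi1
      have hi6 : Integrable (fun G => T i G * T l G - T i (Function.update G l 0) * T l G -
        T l (Function.update G i 0) * T i G) (gaussianRows n p) := hi5.sub hi2
      simp_rw [this]
      rw [integral_add hi6 hi3, integral_sub hi5 hi2, integral_sub hi4 hi1, h1, h2, h3]
      ring
    have hs1 := (((hT i).sub (hTu i l)).pow 2).integrable
    have hs2 := (((hT l).sub (hTu l i)).pow 2).integrable
    rw [h4]
    calc _ ≤ ∫ G, |(T i G - T i (Function.update G l 0)) * (T l G - T l (Function.update G i 0))|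
          ∂gaussianRows n p := abs_integral_le_integral_abs
      _ ≤ ∫ G, ((T i G - T i (Function.update G l 0)) ^ 2 +
          (T l G - T l (Function.update G i 0)) ^ 2) / 2 ∂gaussianRows n p := by
        refine integral_mono (((hT i).sub (hTu i l)).mul ((hT l).sub (hTu l i))).integrable.abs
          ((hs1.add hs2).div_const 2) fun G => ?_
        simp only [abs_mul]
        rw [← sq_abs (T i G - _), ← sq_abs (T l G - _)]
        nlinarith [sq_nonneg (|T i G - T i (Function.update G l 0)| -
          |T l G - T l (Function.update G i 0)|)]
      _ ≤ D := by
        rw [integral_div, integral_add hs1 hs2]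
        have := hD i l hil
        have := hD l i hil.symm
        linarith
  have hexp : ∀ G, (∑ i, a i * T i G) ^ 2 = ∑ i, ∑ l, a i * a l * (T i G * T l G) := by
    intro G
    rw [sq, Finset.sum_mul_sum]
    refine Finset.sum_congr rfl fun i _ => Finset.sum_congr rfl fun l _ => by ring
  have hi : ∀ i l, Integrable (fun G => a i * a l * (T i G * T l G)) (gaussianRows n p) :=
    fun i l => (((hT i).mul (hT l)).integrable).const_mul _
  simp_rw [hexp]
  rw [integral_finsetSum _ fun i _ => integrable_finsetSum _ fun l _ => hi i l]
  simp_rw [integral_finsetSum _ fun l _ => hi _ l, integral_const_mul]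
  have hle : ∀ i l, a i * a l * ∫ G, T i G * T l G ∂gaussianRows n p ≤
      (if i = l then a i ^ 2 * v else 0) + |a i| * |a l| * D := by
    intro i l
    split_ifs with h
    · subst h
      have h1 := hv i
      simp_rw [sq] at h1 ⊢
      have h2 : a i * a i * ∫ G, T i G * T i G ∂gaussianRows n p ≤ a i * a i * v :=
        mul_le_mul_of_nonneg_left h1 (mul_self_nonneg _)
      have h3 : 0 ≤ |a i| * |a i| * D := by positivity
      linarith
    · rw [zero_add]
      refine (le_abs_self _).trans ?_
      rw [abs_mul, abs_mul]
      exact mul_le_mul_of_nonneg_left (hcross i l h) (by positivity)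
  refine (Finset.sum_le_sum fun i _ => Finset.sum_le_sum fun l _ => hle i l).trans ?_
  simp only [Finset.sum_add_distrib, Finset.sum_ite_eq, Finset.mem_univ, if_true]
  have h5 : (∑ i, |a i|) ^ 2 ≤ n * ∑ i, a i ^ 2 := by
    simpa using sq_sum_le_card_mul_sum_sq (s := Finset.univ) (f := fun i => |a i|)
  have h6 : ∑ i, ∑ l, |a i| * |a l| * D = (∑ i, |a i|) ^ 2 * D := by
    rw [sq, Finset.sum_mul_sum]
    simp_rw [Finset.sum_mul]
  rw [h6, ← Finset.sum_mul]
  nlinarith [mul_le_mul_of_nonneg_right h5 hD0]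

end PolynomialGrowth

/-! ### Moments of linear and quadratic forms in one row. -/

section RowMoments

variable {n p : ℕ}

theorem integral_inner_row_sq (i : Fin n)
    {A : (Fin n → EuclideanSpace ℝ (Fin p)) → EuclideanSpace ℝ (Fin p)} (hA : PolyGrowth A) :
    ∫ G, inner ℝ (G i) (A (Function.update G i 0)) ^ 2 ∂gaussianRows n p =
      ∫ G, ‖A (Function.update G i 0)‖ ^ 2 ∂gaussianRows n p := by
  rw [integral_row_gaussianRows i (φ := fun x G => inner ℝ x (A G) ^ 2) (by fun_prop)]
  simp_rw [integral_inner_sq_stdGaussian]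

theorem integrable_inner_pow_four_stdGaussian (u : EuclideanSpace ℝ (Fin p)) :
    Integrable (fun x => inner ℝ x u ^ 4) (stdGaussian (EuclideanSpace ℝ (Fin p))) := by
  refine integrable_of_norm_le_pow_stdGaussian (by fun_prop) (‖u‖ ^ 4) 4 fun x => ?_
  rw [abs_pow, ← mul_pow]
  gcongr
  have := abs_real_inner_le_norm x u
  nlinarith [norm_nonneg u]

theorem integral_inner_sq_mul_inner_sq_stdGaussian_le (u v : EuclideanSpace ℝ (Fin p)) :
    ∫ x, inner ℝ x u ^ 2 * inner ℝ x v ^ 2 ∂stdGaussian (EuclideanSpace ℝ (Fin p)) ≤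
      gaussianFourthMoment * (‖u‖ ^ 2 * ‖v‖ ^ 2) := by
  rcases eq_or_ne u 0 with rfl | hu
  · simp
  rcases eq_or_ne v 0 with rfl | hv
  · simp
  have hu' : 0 < ‖u‖ ^ 2 := by positivity
  have hv' : 0 < ‖v‖ ^ 2 := by positivity
  -- This weight balances the two fourth powers in the arithmetic-geometric mean inequality, so that
  -- the bound is homogeneous in u and in v.
  set s := ‖v‖ ^ 2 / ‖u‖ ^ 2 with hs
  have hs0 : 0 < s := by positivity
  have hiu := integrable_inner_pow_four_stdGaussian u
  have hiv := integrable_inner_pow_four_stdGaussian v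
  have hle : ∀ x : EuclideanSpace ℝ (Fin p), inner ℝ x u ^ 2 * inner ℝ x v ^ 2 ≤
      s / 2 * inner ℝ x u ^ 4 + s⁻¹ / 2 * inner ℝ x v ^ 4 := by
    intro x
    have h := mul_nonneg (inv_nonneg.2 hs0.le)
      (sq_nonneg (s * inner ℝ x u ^ 2 - inner ℝ x v ^ 2))
    have h2 : s⁻¹ * (s * inner ℝ x u ^ 2 - inner ℝ x v ^ 2) ^ 2 =
        s * inner ℝ x u ^ 4 - 2 * (inner ℝ x u ^ 2 * inner ℝ x v ^ 2) +
          s⁻¹ * inner ℝ x v ^ 4 := by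
      field_simp
      ring
    linarith
  calc _ ≤ ∫ x, (s / 2 * inner ℝ x u ^ 4 + s⁻¹ / 2 * inner ℝ x v ^ 4)
        ∂stdGaussian (EuclideanSpace ℝ (Fin p)) := by
        refine integral_mono_of_nonneg (ae_of_all _ fun x => by positivity)
          ((hiu.const_mul _).add (hiv.const_mul _)) (ae_of_all _ hle)
    _ = s / 2 * (gaussianFourthMoment * ‖u‖ ^ 4) + s⁻¹ / 2 * (gaussianFourthMoment * ‖v‖ ^ 4) := by
        rw [integral_add (hiu.const_mul _) (hiv.const_mul _), integral_const_mul,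
          integral_const_mul, integral_inner_pow_four_stdGaussian,
          integral_inner_pow_four_stdGaussian]
    _ = _ := by
        rw [hs]
        field_simp
        ring

theorem integral_sq_inner_mul_inner_sub_le (u v : EuclideanSpace ℝ (Fin p)) :
    ∫ x, (inner ℝ x u * inner ℝ x v - inner ℝ u v) ^ 2
      ∂stdGaussian (EuclideanSpace ℝ (Fin p)) ≤
      2 * (gaussianFourthMoment + 1) * (‖u‖ ^ 2 * ‖v‖ ^ 2) := by
  have hi : Integrable (fun x => inner ℝ x u ^ 2 * inner ℝ x v ^ 2)
      (stdGaussian (EuclideanSpace ℝ (Fin p))) := by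
    refine ((integrable_inner_pow_four_stdGaussian u).add
      (integrable_inner_pow_four_stdGaussian v)).mono' (by fun_prop) (ae_of_all _ fun x => ?_)
    rw [Real.norm_eq_abs, abs_of_nonneg (by positivity)]
    simp only [Pi.add_apply]
    nlinarith [sq_nonneg (inner ℝ x u ^ 2 - inner ℝ x v ^ 2), sq_nonneg (inner ℝ x u ^ 2),
      sq_nonneg (inner ℝ x v ^ 2)]
  have h1 : inner ℝ u v ^ 2 ≤ ‖u‖ ^ 2 * ‖v‖ ^ 2 := by
    rw [← sq_abs, ← mul_pow]
    gcongr
    exact abs_real_inner_le_norm u v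
  calc _ ≤ ∫ x, (2 * (inner ℝ x u ^ 2 * inner ℝ x v ^ 2) + 2 * (‖u‖ ^ 2 * ‖v‖ ^ 2))
        ∂stdGaussian (EuclideanSpace ℝ (Fin p)) := by
        refine integral_mono_of_nonneg (ae_of_all _ fun x => by positivity)
          ((hi.const_mul _).add (integrable_const _)) (ae_of_all _ fun x => ?_)
        simp only
        nlinarith [sq_nonneg (inner ℝ x u * inner ℝ x v + inner ℝ u v)]
    _ = 2 * ∫ x, inner ℝ x u ^ 2 * inner ℝ x v ^ 2 ∂stdGaussian (EuclideanSpace ℝ (Fin p)) +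
        2 * (‖u‖ ^ 2 * ‖v‖ ^ 2) := by
        rw [integral_add (hi.const_mul _) (integrable_const _), integral_const_mul]
        simp
    _ ≤ _ := by
        have := integral_inner_sq_mul_inner_sq_stdGaussian_le u v
        linarith

end RowMoments

/-! ### Moments of a leave-one-out stable function. -/

section LeaveOneOut

/-- A vector valued function of the rows of a design that is stable under replacing one row by
zero and that obeys the growth bound of a regularized estimator. -/
structure IsLeaveOneOutStable {n p : ℕ} (B : ℝ) (τ : EuclideanSpace ℝ (Fin p))
    (H : (Fin n → EuclideanSpace ℝ (Fin p)) → EuclideanSpace ℝ (Fin p)) : Prop where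
  continuous : Continuous H
  norm_sub_update_le : ∀ G i, ‖H G - H (Function.update G i 0)‖ ≤ B / n * ‖G i‖
  norm_sq_le : ∀ G, ‖H G + τ‖ ^ 2 ≤ B / n * ∑ i, |inner ℝ (G i) (H G + τ)|

/-- A bound on the fourth moment of a leave-one-out stable function. -/
noncomputable def fourthMomentBound (γ B M : ℝ) : ℝ :=
  8 * (16 * B ^ 4 + 8 * B ^ 4 * γ + 4 * B ^ 4 * gaussianFourthMoment * γ ^ 2 + M ^ 2)

/-- A bound on the fourth moment of a leave-one-out stable function and its perturbations. -/
noncomputable def perturbedMomentBound (γ B M : ℝ) : ℝ :=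
  27 * (fourthMomentBound γ B M + 2 * (B ^ 4 * gaussianFourthMoment * γ ^ 2))

namespace IsLeaveOneOutStable

variable {n p : ℕ} {γ B M : ℝ} {τ : EuclideanSpace ℝ (Fin p)}
  {H : (Fin n → EuclideanSpace ℝ (Fin p)) → EuclideanSpace ℝ (Fin p)}

theorem norm_le (hH : IsLeaveOneOutStable B τ H) (hB : 0 ≤ B)
    (G : Fin n → EuclideanSpace ℝ (Fin p)) : ‖H G + τ‖ ≤ B * ‖G‖ := by
  have h := hH.norm_sq_le G
  rcases (norm_nonneg (H G + τ)).eq_or_lt with h0 | h0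
  · rw [← h0]; positivity
  rcases Nat.eq_zero_or_pos n with hn | hn
  · subst hn
    simp only [Finset.univ_eq_empty, Finset.sum_empty, mul_zero] at h
    nlinarith
  have hn' : (0 : ℝ) < n := by exact_mod_cast hn
  refine le_of_mul_le_mul_right ?_ h0
  calc ‖H G + τ‖ * ‖H G + τ‖ = ‖H G + τ‖ ^ 2 := by ring
    _ ≤ B / n * ∑ i, |inner ℝ (G i) (H G + τ)| := h
    _ ≤ B / n * ∑ _i : Fin n, ‖G‖ * ‖H G + τ‖ := by
        gcongr with i
        refine (abs_real_inner_le_norm _ _).trans ?_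
        gcongr
        exact norm_le_pi_norm G i
    _ = _ := by
        simp only [Finset.sum_const, Finset.card_univ, Fintype.card_fin, nsmul_eq_mul]
        field_simp

theorem polyGrowth (hH : IsLeaveOneOutStable B τ H) (hB : 0 ≤ B) : PolyGrowth H := by
  refine PolyGrowth.of_bound hH.continuous (B + ‖τ‖) 1 fun G => ?_
  have h1 := hH.norm_le hB G
  have h2 : ‖H G‖ ≤ ‖H G + τ‖ + ‖τ‖ := by
    simpa using norm_sub_le (H G + τ) τ
  have h3 : 0 ≤ ‖τ‖ * ‖G‖ := by positivity
  rw [pow_one]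
  nlinarith

variable (hH : IsLeaveOneOutStable B τ H) (hn : 0 < n) (hγ : 0 < γ) (hp : (p : ℝ) ≤ γ * n)
  (hB : 0 ≤ B) (hτ : ‖τ‖ ^ 2 ≤ M)

include hH hn hγ hp hB

/-- A self-bounding argument. Squaring the growth condition bounds ‖H + τ‖⁴ by an average of ⟨G_i, H
+ τ⟩². Stability replaces H by H^(i) there, and independence of G_i turns the inner product into a
norm. So the fourth moment is at most a multiple of the second plus a constant, and the second
moment is absorbed. -/
theorem integral_norm_add_pow_four_le :
    ∫ G, ‖H G + τ‖ ^ 4 ∂gaussianRows n p ≤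
      16 * B ^ 4 + 8 * B ^ 4 * γ + 4 * B ^ 4 * gaussianFourthMoment * γ ^ 2 := by
  have hn' : (0 : ℝ) < n := by exact_mod_cast hn
  have hn1 : (1 : ℝ) ≤ n := by exact_mod_cast hn
  have hpg := hH.polyGrowth hB
  have hκ := gaussianFourthMoment_nonneg
  have hp0 : (0 : ℝ) ≤ p := by positivity
  have hrow : ∀ i, ∫ G, inner ℝ (G i) (H G + τ) ^ 2 ∂gaussianRows n p ≤
      4 * ∫ G, ‖H G + τ‖ ^ 2 ∂gaussianRows n p + 4 * (B ^ 2 * γ) +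
        2 * (B ^ 2 * (gaussianFourthMoment * γ ^ 2)) := by
    intro i
    have hle : ∀ G, inner ℝ (G i) (H G + τ) ^ 2 ≤
        2 * inner ℝ (G i) (H (Function.update G i 0) + τ) ^ 2 +
          2 * ((B / n) ^ 2 * ‖G i‖ ^ 4) := by
      intro G
      have h1 : inner ℝ (G i) (H G + τ) = inner ℝ (G i) (H (Function.update G i 0) + τ) +
          inner ℝ (G i) (H G - H (Function.update G i 0)) := by
        rw [← inner_add_right]; congr 1; abel
      have h2 : inner ℝ (G i) (H G - H (Function.update G i 0)) ^ 2 ≤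
          (B / n) ^ 2 * ‖G i‖ ^ 4 := by
        rw [← sq_abs]
        calc _ ≤ (‖G i‖ * (B / n * ‖G i‖)) ^ 2 := by
              gcongr
              refine (abs_real_inner_le_norm _ _).trans ?_
              gcongr
              exact hH.norm_sub_update_le G i
          _ = _ := by ring
      rw [h1]
      nlinarith [sq_nonneg (inner ℝ (G i) (H (Function.update G i 0) + τ) -
        inner ℝ (G i) (H G - H (Function.update G i 0)))]
    have hle2 : ∀ G, ‖H (Function.update G i 0) + τ‖ ^ 2 ≤
        2 * ‖H G + τ‖ ^ 2 + 2 * ((B / n) ^ 2 * ‖G i‖ ^ 2) := by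
      intro G
      have h1 : ‖H (Function.update G i 0) + τ‖ ≤ ‖H G + τ‖ + B / n * ‖G i‖ := by
        have h := norm_sub_le (H G + τ) (H G - H (Function.update G i 0))
        rw [show H G + τ - (H G - H (Function.update G i 0)) =
          H (Function.update G i 0) + τ by abel] at h
        exact h.trans (add_le_add le_rfl (hH.norm_sub_update_le G i))
      calc _ ≤ (‖H G + τ‖ + B / n * ‖G i‖) ^ 2 := by gcongr
        _ ≤ _ := by nlinarith [sq_nonneg (‖H G + τ‖ - B / n * ‖G i‖)]
    have hA : PolyGrowth fun G => H G + τ := by fun_prop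
    have e1 : ∫ G, inner ℝ (G i) (H G + τ) ^ 2 ∂gaussianRows n p ≤
        2 * ∫ G, inner ℝ (G i) (H (Function.update G i 0) + τ) ^ 2 ∂gaussianRows n p +
          2 * ((B / n) ^ 2 * ∫ G, ‖G i‖ ^ 4 ∂gaussianRows n p) := by
      rw [← integral_const_mul, ← integral_const_mul, ← integral_const_mul, ← integral_add]
      · exact integral_mono (PolyGrowth.integrable (by fun_prop))
          (PolyGrowth.integrable (by fun_prop)) hle
      · exact PolyGrowth.integrable (by fun_prop)
      · exact PolyGrowth.integrable (by fun_prop)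
    have e2 : ∫ G, ‖H (Function.update G i 0) + τ‖ ^ 2 ∂gaussianRows n p ≤
        2 * ∫ G, ‖H G + τ‖ ^ 2 ∂gaussianRows n p +
          2 * ((B / n) ^ 2 * ∫ G, ‖G i‖ ^ 2 ∂gaussianRows n p) := by
      rw [← integral_const_mul, ← integral_const_mul, ← integral_const_mul, ← integral_add]
      · exact integral_mono (PolyGrowth.integrable (by fun_prop))
          (PolyGrowth.integrable (by fun_prop)) hle2
      · exact PolyGrowth.integrable (by fun_prop)
      · exact PolyGrowth.integrable (by fun_prop)
    have e3 : (B / n) ^ 2 * ∫ G, ‖G i‖ ^ 2 ∂gaussianRows n p ≤ B ^ 2 * γ := by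
      rw [integral_norm_sq_gaussianRows, div_pow, div_mul_eq_mul_div,
        div_le_iff₀ (by positivity), mul_assoc]
      refine mul_le_mul_of_nonneg_left (hp.trans ?_) (sq_nonneg B)
      nlinarith [mul_le_mul_of_nonneg_left hn1 (mul_pos hγ hn').le]
    have e4 : (B / n) ^ 2 * ∫ G, ‖G i‖ ^ 4 ∂gaussianRows n p ≤
        B ^ 2 * (gaussianFourthMoment * γ ^ 2) := by
      have h1 := integral_norm_pow_four_gaussianRows_le (p := p) i
      have h2 : (p : ℝ) ^ 2 ≤ (γ * n) ^ 2 := by gcongr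
      calc _ ≤ (B / n) ^ 2 * (gaussianFourthMoment * (γ * n) ^ 2) := by
            gcongr
            exact h1.trans (by gcongr)
        _ = _ := by field_simp
    have e5 := integral_inner_row_sq i hA
    rw [e5] at e1
    linarith
  have hmain : ∀ G, ‖H G + τ‖ ^ 4 ≤ B ^ 2 / n * ∑ i, inner ℝ (G i) (H G + τ) ^ 2 := by
    intro G
    have h1 := hH.norm_sq_le G
    calc ‖H G + τ‖ ^ 4 = (‖H G + τ‖ ^ 2) ^ 2 := by ring
      _ ≤ (B / n * ∑ i, |inner ℝ (G i) (H G + τ)|) ^ 2 := by gcongr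
      _ = (B / n) ^ 2 * (∑ i, |inner ℝ (G i) (H G + τ)|) ^ 2 := by ring
      _ ≤ (B / n) ^ 2 * (n * ∑ i, inner ℝ (G i) (H G + τ) ^ 2) := by
          gcongr
          simpa using sq_sum_le_card_mul_sum_sq (s := Finset.univ)
            (f := fun i => |inner ℝ (G i) (H G + τ)|)
      _ = _ := by field_simp
  have hint : ∫ G, ‖H G + τ‖ ^ 4 ∂gaussianRows n p ≤
      B ^ 2 / n * ∑ i, ∫ G, inner ℝ (G i) (H G + τ) ^ 2 ∂gaussianRows n p := by
    rw [← integral_finsetSum _ fun i _ => PolyGrowth.integrable (by fun_prop),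
      ← integral_const_mul]
    exact integral_mono (PolyGrowth.integrable (by fun_prop))
      (PolyGrowth.integrable (by fun_prop)) hmain
  have hsum : B ^ 2 / n * ∑ i, ∫ G, inner ℝ (G i) (H G + τ) ^ 2 ∂gaussianRows n p ≤
      B ^ 2 * (4 * ∫ G, ‖H G + τ‖ ^ 2 ∂gaussianRows n p + 4 * (B ^ 2 * γ) +
        2 * (B ^ 2 * (gaussianFourthMoment * γ ^ 2))) := by
    calc _ ≤ B ^ 2 / n * ∑ _i : Fin n, (4 * ∫ G, ‖H G + τ‖ ^ 2 ∂gaussianRows n p +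
          4 * (B ^ 2 * γ) + 2 * (B ^ 2 * (gaussianFourthMoment * γ ^ 2))) := by
          gcongr with i
          exact hrow i
      _ = _ := by
          simp only [Finset.sum_const, Finset.card_univ, Fintype.card_fin, nsmul_eq_mul]
          field_simp
  -- From 4B²x² ≤ x⁴/2 + 8B⁴. Half the fourth moment goes to the left-hand side, which is legitimate
  -- since it is finite by polynomial growth.
  have hyoung : B ^ 2 * (4 * ∫ G, ‖H G + τ‖ ^ 2 ∂gaussianRows n p) ≤
      (∫ G, ‖H G + τ‖ ^ 4 ∂gaussianRows n p) / 2 + 8 * B ^ 4 := by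
    have : ∫ G, (B ^ 2 * (4 * ‖H G + τ‖ ^ 2)) ∂gaussianRows n p ≤
        ∫ G, (‖H G + τ‖ ^ 4 / 2 + 8 * B ^ 4) ∂gaussianRows n p :=
      integral_mono (PolyGrowth.integrable (by fun_prop))
        ((PolyGrowth.integrable (by fun_prop : PolyGrowth fun G => ‖H G + τ‖ ^ 4)).div_const 2
          |>.add (integrable_const _)) fun G => by
          simp only
          nlinarith [sq_nonneg (‖H G + τ‖ ^ 2 - 4 * B ^ 2)]
    rw [integral_const_mul, integral_const_mul, integral_add
      ((PolyGrowth.integrable (by fun_prop)).div_const 2) (integrable_const _), integral_div]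
      at this
    simpa using this
  linarith

include hτ

theorem integral_norm_pow_four_le :
    ∫ G, ‖H G‖ ^ 4 ∂gaussianRows n p ≤ fourthMomentBound γ B M := by
  have hpg := hH.polyGrowth hB
  have h := integral_norm_add_pow_four_le hH hn hγ hp hB
  have hM : 0 ≤ M := (sq_nonneg _).trans hτ
  have hle : ∀ G, ‖H G‖ ^ 4 ≤ 8 * (‖H G + τ‖ ^ 4 + M ^ 2) := by
    intro G
    have h1 : ‖H G‖ ≤ ‖H G + τ‖ + ‖τ‖ := by simpa using norm_sub_le (H G + τ) τ
    have h2 : ‖τ‖ ^ 4 ≤ M ^ 2 := by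
      calc ‖τ‖ ^ 4 = (‖τ‖ ^ 2) ^ 2 := by ring
        _ ≤ _ := by gcongr
    calc ‖H G‖ ^ 4 ≤ (‖H G + τ‖ + ‖τ‖) ^ 4 := by gcongr
      _ ≤ 2 ^ 3 * (‖H G + τ‖ ^ 4 + ‖τ‖ ^ 4) :=
          add_pow_le (norm_nonneg _) (norm_nonneg _) 4
      _ ≤ _ := by linarith
  calc _ ≤ ∫ G, 8 * (‖H G + τ‖ ^ 4 + M ^ 2) ∂gaussianRows n p :=
        integral_mono (PolyGrowth.integrable (by fun_prop))
          (PolyGrowth.integrable (by fun_prop)) hle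
    _ = 8 * (∫ G, ‖H G + τ‖ ^ 4 ∂gaussianRows n p + M ^ 2) := by
        rw [integral_const_mul, integral_add (PolyGrowth.integrable (by fun_prop))
          (integrable_const _)]
        simp
    _ ≤ _ := by
        unfold fourthMomentBound
        linarith

/-- The envelope that dominates the function and its versions with the rows `i`, `l` set to
zero. -/
theorem integral_envelope_pow_four_le (i l : Fin n) :
    ∫ G, (‖H G‖ + B / n * (‖G i‖ + ‖G l‖)) ^ 4 ∂gaussianRows n p ≤
      perturbedMomentBound γ B M := by
  have hn' : (0 : ℝ) < n := by exact_mod_cast hn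
  have hn1 : (1 : ℝ) ≤ n := by exact_mod_cast hn
  have hpg := hH.polyGrowth hB
  have hκ := gaussianFourthMoment_nonneg
  have h4 : ∀ i : Fin n, (B / n) ^ 4 * ∫ G, ‖G i‖ ^ 4 ∂gaussianRows n p ≤
      B ^ 4 * gaussianFourthMoment * γ ^ 2 := by
    intro i
    have h1 := integral_norm_pow_four_gaussianRows_le (p := p) i
    have h2 : (p : ℝ) ^ 2 ≤ (γ * n) ^ 2 := by gcongr
    have h3 : (γ * n) ^ 2 ≤ γ ^ 2 * n ^ 4 := by
      rw [mul_pow]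
      exact mul_le_mul_of_nonneg_left (pow_le_pow_right₀ hn1 (by norm_num)) (sq_nonneg γ)
    calc _ ≤ (B / n) ^ 4 * (gaussianFourthMoment * (γ ^ 2 * n ^ 4)) := by
          gcongr
          exact h1.trans (by gcongr; exact h2.trans h3)
      _ = _ := by field_simp
  have hle : ∀ G, (‖H G‖ + B / n * (‖G i‖ + ‖G l‖)) ^ 4 ≤
      27 * (‖H G‖ ^ 4 + ((B / n) ^ 4 * ‖G i‖ ^ 4 + (B / n) ^ 4 * ‖G l‖ ^ 4)) := by
    intro G
    -- The power mean inequality for three terms produces the factor 27 = 3³.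
    have hpm := Real.pow_arith_mean_le_arith_mean_pow (Finset.univ : Finset (Fin 3))
      (fun _ => 1 / 3) ![‖H G‖, B / n * ‖G i‖, B / n * ‖G l‖] (by simp) (by simp)
      (by
        intro j _
        fin_cases j <;> simp <;> positivity) 4
    simp only [Fin.sum_univ_three, Matrix.cons_val_zero, Matrix.cons_val_one,
      Matrix.cons_val_two, Matrix.head_cons, Matrix.tail_cons] at hpm
    have e : (1 / 3 * ‖H G‖ + 1 / 3 * (B / n * ‖G i‖) + 1 / 3 * (B / n * ‖G l‖)) ^ 4 =
        (1 / 81) * (‖H G‖ + B / n * (‖G i‖ + ‖G l‖)) ^ 4 := by ring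
    rw [e, mul_pow, mul_pow] at hpm
    linarith
  calc _ ≤ ∫ G, 27 * (‖H G‖ ^ 4 + ((B / n) ^ 4 * ‖G i‖ ^ 4 + (B / n) ^ 4 * ‖G l‖ ^ 4))
        ∂gaussianRows n p :=
        integral_mono (PolyGrowth.integrable (by fun_prop))
          (PolyGrowth.integrable (by fun_prop)) hle
    _ = 27 * (∫ G, ‖H G‖ ^ 4 ∂gaussianRows n p +
        ((B / n) ^ 4 * ∫ G, ‖G i‖ ^ 4 ∂gaussianRows n p +
          (B / n) ^ 4 * ∫ G, ‖G l‖ ^ 4 ∂gaussianRows n p)) := by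
        rw [integral_const_mul, integral_add (PolyGrowth.integrable (by fun_prop))
          (PolyGrowth.integrable (by fun_prop)), integral_add
          (PolyGrowth.integrable (by fun_prop)) (PolyGrowth.integrable (by fun_prop)),
          integral_const_mul, integral_const_mul]
    _ ≤ _ := by
        have h5 := integral_norm_pow_four_le hH hn hγ hp hB hτ
        have h6 := h4 i
        have h7 := h4 l
        unfold perturbedMomentBound
        linarith

end IsLeaveOneOutStable

end LeaveOneOut

/-! ### Second moments of sums of leave-one-out quantities. -/

namespace IsLeaveOneOutStable

variable {n p : ℕ} {γ B M : ℝ} {τ : EuclideanSpace ℝ (Fin p)}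
  {H : (Fin n → EuclideanSpace ℝ (Fin p)) → EuclideanSpace ℝ (Fin p)}

theorem norm_update_le (hH : IsLeaveOneOutStable B τ H)
    (G : Fin n → EuclideanSpace ℝ (Fin p)) (i : Fin n) :
    ‖H (Function.update G i 0)‖ ≤ ‖H G‖ + B / n * ‖G i‖ := by
  have h := norm_sub_le (H G) (H G - H (Function.update G i 0))
  rw [sub_sub_cancel] at h
  exact h.trans (add_le_add le_rfl (hH.norm_sub_update_le G i))

theorem norm_update_update_sub_le (hH : IsLeaveOneOutStable B τ H)
    (G : Fin n → EuclideanSpace ℝ (Fin p)) {i l : Fin n} (hil : i ≠ l) :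
    ‖H (Function.update G i 0) - H (Function.update (Function.update G i 0) l 0)‖ ≤
      B / n * ‖G l‖ := by
  have h := hH.norm_sub_update_le (Function.update G i 0) l
  rwa [Function.update_of_ne hil.symm] at h

variable (hH : IsLeaveOneOutStable B τ H) (hn : 0 < n) (hγ : 0 < γ) (hp : (p : ℝ) ≤ γ * n)
  (hB : 0 ≤ B) (hτ : ‖τ‖ ^ 2 ≤ M)

include hH hn hγ hp hB hτ

theorem perturbedMomentBound_nonneg : 0 ≤ perturbedMomentBound γ B M :=
  (integral_nonneg fun G => by positivity).trans
    (integral_envelope_pow_four_le hH hn hγ hp hB hτ ⟨0, hn⟩ ⟨0, hn⟩)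

/-- The squared norm of a row has order n while the envelope has order 1, so the product is split
with weights 1/(2n) and n/2. -/
theorem integral_norm_sq_mul_envelope_sq_le (i l : Fin n) :
    ∫ G, ‖G l‖ ^ 2 * (‖H G‖ + B / n * (‖G i‖ + ‖G l‖)) ^ 2 ∂gaussianRows n p ≤
      n * ((gaussianFourthMoment * γ ^ 2 + perturbedMomentBound γ B M) / 2) := by
  have hn' : (0 : ℝ) < n := by exact_mod_cast hn
  have hpg := hH.polyGrowth hB
  have hκ := gaussianFourthMoment_nonneg
  have hle : ∀ G, ‖G l‖ ^ 2 * (‖H G‖ + B / n * (‖G i‖ + ‖G l‖)) ^ 2 ≤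
      (1 / (2 * n)) * ‖G l‖ ^ 4 + (n / 2) * (‖H G‖ + B / n * (‖G i‖ + ‖G l‖)) ^ 4 := by
    intro G
    have h : (1 / (2 * n)) * ‖G l‖ ^ 4 + (n / 2) * (‖H G‖ + B / n * (‖G i‖ + ‖G l‖)) ^ 4 -
        ‖G l‖ ^ 2 * (‖H G‖ + B / n * (‖G i‖ + ‖G l‖)) ^ 2 =
        (1 / (2 * n)) * (‖G l‖ ^ 2 - n * (‖H G‖ + B / n * (‖G i‖ + ‖G l‖)) ^ 2) ^ 2 := by
      field_simp
      ring
    have h2 : 0 ≤ (1 / (2 * (n : ℝ))) *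
        (‖G l‖ ^ 2 - n * (‖H G‖ + B / n * (‖G i‖ + ‖G l‖)) ^ 2) ^ 2 := by positivity
    linarith
  have h1 := integral_norm_pow_four_gaussianRows_le (p := p) l
  have h2 : (p : ℝ) ^ 2 ≤ (γ * n) ^ 2 := by gcongr
  have h3 := integral_envelope_pow_four_le hH hn hγ hp hB hτ i l
  calc _ ≤ ∫ G, ((1 / (2 * n)) * ‖G l‖ ^ 4 +
        (n / 2) * (‖H G‖ + B / n * (‖G i‖ + ‖G l‖)) ^ 4) ∂gaussianRows n p :=
        integral_mono (PolyGrowth.integrable (by fun_prop))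
          (PolyGrowth.integrable (by fun_prop)) hle
    _ = (1 / (2 * n)) * ∫ G, ‖G l‖ ^ 4 ∂gaussianRows n p +
        (n / 2) * ∫ G, (‖H G‖ + B / n * (‖G i‖ + ‖G l‖)) ^ 4 ∂gaussianRows n p := by
        rw [integral_add (PolyGrowth.integrable (by fun_prop))
          (PolyGrowth.integrable (by fun_prop)), integral_const_mul, integral_const_mul]
    _ ≤ (1 / (2 * n)) * (gaussianFourthMoment * (γ * n) ^ 2) +
        (n / 2) * perturbedMomentBound γ B M := by
        gcongr
        exact h1.trans (by gcongr)
    _ = _ := by field_simp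

theorem integral_envelope_sq_le (i l : Fin n) :
    ∫ G, (‖H G‖ + B / n * (‖G i‖ + ‖G l‖)) ^ 2 ∂gaussianRows n p ≤
      1 + perturbedMomentBound γ B M := by
  have hpg := hH.polyGrowth hB
  calc _ ≤ ∫ G, (1 + (‖H G‖ + B / n * (‖G i‖ + ‖G l‖)) ^ 4) ∂gaussianRows n p :=
        integral_mono (PolyGrowth.integrable (by fun_prop))
          (PolyGrowth.integrable (by fun_prop)) fun G => by
          simp only
          nlinarith [sq_nonneg ((‖H G‖ + B / n * (‖G i‖ + ‖G l‖)) ^ 2 - 1),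
            sq_nonneg ((‖H G‖ + B / n * (‖G i‖ + ‖G l‖)) ^ 2)]
    _ = 1 + ∫ G, (‖H G‖ + B / n * (‖G i‖ + ‖G l‖)) ^ 4 ∂gaussianRows n p := by
        rw [integral_add (integrable_const _) (PolyGrowth.integrable (by fun_prop))]
        simp
    _ ≤ _ := by
        gcongr
        exact integral_envelope_pow_four_le hH hn hγ hp hB hτ i l

theorem integral_inner_update_sq_le (i : Fin n) :
    ∫ G, inner ℝ (G i) (H (Function.update G i 0)) ^ 2 ∂gaussianRows n p ≤
      1 + perturbedMomentBound γ B M := by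
  have hpg := hH.polyGrowth hB
  rw [integral_inner_row_sq i hpg]
  refine le_trans (integral_mono (PolyGrowth.integrable (by fun_prop))
    (PolyGrowth.integrable (by fun_prop)) fun G => ?_)
    (integral_envelope_sq_le hH hn hγ hp hB hτ i i)
  simp only
  gcongr
  refine (hH.norm_update_le G i).trans ?_
  have : 0 ≤ ‖G i‖ := norm_nonneg _
  gcongr
  linarith

/-- The linear forms in the leave-one-out inner products have bounded variance. -/
theorem integral_sq_sum_mul_inner_update_le (a : Fin n → ℝ) :
    ∫ G, (∑ i, a i * inner ℝ (G i) (H (Function.update G i 0))) ^ 2 ∂gaussianRows n p ≤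
      (∑ i, a i ^ 2) * (1 + perturbedMomentBound γ B M + B ^ 2 * γ) := by
  have hn' : (0 : ℝ) < n := by exact_mod_cast hn
  have hpg := hH.polyGrowth hB
  -- D has order 1/n: zeroing row l moves H^(i) by at most (B/n)‖G_l‖, and E‖G_l‖² = p ≤ γn.
  have h := integral_sq_sum_mul_le (n := n) (p := p)
    (T := fun i G => inner ℝ (G i) (H (Function.update G i 0)))
    (fun i => by fun_prop) (fun i G => by simp [integral_inner_stdGaussian])
    (integral_inner_update_sq_le hH hn hγ hp hB hτ) (D := B ^ 2 * γ / n) ?_ (by positivity) a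
  · rwa [mul_div_cancel₀ _ hn'.ne'] at h
  intro i l hil
  have e : ∀ G : Fin n → EuclideanSpace ℝ (Fin p),
      inner ℝ (G i) (H (Function.update G i 0)) -
        inner ℝ (Function.update G l 0 i) (H (Function.update (Function.update G l 0) i 0)) =
      inner ℝ (G i) ((fun G => H G - H (Function.update G l 0)) (Function.update G i 0)) := by
    intro G
    rw [Function.update_of_ne hil, Function.update_comm hil.symm, ← inner_sub_right]
  simp_rw [e]
  rw [integral_inner_row_sq i (A := fun G => H G - H (Function.update G l 0)) (by fun_prop)]
  calc _ ≤ ∫ G, (B / n) ^ 2 * ‖G l‖ ^ 2 ∂gaussianRows n p := by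
        refine integral_mono (PolyGrowth.integrable (by fun_prop))
          (PolyGrowth.integrable (by fun_prop)) fun G => ?_
        simp only
        rw [← mul_pow]
        gcongr
        exact hH.norm_update_update_sub_le G hil
    _ = (B / n) ^ 2 * p := by rw [integral_const_mul, integral_norm_sq_gaussianRows]
    _ ≤ (B / n) ^ 2 * (γ * n) := by gcongr
    _ = _ := by field_simp

/-- A bound on the variance of the leave-one-out quadratic forms. -/
noncomputable def _root_.quadraticVarianceBound (γ B M : ℝ) : ℝ :=
  2 * (gaussianFourthMoment + 1) * perturbedMomentBound γ B M +
    4 * (gaussianFourthMoment + 1) * B ^ 2 *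
      (gaussianFourthMoment * γ ^ 2 + perturbedMomentBound γ B M)

/-- Given the other rows, the i-th summand is centred because E⟨G_i, u⟩² = ‖u‖² for fixed u. Almost
orthogonality then keeps the variance of the sum of order n. -/
theorem integral_sq_sum_inner_update_sq_sub_le :
    ∫ G, (∑ i, (inner ℝ (G i) (H (Function.update G i 0)) ^ 2 -
      ‖H (Function.update G i 0)‖ ^ 2)) ^ 2 ∂gaussianRows n p ≤
      n * quadraticVarianceBound γ B M := by
  have hn' : (0 : ℝ) < n := by exact_mod_cast hn
  have hpg := hH.polyGrowth hB
  have hκ := gaussianFourthMoment_nonneg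
  have hC := perturbedMomentBound_nonneg hH hn hγ hp hB hτ
  have h := integral_sq_sum_mul_le (n := n) (p := p)
    (T := fun i G => inner ℝ (G i) (H (Function.update G i 0)) ^ 2 -
      ‖H (Function.update G i 0)‖ ^ 2)
    (fun i => by fun_prop) (fun i G => ?_) (v := 2 * (gaussianFourthMoment + 1) *
      perturbedMomentBound γ B M) (fun i => ?_)
    (D := 4 * (gaussianFourthMoment + 1) * B ^ 2 *
      (gaussianFourthMoment * γ ^ 2 + perturbedMomentBound γ B M) / n) ?_ (by positivity)
    (fun _ => 1)
  · rw [mul_div_cancel₀ _ hn'.ne'] at h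
    simpa [quadraticVarianceBound] using h
  · simp only [Function.update_self, Function.update_idem]
    rw [integral_sub, integral_inner_sq_stdGaussian]
    · simp
    · refine integrable_of_norm_le_pow_stdGaussian (by fun_prop)
        (‖H (Function.update G i 0)‖ ^ 2) 2 fun x => ?_
      rw [abs_pow, ← mul_pow]
      gcongr
      have := abs_real_inner_le_norm x (H (Function.update G i 0))
      nlinarith [norm_nonneg (H (Function.update G i 0))]
    · exact integrable_const _
  · rw [integral_row_gaussianRows i (φ := fun x G => (inner ℝ x (H G) ^ 2 - ‖H G‖ ^ 2) ^ 2)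
      (by fun_prop)]
    have hrow : ∀ G : Fin n → EuclideanSpace ℝ (Fin p),
        ∫ x, (inner ℝ x (H (Function.update G i 0)) ^ 2 -
        ‖H (Function.update G i 0)‖ ^ 2) ^ 2 ∂stdGaussian (EuclideanSpace ℝ (Fin p)) ≤
        2 * (gaussianFourthMoment + 1) * (‖H G‖ + B / n * (‖G i‖ + ‖G i‖)) ^ 4 := by
      intro G
      have h1 := integral_sq_inner_mul_inner_sub_le (H (Function.update G i 0))
        (H (Function.update G i 0))
      simp only [real_inner_self_eq_norm_sq, ← pow_two] at h1
      refine h1.trans ?_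
      rw [← pow_mul]
      gcongr
      refine (hH.norm_update_le G i).trans ?_
      have : 0 ≤ ‖G i‖ := norm_nonneg _
      gcongr
      linarith
    refine (integral_mono_of_nonneg (ae_of_all _ fun G => integral_nonneg fun x => by positivity)
      (PolyGrowth.integrable (by fun_prop)) (ae_of_all _ hrow)).trans ?_
    rw [integral_const_mul]
    gcongr
    exact integral_envelope_pow_four_le hH hn hγ hp hB hτ i i
  · intro i l hil
    -- Polarization: a difference of two quadratic forms is the centred bilinear form in the
    -- difference and the sum of the vectors. The difference supplies the factor (B/n)‖G_l‖.
    have e : ∀ G : Fin n → EuclideanSpace ℝ (Fin p),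
        (inner ℝ (G i) (H (Function.update G i 0)) ^ 2 - ‖H (Function.update G i 0)‖ ^ 2) -
        (inner ℝ (Function.update G l 0 i)
          (H (Function.update (Function.update G l 0) i 0)) ^ 2 -
          ‖H (Function.update (Function.update G l 0) i 0)‖ ^ 2) =
        (fun x G => inner ℝ x (H G - H (Function.update G l 0)) *
          inner ℝ x (H G + H (Function.update G l 0)) -
          inner ℝ (H G - H (Function.update G l 0)) (H G + H (Function.update G l 0)))
          (G i) (Function.update G i 0) := by
      intro G
      simp only
      rw [Function.update_of_ne hil, Function.update_comm hil.symm]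
      simp only [inner_sub_right, inner_add_right, inner_sub_left, real_inner_self_eq_norm_sq]
      rw [real_inner_comm (H (Function.update G i 0))
        (H (Function.update (Function.update G i 0) l 0))]
      ring
    simp_rw [e]
    rw [integral_row_gaussianRows i (φ := fun x G => (inner ℝ x (H G - H (Function.update G l 0)) *
          inner ℝ x (H G + H (Function.update G l 0)) -
          inner ℝ (H G - H (Function.update G l 0)) (H G + H (Function.update G l 0))) ^ 2)
      (by fun_prop)]
    have hrow : ∀ G : Fin n → EuclideanSpace ℝ (Fin p),
        ∫ x, (inner ℝ x (H (Function.update G i 0) -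
            H (Function.update (Function.update G i 0) l 0)) *
          inner ℝ x (H (Function.update G i 0) +
            H (Function.update (Function.update G i 0) l 0)) -
          inner ℝ (H (Function.update G i 0) - H (Function.update (Function.update G i 0) l 0))
            (H (Function.update G i 0) + H (Function.update (Function.update G i 0) l 0))) ^ 2
          ∂stdGaussian (EuclideanSpace ℝ (Fin p)) ≤
        8 * (gaussianFourthMoment + 1) * (B / n) ^ 2 *
          (‖G l‖ ^ 2 * (‖H G‖ + B / n * (‖G i‖ + ‖G l‖)) ^ 2) := by
      intro G
      have h1 := hH.norm_update_update_sub_le G hil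
      have h2 := hH.norm_update_le G i
      have h3 : ‖H (Function.update (Function.update G i 0) l 0)‖ ≤
          ‖H (Function.update G i 0)‖ + B / n * ‖G l‖ := by
        have := hH.norm_update_le (Function.update G i 0) l
        rwa [Function.update_of_ne hil.symm] at this
      have h4 : ‖H (Function.update G i 0) +
          H (Function.update (Function.update G i 0) l 0)‖ ≤
          2 * (‖H G‖ + B / n * (‖G i‖ + ‖G l‖)) := by
        refine (norm_add_le _ _).trans ?_
        have : 0 ≤ B / n * ‖G l‖ := by positivity
        linarith
      refine (integral_sq_inner_mul_inner_sub_le _ _).trans ?_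
      calc _ ≤ 2 * (gaussianFourthMoment + 1) * ((B / n * ‖G l‖) ^ 2 *
            (2 * (‖H G‖ + B / n * (‖G i‖ + ‖G l‖))) ^ 2) := by gcongr
        _ = _ := by ring
    refine (integral_mono_of_nonneg (ae_of_all _ fun G => integral_nonneg fun x => by positivity)
      (PolyGrowth.integrable (by fun_prop)) (ae_of_all _ hrow)).trans ?_
    rw [integral_const_mul]
    calc _ ≤ 8 * (gaussianFourthMoment + 1) * (B / n) ^ 2 *
          (n * ((gaussianFourthMoment * γ ^ 2 + perturbedMomentBound γ B M) / 2)) := by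
          gcongr
          exact integral_norm_sq_mul_envelope_sq_le hH hn hγ hp hB hτ i l
      _ = _ := by
          field_simp
          ring

/-- Each summand is at most (B/n)‖G_i‖ times twice the envelope, of order n^{-1/2}, so absolute
values may be summed. The weight √n balances the row norm against the envelope. -/
theorem integral_abs_sum_norm_update_sq_sub_le :
    ∫ G, |∑ i, (‖H (Function.update G i 0)‖ ^ 2 - ‖H G‖ ^ 2)| ∂gaussianRows n p ≤
      √n * (B * (γ + 1 + perturbedMomentBound γ B M)) := by
  have hn' : (0 : ℝ) < n := by exact_mod_cast hn
  have hs : 0 < √(n : ℝ) := Real.sqrt_pos.2 hn'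
  have hss : √(n : ℝ) * √n = n := Real.mul_self_sqrt hn'.le
  have hpg := hH.polyGrowth hB
  have hle : ∀ G, |∑ i, (‖H (Function.update G i 0)‖ ^ 2 - ‖H G‖ ^ 2)| ≤
      ∑ i, (B / n * (‖G i‖ ^ 2 / √n + √n * (‖H G‖ + B / n * (‖G i‖ + ‖G i‖)) ^ 2)) := by
    intro G
    refine (Finset.abs_sum_le_sum_abs _ _).trans (Finset.sum_le_sum fun i _ => ?_)
    have h1 := hH.norm_sub_update_le G i
    have h2 := hH.norm_update_le G i
    have h0 : 0 ≤ ‖G i‖ := norm_nonneg _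
    have h00 : 0 ≤ B / n * ‖G i‖ := by positivity
    set N := ‖H G‖ + B / n * (‖G i‖ + ‖G i‖) with hN
    have h3 : |‖H (Function.update G i 0)‖ - ‖H G‖| ≤ B / n * ‖G i‖ := by
      rw [abs_sub_comm]
      exact (abs_norm_sub_norm_le _ _).trans h1
    have h4 : |‖H (Function.update G i 0)‖ + ‖H G‖| ≤ 2 * N := by
      rw [abs_of_nonneg (by positivity)]
      linarith
    calc |‖H (Function.update G i 0)‖ ^ 2 - ‖H G‖ ^ 2| =
          |‖H (Function.update G i 0)‖ - ‖H G‖| * |‖H (Function.update G i 0)‖ + ‖H G‖| := by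
          rw [← abs_mul]; congr 1; ring
      _ ≤ B / n * ‖G i‖ * (2 * N) := by gcongr
      _ = B / n * (2 * ‖G i‖ * N) := by ring
      _ ≤ _ := by
          gcongr
          have h5 : ‖G i‖ ^ 2 / √n + √n * N ^ 2 - 2 * ‖G i‖ * N =
              (‖G i‖ - √n * N) ^ 2 / √n := by
            field_simp
            ring
          have h6 : 0 ≤ (‖G i‖ - √n * N) ^ 2 / √n := by positivity
          linarith
  calc _ ≤ ∫ G, ∑ i, (B / n * (‖G i‖ ^ 2 / √n +
        √n * (‖H G‖ + B / n * (‖G i‖ + ‖G i‖)) ^ 2)) ∂gaussianRows n p := by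
        refine integral_mono_of_nonneg (ae_of_all _ fun G => abs_nonneg _)
          (PolyGrowth.integrable ?_) (ae_of_all _ hle)
        simp only [div_eq_mul_inv]
        fun_prop
    _ = ∑ i : Fin n, B / n * ((∫ G, ‖G i‖ ^ 2 ∂gaussianRows n p) / √n +
        √n * ∫ G, (‖H G‖ + B / n * (‖G i‖ + ‖G i‖)) ^ 2 ∂gaussianRows n p) := by
        rw [integral_finsetSum]
        · refine Finset.sum_congr rfl fun i _ => ?_
          rw [integral_const_mul, integral_add, integral_div, integral_const_mul]
          · exact (PolyGrowth.integrable (by fun_prop)).div_const _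
          · exact PolyGrowth.integrable (by fun_prop)
        · intro i _
          refine PolyGrowth.integrable ?_
          simp only [div_eq_mul_inv]
          fun_prop
    _ ≤ ∑ _i : Fin n, B / n * (γ * n / √n + √n * (1 + perturbedMomentBound γ B M)) := by
        gcongr with i
        · rw [integral_norm_sq_gaussianRows]
          exact hp
        · exact integral_envelope_sq_le hH hn hγ hp hB hτ i i
    _ = _ := by
        simp only [Finset.sum_const, Finset.card_univ, Fintype.card_fin, nsmul_eq_mul]
        have : γ * n / √n = γ * √n := by
          rw [mul_div_assoc, Real.div_sqrt]
        rw [this]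
        field_simp
        ring

theorem integral_norm_sq_mul_norm_sq_le (i : Fin n) :
    ∫ G, ‖G i‖ ^ 2 * ‖H G‖ ^ 2 ∂gaussianRows n p ≤
      n * ((gaussianFourthMoment * γ ^ 2 + perturbedMomentBound γ B M) / 2) := by
  have hpg := hH.polyGrowth hB
  refine le_trans (integral_mono (PolyGrowth.integrable (by fun_prop))
    (PolyGrowth.integrable (by fun_prop)) fun G => ?_)
    (integral_norm_sq_mul_envelope_sq_le hH hn hγ hp hB hτ i i)
  simp only
  have : 0 ≤ B / n * (‖G i‖ + ‖G i‖) := by positivity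
  gcongr
  linarith

end IsLeaveOneOutStable

/-! ### The Stein inequality in a single row. -/

section RowStein

open EuclideanSpace
open scoped NNReal

variable {m n p : ℕ}

/-- The divergence of `H` with respect to the row `i`. -/
noncomputable def rowDivergence (i : Fin n)
    (H : (Fin n → EuclideanSpace ℝ (Fin p)) → EuclideanSpace ℝ (Fin p))
    (G : Fin n → EuclideanSpace ℝ (Fin p)) : ℝ :=
  ∑ j, partialDeriv j (fun x => H (Function.update G i x) j) (G i)

/-- The squared Frobenius norm of the derivative of `H` with respect to the row `i`. -/
noncomputable def rowSqDeriv (i : Fin n)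
    (H : (Fin n → EuclideanSpace ℝ (Fin p)) → EuclideanSpace ℝ (Fin p))
    (G : Fin n → EuclideanSpace ℝ (Fin p)) : ℝ :=
  ∑ j, ∑ k, partialDeriv k (fun x => H (Function.update G i x) j) (G i) ^ 2

/-- The difference between the divergence form of `⟨G i, H G⟩` and its leave-one-out version. -/
noncomputable def steinError (i : Fin n)
    (H : (Fin n → EuclideanSpace ℝ (Fin p)) → EuclideanSpace ℝ (Fin p))
    (G : Fin n → EuclideanSpace ℝ (Fin p)) : ℝ :=
  inner ℝ (G i) (H G) - rowDivergence i H G - inner ℝ (G i) (H (Function.update G i 0))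

variable {F : EuclideanSpace ℝ (Fin m) → (Fin n → EuclideanSpace ℝ (Fin p)) →
    EuclideanSpace ℝ (Fin p)}

/-- Measurability is joint in a parameter and the rows because the noise is later integrated as
well; joint continuity of F provides it. -/
theorem measurable_partialDeriv_row (hF : Continuous F.uncurry) (i : Fin n) (j k : Fin p) :
    Measurable fun z : EuclideanSpace ℝ (Fin m) × (Fin n → EuclideanSpace ℝ (Fin p)) =>
      partialDeriv k (fun x => F z.1 (Function.update z.2 i x) j) (z.2 i) := by
  let f : EuclideanSpace ℝ (Fin m) × (Fin n → EuclideanSpace ℝ (Fin p)) →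
    EuclideanSpace ℝ (Fin p) → ℝ := fun z x => F z.1 (Function.update z.2 i x) j
  have hf : Continuous f.uncurry := by
    have h1 : Continuous fun w : (EuclideanSpace ℝ (Fin m) ×
        (Fin n → EuclideanSpace ℝ (Fin p))) × EuclideanSpace ℝ (Fin p) =>
        F.uncurry (w.1.1, Function.update w.1.2 i w.2) :=
      hF.comp (continuous_fst.fst.prodMk (continuous_fst.snd.update i continuous_snd))
    change Continuous fun w : (EuclideanSpace ℝ (Fin m) ×
        (Fin n → EuclideanSpace ℝ (Fin p))) × EuclideanSpace ℝ (Fin p) =>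
        F.uncurry (w.1.1, Function.update w.1.2 i w.2) j
    fun_prop
  have h2 := measurable_fderiv_apply_const_with_param ℝ hf (single k (1 : ℝ))
  exact h2.comp (measurable_id.prodMk ((measurable_pi_apply i).comp measurable_snd))

theorem measurable_rowSqDeriv (hF : Continuous F.uncurry) (i : Fin n) :
    Measurable fun z : EuclideanSpace ℝ (Fin m) × (Fin n → EuclideanSpace ℝ (Fin p)) =>
      rowSqDeriv i (F z.1) z.2 := by
  unfold rowSqDeriv
  exact Finset.measurable_sum _ fun j _ => Finset.measurable_sum _ fun k _ =>
    (measurable_partialDeriv_row hF i j k).pow_const 2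

theorem measurable_steinError (hF : Continuous F.uncurry) (i : Fin n) :
    Measurable fun z : EuclideanSpace ℝ (Fin m) × (Fin n → EuclideanSpace ℝ (Fin p)) =>
      steinError i (F z.1) z.2 := by
  unfold steinError rowDivergence
  have h1 : Continuous fun z : EuclideanSpace ℝ (Fin m) × (Fin n → EuclideanSpace ℝ (Fin p)) =>
      F.uncurry (z.1, z.2) := hF.comp (by fun_prop)
  have h2 : Continuous fun z : EuclideanSpace ℝ (Fin m) × (Fin n → EuclideanSpace ℝ (Fin p)) =>
      F.uncurry (z.1, Function.update z.2 i 0) :=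
    hF.comp (continuous_fst.prodMk (continuous_snd.update i continuous_const))
  have h3 : Continuous fun z : EuclideanSpace ℝ (Fin m) × (Fin n → EuclideanSpace ℝ (Fin p)) =>
      inner ℝ (z.2 i) (F.uncurry (z.1, z.2)) := by fun_prop
  have h4 : Continuous fun z : EuclideanSpace ℝ (Fin m) × (Fin n → EuclideanSpace ℝ (Fin p)) =>
      inner ℝ (z.2 i) (F.uncurry (z.1, Function.update z.2 i 0)) := by fun_prop
  exact (h3.measurable.sub (Finset.measurable_sum _ fun j _ =>
    measurable_partialDeriv_row hF i j j)).sub h4.measurable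

theorem dist_update_le (G : Fin n → EuclideanSpace ℝ (Fin p)) (i : Fin n)
    (x y : EuclideanSpace ℝ (Fin p)) :
    dist (Function.update G i x) (Function.update G i y) ≤ dist x y := by
  refine (dist_pi_le_iff dist_nonneg).2 fun l => ?_
  rcases eq_or_ne l i with rfl | h
  · simp
  · simp [h]

variable {H : (Fin n → EuclideanSpace ℝ (Fin p)) → EuclideanSpace ℝ (Fin p)}

theorem exists_lipschitzOnWith_row
    (hH : ∀ R : ℝ, ∃ K : ℝ≥0, LipschitzOnWith K H (Metric.closedBall 0 R)) (i : Fin n)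
    (G : Fin n → EuclideanSpace ℝ (Fin p)) (R : ℝ) :
    ∃ K : ℝ≥0, ∀ j, LipschitzOnWith K (fun x => H (Function.update G i x) j)
      (Metric.closedBall 0 R) := by
  obtain ⟨K, hK⟩ := hH (max R ‖G‖)
  refine ⟨K, fun j => LipschitzOnWith.of_dist_le_mul fun x hx y hy => ?_⟩
  have hmem : ∀ x ∈ Metric.closedBall (0 : EuclideanSpace ℝ (Fin p)) R,
      Function.update G i x ∈ Metric.closedBall (0 : Fin n → EuclideanSpace ℝ (Fin p))
        (max R ‖G‖) := by
    intro x hx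
    rw [mem_closedBall_zero_iff] at hx ⊢
    refine (pi_norm_le_iff_of_nonneg (le_max_of_le_right (norm_nonneg G))).2 fun l => ?_
    rcases eq_or_ne l i with rfl | h
    · simpa using Or.inl hx
    · rw [Function.update_of_ne h]
      exact le_max_of_le_right (norm_le_pi_norm G l)
  have h1 := hK.dist_le_mul _ (hmem x hx) _ (hmem y hy)
  refine le_trans ?_ (h1.trans (mul_le_mul_of_nonneg_left (dist_update_le G i x y) K.2))
  rw [Real.dist_eq, dist_eq_norm, ← PiLp.sub_apply]
  exact PiLp.norm_apply_le (H (Function.update G i x) - H (Function.update G i y)) j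

/-- The parameter is specialized to the one-point space of dimension zero. -/
theorem measurable_steinError_of_continuous (hHc : Continuous H) (i : Fin n) :
    Measurable (steinError i H) := by
  have hc : Continuous (Function.uncurry fun _ : EuclideanSpace ℝ (Fin 0) => H) := by
    have := hHc.comp (continuous_snd (X := EuclideanSpace ℝ (Fin 0)))
    exact this
  have h := (measurable_steinError (F := fun _ => H) hc i).comp
    (measurable_prodMk_left (x := (0 : EuclideanSpace ℝ (Fin 0))))
  simp only [Function.comp_def] at h
  exact h

theorem measurable_rowSqDeriv_of_continuous (hHc : Continuous H) (i : Fin n) :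
    Measurable (rowSqDeriv i H) := by
  have hc : Continuous (Function.uncurry fun _ : EuclideanSpace ℝ (Fin 0) => H) := by
    have := hHc.comp (continuous_snd (X := EuclideanSpace ℝ (Fin 0)))
    exact this
  have h := (measurable_rowSqDeriv (F := fun _ => H) hc i).comp
    (measurable_prodMk_left (x := (0 : EuclideanSpace ℝ (Fin 0))))
  simp only [Function.comp_def] at h
  exact h

/-- The Stein inequality is applied, with the other rows frozen, to H - H^(i). Subtracting H^(i), a
constant in row i, leaves the derivatives unchanged and turns the zeroth order term into the small
‖H - H^(i)‖² instead of ‖H‖². -/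
theorem lintegral_sq_steinError_le
    (hH : ∀ R : ℝ, ∃ K : ℝ≥0, LipschitzOnWith K H (Metric.closedBall 0 R)) (hHc : Continuous H)
    (i : Fin n) :
    ∫⁻ G, ENNReal.ofReal (steinError i H G ^ 2) ∂gaussianRows n p ≤
      ∫⁻ G, ENNReal.ofReal (3 * (‖H G - H (Function.update G i 0)‖ ^ 2 + rowSqDeriv i H G))
        ∂gaussianRows n p := by
  have hm1 := measurable_steinError_of_continuous hHc i
  have hm2 := measurable_rowSqDeriv_of_continuous hHc i
  have hm3 : Measurable fun G => ‖H G - H (Function.update G i 0)‖ :=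
    (Continuous.norm (hHc.sub (hHc.comp (continuous_id.update i continuous_const)))).measurable
  rw [lintegral_pi_eq_lintegral_update _ i (hm1.pow_const 2).ennreal_ofReal,
    lintegral_pi_eq_lintegral_update _ i
      (f := fun G => ENNReal.ofReal (3 * (‖H G - H (Function.update G i 0)‖ ^ 2 +
        rowSqDeriv i H G))) (((hm3.pow_const 2).add hm2).const_mul 3).ennreal_ofReal]
  refine lintegral_mono fun G => ?_
  have h := lintegral_sq_gaussianDivergence_le (p := p)
    (f := fun j x => H (Function.update G i x) j - H (Function.update G i 0) j) (fun R => by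
      obtain ⟨K, hK⟩ := exists_lipschitzOnWith_row hH i G R
      exact ⟨K, fun j => LipschitzOnWith.of_dist_le_mul fun x hx y hy => by
        simpa only [dist_sub_right] using (hK j).dist_le_mul x hx y hy⟩)
  have e1 : ∀ x, steinError i H (Function.update G i x) =
      ∑ j, gaussianAdjoint j
        (fun x => H (Function.update G i x) j - H (Function.update G i 0) j) x := by
    intro x
    simp only [steinError, rowDivergence, gaussianAdjoint, partialDeriv, Function.update_self,
      Function.update_idem, fderiv_sub_const, PiLp.inner_apply, RCLike.inner_apply, conj_trivial]
    rw [← Finset.sum_sub_distrib, ← Finset.sum_sub_distrib]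
    exact Finset.sum_congr rfl fun j _ => by ring
  have e2 : ∀ x, ‖H (Function.update G i x) - H (Function.update (Function.update G i x) i 0)‖ ^ 2 +
      rowSqDeriv i H (Function.update G i x) =
      ∑ j, (H (Function.update G i x) j - H (Function.update G i 0) j) ^ 2 +
        ∑ j, ∑ k, partialDeriv k
          (fun x => H (Function.update G i x) j - H (Function.update G i 0) j) x ^ 2 := by
    intro x
    simp only [rowSqDeriv, partialDeriv, Function.update_self, Function.update_idem,
      fderiv_sub_const, EuclideanSpace.real_norm_sq_eq, PiLp.sub_apply]
  simp_rw [e1, e2]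
  exact h

end RowStein

/-! ### The fluctuation of the criterion for fixed noise. -/

section Fluctuation

open scoped NNReal

variable {m n p : ℕ}

/-- The vector of leave-one-out inner products `⟨G i, H (G with row i replaced by 0)⟩`. -/
noncomputable def leaveOneOutVector
    (H : (Fin n → EuclideanSpace ℝ (Fin p)) → EuclideanSpace ℝ (Fin p))
    (G : Fin n → EuclideanSpace ℝ (Fin p)) : EuclideanSpace ℝ (Fin n) :=
  WithLp.toLp 2 fun i => inner ℝ (G i) (H (Function.update G i 0))

theorem leaveOneOutVector_apply
    (H : (Fin n → EuclideanSpace ℝ (Fin p)) → EuclideanSpace ℝ (Fin p))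
    (G : Fin n → EuclideanSpace ℝ (Fin p)) (i : Fin n) :
    leaveOneOutVector H G i = inner ℝ (G i) (H (Function.update G i 0)) := rfl

/-- A bound on the squared distance between the debiased residuals and their leave-one-out
version. -/
noncomputable def remainderSq (μ : ℝ)
    (H : (Fin n → EuclideanSpace ℝ (Fin p)) → EuclideanSpace ℝ (Fin p))
    (G : Fin n → EuclideanSpace ℝ (Fin p)) : ℝ :=
  ∑ i, (2 * steinError i H G ^ 2 + 2 * (n * μ)⁻¹ ^ 2 * (‖G i‖ ^ 2 * ‖H G‖ ^ 2))

theorem remainderSq_nonneg (μ : ℝ)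
    (H : (Fin n → EuclideanSpace ℝ (Fin p)) → EuclideanSpace ℝ (Fin p))
    (G : Fin n → EuclideanSpace ℝ (Fin p)) : 0 ≤ remainderSq μ H G :=
  Finset.sum_nonneg fun i _ => by positivity

/-- The part of the fluctuation that only involves leave-one-out inner products. -/
noncomputable def leaveOneOutFluctuation (a : ℝ) (e : EuclideanSpace ℝ (Fin n))
    (H : (Fin n → EuclideanSpace ℝ (Fin p)) → EuclideanSpace ℝ (Fin p))
    (G : Fin n → EuclideanSpace ℝ (Fin p)) : ℝ :=
  2 / (a * n) * (|∑ i, (inner ℝ (G i) (H (Function.update G i 0)) ^ 2 -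
      ‖H (Function.update G i 0)‖ ^ 2)| +
    |∑ i, (‖H (Function.update G i 0)‖ ^ 2 - ‖H G‖ ^ 2)| +
    (∑ i, inner ℝ (G i) (H (Function.update G i 0)) ^ 2) / √n) +
  4 / (a * n) ^ 2 * (8 * (∑ i, e i * inner ℝ (G i) (H (Function.update G i 0))) ^ 2)

/-- A function that is at least one wherever the criterion deviates by more than `a`. -/
noncomputable def fluctuation (μ a : ℝ) (e : EuclideanSpace ℝ (Fin n))
    (H : (Fin n → EuclideanSpace ℝ (Fin p)) → EuclideanSpace ℝ (Fin p))
    (G : Fin n → EuclideanSpace ℝ (Fin p)) : ℝ :=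
  leaveOneOutFluctuation a e H G +
    (2 / (a * n) * (√n + 1) + 4 / (a * n) ^ 2 * (8 * ‖e‖ ^ 2)) * remainderSq μ H G

/-- The deviation is at most Y + y, where y collects the terms involving the noise. Exceeding A
forces 2Y ≥ A or 2y ≥ A, so either the first power of 2Y/A or the square of 2y/A is at least 1.
Squaring the noise part brings in second moments and leads to ‖e‖²/n². Young's inequality with
weight s splits the product W x. -/
theorem one_le_of_lt_abs_deviation {A s E W x R Q₁ Q₂ α β δ : ℝ} (hA : 0 < A) (hs : 0 < s)
    (hR : x ^ 2 ≤ R) (hβ : |β| ≤ E * x) (hδ : |δ| ≤ W * x)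
    (h : A < |Q₁ + Q₂ - 2 * α + 2 * β - 2 * δ + x ^ 2|) :
    1 ≤ 2 / A * (|Q₁| + |Q₂| + W ^ 2 / s + (s + 1) * R) +
      4 / A ^ 2 * (8 * α ^ 2 + 8 * E ^ 2 * R) := by
  have hR0 : 0 ≤ R := (sq_nonneg x).trans hR
  have hyoung : 2 * (W * x) ≤ W ^ 2 / s + s * R := by
    have h1 : W ^ 2 / s + s * x ^ 2 - 2 * (W * x) = (W - s * x) ^ 2 / s := by
      field_simp
      ring
    have h2 : 0 ≤ (W - s * x) ^ 2 / s := by positivity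
    have h3 : s * x ^ 2 ≤ s * R := by gcongr
    linarith
  set Y := |Q₁| + |Q₂| + W ^ 2 / s + (s + 1) * R with hY
  set y := 2 * |α| + 2 * (E * x) with hy
  have hsum : A < Y + y := by
    refine h.trans_le ?_
    have b1 := le_abs_self Q₁
    have b2 := neg_abs_le Q₁
    have b3 := le_abs_self Q₂
    have b4 := neg_abs_le Q₂
    have b5 := le_abs_self α
    have b6 := neg_abs_le α
    have b7 := abs_le.1 hβ
    have b8 := abs_le.1 hδ
    have b9 := sq_nonneg x
    have b10 : (s + 1) * R = s * R + R := by ring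
    exact abs_le.2 ⟨by linarith, by linarith⟩
  have hy2 : y ^ 2 ≤ 8 * α ^ 2 + 8 * E ^ 2 * R := by
    have h1 : E ^ 2 * x ^ 2 ≤ E ^ 2 * R := by gcongr
    rw [hy, ← sq_abs α]
    nlinarith [sq_nonneg (|α| - E * x)]
  have hY0 : 0 ≤ Y := by positivity
  have hle : 2 / A * Y + 4 / A ^ 2 * y ^ 2 ≤
      2 / A * Y + 4 / A ^ 2 * (8 * α ^ 2 + 8 * E ^ 2 * R) := by
    gcongr
  refine le_trans ?_ hle
  rcases le_total A (2 * Y) with h1 | h1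
  · have : 1 ≤ 2 / A * Y := by
      rw [div_mul_eq_mul_div, le_div_iff₀ hA]
      linarith
    have : 0 ≤ 4 / A ^ 2 * y ^ 2 := by positivity
    linarith
  · have h2 : A ≤ 2 * y := by linarith
    have : 1 ≤ 4 / A ^ 2 * y ^ 2 := by
      rw [div_mul_eq_mul_div, le_div_iff₀ (by positivity)]
      nlinarith
    have : 0 ≤ 2 / A * Y := by positivity
    linarith

/-- Expanding the square identifies Q₁ + Q₂ with ‖w‖² - n‖H‖², where w is the leave-one-out vector;
α, β, δ are the inner products ⟨e, w⟩, ⟨e, e'⟩, ⟨w, e'⟩, and s = √n, A = a n. -/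
theorem one_le_fluctuation {μ a : ℝ} (ha : 0 < a) (hn : 0 < n) (e : EuclideanSpace ℝ (Fin n))
    (H : (Fin n → EuclideanSpace ℝ (Fin p)) → EuclideanSpace ℝ (Fin p))
    (G : Fin n → EuclideanSpace ℝ (Fin p)) {e' : EuclideanSpace ℝ (Fin n)}
    (he' : ‖e'‖ ^ 2 ≤ remainderSq μ H G)
    (h : a * n < |‖e - leaveOneOutVector H G + e'‖ ^ 2 - ‖e‖ ^ 2 - n * ‖H G‖ ^ 2|) :
    1 ≤ fluctuation μ a e H G := by
  have hn' : (0 : ℝ) < n := by exact_mod_cast hn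
  have hs : 0 < √(n : ℝ) := Real.sqrt_pos.2 hn'
  have hw2 : ∑ i, inner ℝ (G i) (H (Function.update G i 0)) ^ 2 =
      ‖leaveOneOutVector H G‖ ^ 2 := by
    rw [EuclideanSpace.real_norm_sq_eq]
    rfl
  have hew : ∑ i, e i * inner ℝ (G i) (H (Function.update G i 0)) =
      inner ℝ e (leaveOneOutVector H G) := by
    rw [PiLp.inner_apply]
    exact Finset.sum_congr rfl fun i _ => by simp [leaveOneOutVector_apply, mul_comm]
  have hQ : ‖leaveOneOutVector H G‖ ^ 2 - n * ‖H G‖ ^ 2 =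
      ∑ i, (inner ℝ (G i) (H (Function.update G i 0)) ^ 2 - ‖H (Function.update G i 0)‖ ^ 2) +
        ∑ i, (‖H (Function.update G i 0)‖ ^ 2 - ‖H G‖ ^ 2) := by
    rw [← hw2, ← Finset.sum_add_distrib]
    simp [Finset.sum_sub_distrib]
  rw [show ‖e - leaveOneOutVector H G + e'‖ ^ 2 - ‖e‖ ^ 2 - n * ‖H G‖ ^ 2 =
      ∑ i, (inner ℝ (G i) (H (Function.update G i 0)) ^ 2 - ‖H (Function.update G i 0)‖ ^ 2) +
        ∑ i, (‖H (Function.update G i 0)‖ ^ 2 - ‖H G‖ ^ 2) -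
        2 * inner ℝ e (leaveOneOutVector H G) + 2 * inner ℝ e e' -
        2 * inner ℝ (leaveOneOutVector H G) e' + ‖e'‖ ^ 2 by
    rw [← hQ, norm_add_sq_real, norm_sub_sq_real, inner_sub_left]
    ring] at h
  refine (one_le_of_lt_abs_deviation (by positivity) hs he'
    (abs_real_inner_le_norm e e') (abs_real_inner_le_norm _ e') h).trans_eq ?_
  rw [fluctuation, leaveOneOutFluctuation, hw2, hew]
  ring

theorem measurable_fluctuation {F : EuclideanSpace ℝ (Fin n) →
    (Fin n → EuclideanSpace ℝ (Fin p)) → EuclideanSpace ℝ (Fin p)}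
    (hF : Continuous F.uncurry) (μ a : ℝ) :
    Measurable fun z : EuclideanSpace ℝ (Fin n) × (Fin n → EuclideanSpace ℝ (Fin p)) =>
      fluctuation μ a z.1 (F z.1) z.2 := by
  have h1 : Continuous fun z : EuclideanSpace ℝ (Fin n) × (Fin n → EuclideanSpace ℝ (Fin p)) =>
      F z.1 z.2 := hF
  have h2 : ∀ i, Continuous fun z : EuclideanSpace ℝ (Fin n) ×
      (Fin n → EuclideanSpace ℝ (Fin p)) => F z.1 (Function.update z.2 i 0) := fun i =>
    hF.comp (continuous_fst.prodMk (continuous_snd.update i continuous_const))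
  have h3 : Measurable fun z : EuclideanSpace ℝ (Fin n) ×
      (Fin n → EuclideanSpace ℝ (Fin p)) => remainderSq μ (F z.1) z.2 := by
    unfold remainderSq
    refine Finset.measurable_sum _ fun i _ => ((measurable_steinError hF i).pow_const 2
      |>.const_mul 2).add (Continuous.measurable ?_)
    fun_prop
  have h4 : Continuous fun z : EuclideanSpace ℝ (Fin n) ×
      (Fin n → EuclideanSpace ℝ (Fin p)) => leaveOneOutFluctuation a z.1 (F z.1) z.2 := by
    unfold leaveOneOutFluctuation
    simp only [div_eq_mul_inv]
    fun_prop
  unfold fluctuation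
  exact h4.measurable.add (Measurable.mul (Continuous.measurable (by fun_prop)) h3)

/-- A bound on the expected squared remainder. -/
noncomputable def remainderBound (γ μ B M : ℝ) : ℝ :=
  6 * (B ^ 2 * γ + 2 / μ ^ 2 * (M ^ 2 * γ +
    (gaussianFourthMoment * γ ^ 2 + perturbedMomentBound γ B M) / 2)) +
  2 / μ ^ 2 * ((gaussianFourthMoment * γ ^ 2 + perturbedMomentBound γ B M) / 2)

/-- The constant in the bound on the expected fluctuation. -/
noncomputable def fluctuationConst (γ μ B M a : ℝ) : ℝ :=
  2 / a * ((quadraticVarianceBound γ B M + 1) / 2 +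
    B * (γ + 1 + perturbedMomentBound γ B M) + (1 + perturbedMomentBound γ B M)) +
  32 / a ^ 2 * (1 + perturbedMomentBound γ B M + B ^ 2 * γ) +
  (4 / a + 32 / a ^ 2) * remainderBound γ μ B M

namespace IsLeaveOneOutStable

variable {γ μ B M : ℝ} {τ : EuclideanSpace ℝ (Fin p)}
  {H : (Fin n → EuclideanSpace ℝ (Fin p)) → EuclideanSpace ℝ (Fin p)}
  (hH : IsLeaveOneOutStable B τ H) (hn : 0 < n) (hγ : 0 < γ) (hp : (p : ℝ) ≤ γ * n)
  (hB : 0 ≤ B) (hτ : ‖τ‖ ^ 2 ≤ M) (hμ : 0 < μ)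
  (hL : ∀ R : ℝ, ∃ K : ℝ≥0, LipschitzOnWith K H (Metric.closedBall 0 R))
  (hD : ∀ᵐ G ∂gaussianRows n p, ∀ i, rowSqDeriv i H G ≤
    2 * (n * μ)⁻¹ ^ 2 * (M ^ 2 * p + ‖G i‖ ^ 2 * ‖H G‖ ^ 2))

include hH hn hγ hp hB hτ

theorem lintegral_norm_sq_mul_norm_sq_le (i : Fin n) :
    ∫⁻ G, ENNReal.ofReal (2 * (n * μ)⁻¹ ^ 2 * (‖G i‖ ^ 2 * ‖H G‖ ^ 2)) ∂gaussianRows n p ≤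
      ENNReal.ofReal ((n : ℝ)⁻¹ * (2 / μ ^ 2 *
        ((gaussianFourthMoment * γ ^ 2 + perturbedMomentBound γ B M) / 2))) := by
  have hn' : (0 : ℝ) < n := by exact_mod_cast hn
  have hpg := hH.polyGrowth hB
  rw [← ofReal_integral_eq_lintegral_ofReal (PolyGrowth.integrable (by fun_prop))
    (ae_of_all _ fun G => by positivity), integral_const_mul]
  refine ENNReal.ofReal_le_ofReal ?_
  have h := integral_norm_sq_mul_norm_sq_le hH hn hγ hp hB hτ i
  calc _ ≤ 2 * (n * μ)⁻¹ ^ 2 *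
        (n * ((gaussianFourthMoment * γ ^ 2 + perturbedMomentBound γ B M) / 2)) := by gcongr
    _ = _ := by field_simp

include hμ hL hD

/-- Row deletion changes H by at most (B/n)‖G_i‖, and the derivative hypothesis carries (nμ)^{-2}.
Both squares have mean O(1/n) since p ≤ γn, so the sum over the n rows stays bounded. -/
theorem lintegral_sq_steinError_row_le (i : Fin n) :
    ∫⁻ G, ENNReal.ofReal (steinError i H G ^ 2) ∂gaussianRows n p ≤
      ENNReal.ofReal ((n : ℝ)⁻¹ * (3 * (B ^ 2 * γ + 2 / μ ^ 2 * (M ^ 2 * γ +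
        (gaussianFourthMoment * γ ^ 2 + perturbedMomentBound γ B M) / 2)))) := by
  have hn' : (0 : ℝ) < n := by exact_mod_cast hn
  have hpg := hH.polyGrowth hB
  refine (lintegral_sq_steinError_le hL hH.continuous i).trans ?_
  have hae : ∀ᵐ G ∂gaussianRows n p,
      ENNReal.ofReal (3 * (‖H G - H (Function.update G i 0)‖ ^ 2 + rowSqDeriv i H G)) ≤
      ENNReal.ofReal (3 * ((B / n) ^ 2 * ‖G i‖ ^ 2 +
        2 * (n * μ)⁻¹ ^ 2 * (M ^ 2 * p + ‖G i‖ ^ 2 * ‖H G‖ ^ 2))) := by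
    filter_upwards [hD] with G hG
    have h1 := hH.norm_sub_update_le G i
    have h2 := hG i
    refine ENNReal.ofReal_le_ofReal ?_
    rw [← mul_pow]
    gcongr
  refine (lintegral_mono_ae hae).trans ?_
  rw [← ofReal_integral_eq_lintegral_ofReal (PolyGrowth.integrable (by fun_prop))
    (ae_of_all _ fun G => by positivity), integral_const_mul,
    integral_add (PolyGrowth.integrable (by fun_prop)) (PolyGrowth.integrable (by fun_prop)),
    integral_const_mul, integral_const_mul, integral_add (integrable_const _)
      (PolyGrowth.integrable (by fun_prop)), integral_norm_sq_gaussianRows]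
  refine ENNReal.ofReal_le_ofReal ?_
  have h := integral_norm_sq_mul_norm_sq_le hH hn hγ hp hB hτ i
  simp only [integral_const, probReal_univ, one_smul]
  calc _ ≤ 3 * ((B / n) ^ 2 * (γ * n) + 2 * (n * μ)⁻¹ ^ 2 * (M ^ 2 * (γ * n) +
        n * ((gaussianFourthMoment * γ ^ 2 + perturbedMomentBound γ B M) / 2))) := by gcongr
    _ = _ := by
        field_simp

theorem lintegral_remainderSq_le :
    ∫⁻ G, ENNReal.ofReal (remainderSq μ H G) ∂gaussianRows n p ≤
      ENNReal.ofReal (remainderBound γ μ B M) := by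
  have hn' : (0 : ℝ) < n := by exact_mod_cast hn
  have hpg := hH.polyGrowth hB
  have hC := perturbedMomentBound_nonneg hH hn hγ hp hB hτ
  have hκ := gaussianFourthMoment_nonneg
  have hm : ∀ i, Measurable fun G => ENNReal.ofReal (steinError i H G ^ 2) := fun i =>
    ((measurable_steinError_of_continuous hH.continuous i).pow_const 2).ennreal_ofReal
  have hm2 : ∀ i, Measurable fun G : Fin n → EuclideanSpace ℝ (Fin p) =>
      ENNReal.ofReal (2 * (n * μ)⁻¹ ^ 2 * (‖G i‖ ^ 2 * ‖H G‖ ^ 2)) := fun i =>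
    (Continuous.measurable (by have := hH.continuous; fun_prop)).ennreal_ofReal
  have e : ∀ G, ENNReal.ofReal (remainderSq μ H G) =
      ∑ i, (2 * ENNReal.ofReal (steinError i H G ^ 2) +
        ENNReal.ofReal (2 * (n * μ)⁻¹ ^ 2 * (‖G i‖ ^ 2 * ‖H G‖ ^ 2))) := by
    intro G
    rw [remainderSq, ENNReal.ofReal_sum_of_nonneg fun i _ => by positivity]
    refine Finset.sum_congr rfl fun i _ => ?_
    rw [ENNReal.ofReal_add (by positivity) (by positivity), ENNReal.ofReal_mul (by norm_num)]
    simp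
  simp_rw [e]
  have hm3 : ∀ i, Measurable fun G => 2 * ENNReal.ofReal (steinError i H G ^ 2) +
      ENNReal.ofReal (2 * (n * μ)⁻¹ ^ 2 * (‖G i‖ ^ 2 * ‖H G‖ ^ 2)) := fun i =>
    ((hm i).const_mul 2).add (hm2 i)
  rw [lintegral_finsetSum _ fun i _ => hm3 i]
  have hrow : ∀ i : Fin n, ∫⁻ G, (2 * ENNReal.ofReal (steinError i H G ^ 2) +
        ENNReal.ofReal (2 * (n * μ)⁻¹ ^ 2 * (‖G i‖ ^ 2 * ‖H G‖ ^ 2))) ∂gaussianRows n p ≤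
      ENNReal.ofReal ((n : ℝ)⁻¹ * remainderBound γ μ B M) := by
    intro i
    rw [lintegral_add_left ((hm i).const_mul 2), lintegral_const_mul _ (hm i)]
    refine (add_le_add (mul_le_mul_right
      (lintegral_sq_steinError_row_le hH hn hγ hp hB hτ hμ hL hD i) 2)
      (lintegral_norm_sq_mul_norm_sq_le (μ := μ) hH hn hγ hp hB hτ i)).trans_eq ?_
    rw [show (2 : ENNReal) = ENNReal.ofReal 2 by simp, ← ENNReal.ofReal_mul (by norm_num),
      ← ENNReal.ofReal_add (by positivity) (by positivity)]
    congr 1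
    rw [remainderBound]
    ring
  refine (Finset.sum_le_sum fun i _ => hrow i).trans_eq ?_
  rw [Finset.sum_const, Finset.card_univ, Fintype.card_fin, nsmul_eq_mul,
    ← ENNReal.ofReal_natCast, ← ENNReal.ofReal_mul (by positivity), mul_inv_cancel_left₀ hn'.ne']

omit hμ hL hD in
theorem quadraticVarianceBound_nonneg : 0 ≤ quadraticVarianceBound γ B M := by
  have hC := perturbedMomentBound_nonneg hH hn hγ hp hB hτ
  have hκ := gaussianFourthMoment_nonneg
  unfold quadraticVarianceBound
  positivity

omit hμ hL hD in
theorem remainderBound_nonneg : 0 ≤ remainderBound γ μ B M := by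
  have hC := perturbedMomentBound_nonneg hH hn hγ hp hB hτ
  have hκ := gaussianFourthMoment_nonneg
  unfold remainderBound
  positivity

omit hμ hL hD in
theorem fluctuationConst_nonneg {a : ℝ} (ha : 0 < a) : 0 ≤ fluctuationConst γ μ B M a := by
  have hC := perturbedMomentBound_nonneg hH hn hγ hp hB hτ
  have hV := quadraticVarianceBound_nonneg hH hn hγ hp hB hτ
  have hR := remainderBound_nonneg (μ := μ) hH hn hγ hp hB hτ
  unfold fluctuationConst
  positivity

omit hμ hL hD in
theorem integral_leaveOneOutFluctuation_le {a : ℝ} (ha : 0 < a)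
    (e : EuclideanSpace ℝ (Fin n)) :
    Integrable (leaveOneOutFluctuation a e H) (gaussianRows n p) ∧
    ∫ G, leaveOneOutFluctuation a e H G ∂gaussianRows n p ≤
      2 / (a * n) * (√n * ((quadraticVarianceBound γ B M + 1) / 2 +
        B * (γ + 1 + perturbedMomentBound γ B M) + (1 + perturbedMomentBound γ B M))) +
      4 / (a * n) ^ 2 * (8 * (‖e‖ ^ 2 * (1 + perturbedMomentBound γ B M + B ^ 2 * γ))) := by
  have hn' : (0 : ℝ) < n := by exact_mod_cast hn
  have hs : 0 < √(n : ℝ) := Real.sqrt_pos.2 hn'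
  have hss : √(n : ℝ) * √n = n := Real.mul_self_sqrt hn'.le
  have hpg := hH.polyGrowth hB
  have h1 : ∫ G, |∑ i, (inner ℝ (G i) (H (Function.update G i 0)) ^ 2 -
      ‖H (Function.update G i 0)‖ ^ 2)| ∂gaussianRows n p ≤
      √n * ((quadraticVarianceBound γ B M + 1) / 2) := by
    have hle : ∀ G, |∑ i, (inner ℝ (G i) (H (Function.update G i 0)) ^ 2 -
        ‖H (Function.update G i 0)‖ ^ 2)| ≤ 1 / (2 * √n) *
        (∑ i, (inner ℝ (G i) (H (Function.update G i 0)) ^ 2 -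
        ‖H (Function.update G i 0)‖ ^ 2)) ^ 2 + √n / 2 := by
      intro G
      set x := ∑ i, (inner ℝ (G i) (H (Function.update G i 0)) ^ 2 -
        ‖H (Function.update G i 0)‖ ^ 2)
      have h : 1 / (2 * √n) * x ^ 2 + √n / 2 - |x| = 1 / (2 * √n) * (|x| - √n) ^ 2 := by
        rw [← sq_abs x]
        field_simp
        ring
      have : 0 ≤ 1 / (2 * √(n : ℝ)) * (|x| - √n) ^ 2 := by positivity
      linarith
    refine (integral_mono_of_nonneg (ae_of_all _ fun G => abs_nonneg _)
      (PolyGrowth.integrable (by fun_prop)) (ae_of_all _ hle)).trans ?_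
    rw [integral_add (PolyGrowth.integrable (by fun_prop)) (integrable_const _),
      integral_const_mul]
    have h := integral_sq_sum_inner_update_sq_sub_le hH hn hγ hp hB hτ
    calc _ ≤ 1 / (2 * √n) * (n * quadraticVarianceBound γ B M) + √n / 2 := by
          gcongr
          simp
      _ = _ := by
          have : (n : ℝ) / √n = √n := Real.div_sqrt
          have h3 : 1 / (2 * √n) * (n * quadraticVarianceBound γ B M) =
              (n / √n) * quadraticVarianceBound γ B M / 2 := by
            field_simp
          rw [h3, this]
          ring
  have h2 := integral_abs_sum_norm_update_sq_sub_le hH hn hγ hp hB hτ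
  have h3 : (∫ G, ∑ i, inner ℝ (G i) (H (Function.update G i 0)) ^ 2 ∂gaussianRows n p) / √n ≤
      √n * (1 + perturbedMomentBound γ B M) := by
    rw [integral_finsetSum _ fun i _ => PolyGrowth.integrable (by fun_prop), div_le_iff₀ hs]
    refine (Finset.sum_le_sum fun i _ =>
      integral_inner_update_sq_le hH hn hγ hp hB hτ i).trans_eq ?_
    rw [Finset.sum_const, Finset.card_univ, Fintype.card_fin, nsmul_eq_mul, mul_right_comm, hss]
  have h4 := integral_sq_sum_mul_inner_update_le hH hn hγ hp hB hτ e
  rw [← EuclideanSpace.real_norm_sq_eq] at h4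
  have i1 : PolyGrowth fun G : Fin n → EuclideanSpace ℝ (Fin p) =>
      |∑ i, (inner ℝ (G i) (H (Function.update G i 0)) ^ 2 -
      ‖H (Function.update G i 0)‖ ^ 2)| := by
    simp only [← Real.norm_eq_abs]
    fun_prop
  have i2 : PolyGrowth fun G : Fin n → EuclideanSpace ℝ (Fin p) =>
      |∑ i, (‖H (Function.update G i 0)‖ ^ 2 - ‖H G‖ ^ 2)| := by
    simp only [← Real.norm_eq_abs]
    fun_prop
  have i3 : Integrable (fun G : Fin n → EuclideanSpace ℝ (Fin p) =>
      (∑ i, inner ℝ (G i) (H (Function.update G i 0)) ^ 2) / √n) (gaussianRows n p) :=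
    (PolyGrowth.integrable (by fun_prop)).div_const _
  have i4 : Integrable (fun G : Fin n → EuclideanSpace ℝ (Fin p) =>
      4 / (a * n) ^ 2 * (8 * (∑ i, e i * inner ℝ (G i) (H (Function.update G i 0))) ^ 2))
      (gaussianRows n p) := PolyGrowth.integrable (by fun_prop)
  have i12 : Integrable (fun G : Fin n → EuclideanSpace ℝ (Fin p) =>
      |∑ i, (inner ℝ (G i) (H (Function.update G i 0)) ^ 2 -
        ‖H (Function.update G i 0)‖ ^ 2)| +
      |∑ i, (‖H (Function.update G i 0)‖ ^ 2 - ‖H G‖ ^ 2)|) (gaussianRows n p) :=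
    i1.integrable.add i2.integrable
  have i123 : Integrable (fun G : Fin n → EuclideanSpace ℝ (Fin p) => 2 / (a * n) *
      (|∑ i, (inner ℝ (G i) (H (Function.update G i 0)) ^ 2 -
        ‖H (Function.update G i 0)‖ ^ 2)| +
      |∑ i, (‖H (Function.update G i 0)‖ ^ 2 - ‖H G‖ ^ 2)| +
      (∑ i, inner ℝ (G i) (H (Function.update G i 0)) ^ 2) / √n)) (gaussianRows n p) :=
    (i12.add i3).const_mul (2 / (a * n))
  refine ⟨i123.add i4, ?_⟩
  have hsplit : ∫ G, leaveOneOutFluctuation a e H G ∂gaussianRows n p =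
      2 / (a * n) * (∫ G, |∑ i, (inner ℝ (G i) (H (Function.update G i 0)) ^ 2 -
        ‖H (Function.update G i 0)‖ ^ 2)| ∂gaussianRows n p +
        ∫ G, |∑ i, (‖H (Function.update G i 0)‖ ^ 2 - ‖H G‖ ^ 2)| ∂gaussianRows n p +
        (∫ G, ∑ i, inner ℝ (G i) (H (Function.update G i 0)) ^ 2 ∂gaussianRows n p) / √n) +
      4 / (a * n) ^ 2 * (8 * ∫ G, (∑ i, e i * inner ℝ (G i) (H (Function.update G i 0))) ^ 2
        ∂gaussianRows n p) := by
    rw [← integral_div, ← integral_add i1.integrable i2.integrable, ← integral_const_mul 8,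
      ← integral_const_mul, ← integral_add i12 i3, ← integral_const_mul, ← integral_add i123 i4]
    rfl
  rw [hsplit]
  have : 0 < a * n := by positivity
  calc _ ≤ 2 / (a * n) * (√n * ((quadraticVarianceBound γ B M + 1) / 2) +
        √n * (B * (γ + 1 + perturbedMomentBound γ B M)) +
        √n * (1 + perturbedMomentBound γ B M)) +
      4 / (a * n) ^ 2 * (8 * (‖e‖ ^ 2 * (1 + perturbedMomentBound γ B M + B ^ 2 * γ))) := by
        gcongr
    _ = _ := by ring

/-- The expected fluctuation is small when the noise vector `e` is not too large. -/
theorem lintegral_fluctuation_le {a : ℝ} (ha : 0 < a) (e : EuclideanSpace ℝ (Fin n)) :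
    ∫⁻ G, ENNReal.ofReal (fluctuation μ a e H G) ∂gaussianRows n p ≤
      ENNReal.ofReal (fluctuationConst γ μ B M a * (1 / √n + ‖e‖ ^ 2 / n ^ 2)) := by
  have hn' : (0 : ℝ) < n := by exact_mod_cast hn
  have hn1 : (1 : ℝ) ≤ n := by exact_mod_cast hn
  have hs : 0 < √(n : ℝ) := Real.sqrt_pos.2 hn'
  have hs1 : 1 ≤ √(n : ℝ) := Real.one_le_sqrt.2 hn1
  have hC := perturbedMomentBound_nonneg hH hn hγ hp hB hτ
  have hκ := gaussianFourthMoment_nonneg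
  have hV := quadraticVarianceBound_nonneg hH hn hγ hp hB hτ
  have hE0 := remainderBound_nonneg (μ := μ) hH hn hγ hp hB hτ
  obtain ⟨hi, hle⟩ := integral_leaveOneOutFluctuation_le hH hn hγ hp hB hτ ha e
  have h0 : ∀ G, 0 ≤ leaveOneOutFluctuation a e H G := fun G => by
    unfold leaveOneOutFluctuation
    positivity
  have hm : AEMeasurable (fun G => ENNReal.ofReal (leaveOneOutFluctuation a e H G))
      (gaussianRows n p) := hi.aestronglyMeasurable.aemeasurable.ennreal_ofReal
  set c := 2 / (a * n) * (√n + 1) + 4 / (a * n) ^ 2 * (8 * ‖e‖ ^ 2) with hc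
  have hc0 : 0 ≤ c := by positivity
  have hsplit : ∀ G, ENNReal.ofReal (fluctuation μ a e H G) =
      ENNReal.ofReal (leaveOneOutFluctuation a e H G) +
        ENNReal.ofReal c * ENNReal.ofReal (remainderSq μ H G) := by
    intro G
    rw [fluctuation, ENNReal.ofReal_add (h0 G) (mul_nonneg hc0 (remainderSq_nonneg μ H G)),
      ENNReal.ofReal_mul hc0]
  simp_rw [hsplit]
  rw [lintegral_add_left' hm, lintegral_const_mul' _ _ ENNReal.ofReal_ne_top,
    ← ofReal_integral_eq_lintegral_ofReal hi (ae_of_all _ h0)]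
  refine (add_le_add (ENNReal.ofReal_le_ofReal hle) (mul_le_mul_right
    (lintegral_remainderSq_le hH hn hγ hp hB hτ hμ hL hD) _)).trans ?_
  rw [← ENNReal.ofReal_mul hc0, ← ENNReal.ofReal_add (by positivity) (by positivity)]
  refine ENNReal.ofReal_le_ofReal ?_
  set u := 1 / √(n : ℝ) with hu
  set v := ‖e‖ ^ 2 / (n : ℝ) ^ 2 with hv
  have hu0 : 0 ≤ u := by positivity
  have hv0 : 0 ≤ v := by positivity
  have hsn : √(n : ℝ) / n = u := Real.sqrt_div_self'
  have e1 : ∀ t : ℝ, 2 / (a * n) * (√n * t) = 2 / a * t * u := fun t => by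
    rw [← hsn]
    field_simp
  have e2 : ∀ t : ℝ, 4 / (a * n) ^ 2 * (8 * (‖e‖ ^ 2 * t)) = 32 / a ^ 2 * t * v := fun t => by
    rw [hv]
    field_simp
    ring
  have e3 : c ≤ 4 / a * u + 32 / a ^ 2 * v := by
    have h1 : 2 / (a * n) * (√n + 1) ≤ 2 / (a * n) * (√n * 2) := by
      gcongr
      linarith
    have h2 := e1 2
    have h3 := e2 1
    rw [mul_one] at h3
    rw [hc, h3]
    have h4 : 2 / a * 2 * u = 4 / a * u := by ring
    linarith
  rw [e1, e2, fluctuationConst]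
  set c₁ := (quadraticVarianceBound γ B M + 1) / 2 + B * (γ + 1 + perturbedMomentBound γ B M) +
    (1 + perturbedMomentBound γ B M) with hc₁
  set c₂ := 1 + perturbedMomentBound γ B M + B ^ 2 * γ with hc₂
  have h1 : 0 ≤ 2 / a * c₁ := by positivity
  have h2 : 0 ≤ 32 / a ^ 2 * c₂ := by positivity
  have h3 : 0 ≤ 4 / a * remainderBound γ μ B M := by positivity
  have h4 : 0 ≤ 32 / a ^ 2 * remainderBound γ μ B M := by positivity
  have h5 := mul_le_mul_of_nonneg_right e3 hE0
  -- The four products are the missing cross terms; adding them lets one constant multiply u + v.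
  nlinarith [mul_nonneg h1 hv0, mul_nonneg h2 hu0, mul_nonneg h3 hv0, mul_nonneg h4 hu0]

end IsLeaveOneOutStable

end Fluctuation

/-! ### The data as a linear image of the noise and the standardized rows. -/

section GaussianData

open EuclideanSpace
open scoped NNReal

variable {n p : ℕ} {γ μ M : ℝ} {S A : Matrix (Fin p) (Fin p) ℝ} {ρ : ℝ → ℝ}
  {g : EuclideanSpace ℝ (Fin p) → ℝ} {βstar : EuclideanSpace ℝ (Fin p)}

/-- The data of the linear model as a linear function of the noise vector and of the standardized
rows of the design. -/
noncomputable def RobustSelection.standardizedData (n : ℕ) (S : Matrix (Fin p) (Fin p) ℝ)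
    (βstar : EuclideanSpace ℝ (Fin p)) : Data n p →ₗ[ℝ] Data n p where
  toFun z := (design (fun i => act (CFC.sqrt S) (z.2 i)) βstar + z.1,
    fun i => act (CFC.sqrt S) (z.2 i))
  map_add' z z' := by
    refine Prod.ext ?_ ?_
    · ext i
      simp only [PiLp.add_apply, design_apply, Prod.fst_add, Prod.snd_add, Pi.add_apply, map_add,
        inner_add_left]
      ring
    · funext i
      simp
  map_smul' c z := by
    refine Prod.ext ?_ ?_
    · ext i
      simp only [PiLp.add_apply, design_apply, Prod.smul_fst, Prod.smul_snd, Pi.smul_apply,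
        map_smul, real_inner_smul_left, PiLp.smul_apply, smul_eq_mul, RingHom.id_apply]
      ring
    · funext i
      simp

theorem RobustSelection.standardizedData_fst_apply (S : Matrix (Fin p) (Fin p) ℝ)
    (βstar : EuclideanSpace ℝ (Fin p)) (z : Data n p) (i : Fin n) :
    (standardizedData n S βstar z).1 i = inner ℝ (act (CFC.sqrt S) (z.2 i)) βstar + z.1 i := rfl

theorem RobustSelection.standardizedData_snd_apply (S : Matrix (Fin p) (Fin p) ℝ)
    (βstar : EuclideanSpace ℝ (Fin p)) (z : Data n p) (i : Fin n) :
    (standardizedData n S βstar z).2 i = act (CFC.sqrt S) (z.2 i) := rfl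

theorem RobustSelection.continuous_standardizedData (n : ℕ) (S : Matrix (Fin p) (Fin p) ℝ)
    (βstar : EuclideanSpace ℝ (Fin p)) : Continuous (standardizedData n S βstar) :=
  LinearMap.continuous_of_finiteDimensional _

/-- The map is linear and injective because Σ^{1/2} is, so its determinant is nonzero and preimages
of null sets are null. -/
theorem RobustSelection.quasiMeasurePreserving_standardizedData (hS : S.PosDef)
    (βstar : EuclideanSpace ℝ (Fin p)) :
    Measure.QuasiMeasurePreserving (standardizedData n S βstar) volume volume := by
  have hinj : Function.Injective (standardizedData n S βstar) := by
    intro z z' h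
    have h2 : z.2 = z'.2 := by
      funext i
      have h3 := congrFun (congrArg Prod.snd h) i
      rw [standardizedData_snd_apply, standardizedData_snd_apply] at h3
      rw [← act_invSqrt_act_sqrt hS (z.2 i), h3, act_invSqrt_act_sqrt hS]
    refine Prod.ext ?_ h2
    ext i
    have h3 := congrArg (fun w : Data n p => w.1 i) h
    simp only [standardizedData_fst_apply, h2] at h3
    linarith
  have hdet : LinearMap.det (standardizedData n S βstar) ≠ 0 := by
    have := LinearEquiv.isUnit_det' (LinearEquiv.ofInjectiveEndo _ hinj)
    exact this.ne_zero
  exact Measure.LinearMap.quasiMeasurePreserving volume _ hdet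

/-- The standardized estimation error as a function of the noise and the standardized rows. -/
noncomputable def RobustSelection.standardizedError (S : Matrix (Fin p) (Fin p) ℝ)
    (βstar : EuclideanSpace ℝ (Fin p)) (ρ : ℝ → ℝ) (g : EuclideanSpace ℝ (Fin p) → ℝ)
    (e : EuclideanSpace ℝ (Fin n)) (G : Fin n → EuclideanSpace ℝ (Fin p)) :
    EuclideanSpace ℝ (Fin p) :=
  act (CFC.sqrt S) (mEstimator ρ g (standardizedData n S βstar (e, G)) - βstar)

theorem RobustSelection.continuous_standardizedError (hμ : 0 < μ) (hS : S.PosDef)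
    (hρ : IsAdmissibleLoss M ρ) (hg : IsAdmissiblePenalty μ S g) (hn : 0 < n)
    (βstar : EuclideanSpace ℝ (Fin p)) :
    Continuous (Function.uncurry (standardizedError (n := n) S βstar ρ g)) := by
  have h := (continuous_mEstimator (n := n) hμ hS hρ hg hn).comp
    (continuous_standardizedData n S βstar)
  exact (act (CFC.sqrt S)).continuous.comp (h.sub continuous_const)

/-- Here H + τ = Σ^{1/2}β̂, so the growth bound is the size bound of the estimator. Zeroing row i
also changes the response y_i through ⟨x_i, β*⟩, which the row deletion bound permits. -/
theorem RobustSelection.isLeaveOneOutStable_standardizedError (hμ : 0 < μ) (hS : S.PosDef)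
    (hρ : IsAdmissibleLoss M ρ) (hg : IsAdmissiblePenalty μ S g) (hn : 0 < n)
    (βstar : EuclideanSpace ℝ (Fin p)) (e : EuclideanSpace ℝ (Fin n)) :
    IsLeaveOneOutStable (M / μ) (act (CFC.sqrt S) βstar) (standardizedError S βstar ρ g e) := by
  have hn' : (0 : ℝ) < n := by exact_mod_cast hn
  have e1 : M / μ / n = M / (n * μ) := by rw [div_div, mul_comm]
  refine ⟨?_, fun G i => ?_, fun G => ?_⟩
  · have h := (continuous_standardizedError hμ hS hρ hg hn βstar).comp
      (Continuous.prodMk_right e)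
    simp only [Function.comp_def, Function.uncurry_apply_pair] at h
    exact h
  · have h := norm_sub_le_of_row_eq_zero hμ hS hρ hg
      (d := standardizedData n S βstar (e, G))
      (d' := standardizedData n S βstar (e, Function.update G i 0)) (i := i) (x := G i)
      (standardizedData_snd_apply _ _ _ _)
      (by rw [standardizedData_snd_apply]; simp)
      (fun l hl => by
        rw [standardizedData_fst_apply, standardizedData_fst_apply]; simp [hl])
      (fun l hl => by
        rw [standardizedData_snd_apply, standardizedData_snd_apply]; simp [hl])
    rw [standardizedError, standardizedError, ← map_sub, sub_sub_sub_cancel_right, e1,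
      div_mul_eq_mul_div, le_div_iff₀ (by positivity), mul_comm]
    exact h
  · have h := norm_sq_mEstimator_le hμ hS hρ hg (standardizedData n S βstar (e, G))
    simp_rw [standardizedData_snd_apply, inner_act_sqrt] at h
    rw [standardizedError, ← map_add, sub_add_cancel, e1,
      div_mul_eq_mul_div, le_div_iff₀ (by positivity), mul_comm]
    exact h

theorem RobustSelection.exists_lipschitzOnWith_standardizedError (hμ : 0 < μ) (hS : S.PosDef)
    (hρ : IsAdmissibleLoss M ρ) (hg : IsAdmissiblePenalty μ S g) (hn : 0 < n)
    (βstar : EuclideanSpace ℝ (Fin p)) (e : EuclideanSpace ℝ (Fin n)) (R : ℝ) :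
    ∃ K : ℝ≥0, LipschitzOnWith K (standardizedError S βstar ρ g e) (Metric.closedBall 0 R) := by
  set Φ := (standardizedData n S βstar).toContinuousLinearMap with hΦ
  have hΦz : ∀ z, Φ z = standardizedData n S βstar z := fun z => rfl
  obtain ⟨K, hK⟩ := exists_lipschitzOnWith_mEstimator (p := p) hμ hS hρ hg hn
    (‖Φ‖ * max ‖e‖ |R|)
  refine ⟨‖act (CFC.sqrt S)‖₊ * (K * ‖Φ‖₊), LipschitzOnWith.of_dist_le_mul fun G hG G' hG' => ?_⟩
  have hmem : ∀ G ∈ Metric.closedBall (0 : Fin n → EuclideanSpace ℝ (Fin p)) R,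
      Φ (e, G) ∈ Metric.closedBall (0 : Data n p) (‖Φ‖ * max ‖e‖ |R|) := by
    intro G hG
    rw [mem_closedBall_zero_iff] at hG ⊢
    refine (Φ.le_opNorm _).trans ?_
    gcongr
    exact max_le_max le_rfl (hG.trans (le_abs_self R))
  have h1 := hK.dist_le_mul _ (hmem G hG) _ (hmem G' hG')
  have h2 : dist (Φ (e, G)) (Φ (e, G')) ≤ ‖Φ‖ * dist G G' := by
    rw [dist_eq_norm, ← map_sub]
    refine (Φ.le_opNorm _).trans_eq ?_
    rw [dist_eq_norm, Prod.mk_sub_mk, sub_self, Prod.norm_mk, norm_zero,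
      max_eq_right (norm_nonneg _)]
  rw [standardizedError, standardizedError, dist_eq_norm, ← map_sub, sub_sub_sub_cancel_right]
  refine ((act (CFC.sqrt S)).le_opNorm _).trans ?_
  rw [← dist_eq_norm, NNReal.coe_mul, NNReal.coe_mul, coe_nnnorm, coe_nnnorm, mul_assoc, mul_assoc]
  refine mul_le_mul_of_nonneg_left (h1.trans ?_) (norm_nonneg _)
  exact mul_le_mul_of_nonneg_left h2 K.2

end GaussianData

/-! ### Derivative of the standardized error in a row. -/

section Derivatives

open EuclideanSpace

variable {n p : ℕ} {γ μ M : ℝ} {S A : Matrix (Fin p) (Fin p) ℝ} {ρ : ℝ → ℝ}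
  {g : EuclideanSpace ℝ (Fin p) → ℝ} {βstar : EuclideanSpace ℝ (Fin p)}

theorem RobustSelection.IsDerivativeMatrix.fderiv_design {d : Data n p}
    (hA : IsDerivativeMatrix μ S ρ g d A) (i : Fin n) (v : EuclideanSpace ℝ (Fin p)) :
    fderiv ℝ (fun d' : Data n p => mEstimator ρ g d') d (0, Pi.single i v) =
      deriv ρ (residual ρ g d i) • act A v -
        (deriv (deriv ρ) (residual ρ g d i) * inner ℝ v (mEstimator ρ g d)) •
          act A (d.2 i) := by
  set ℓ := fderiv ℝ (fun d' : Data n p => mEstimator ρ g d') d with hℓ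
  let L₁ : EuclideanSpace ℝ (Fin p) →ₗ[ℝ] EuclideanSpace ℝ (Fin p) :=
    ℓ.toLinearMap ∘ₗ LinearMap.inr ℝ _ _ ∘ₗ
      LinearMap.single ℝ (fun _ : Fin n => EuclideanSpace ℝ (Fin p)) i
  let L₂ : EuclideanSpace ℝ (Fin p) →ₗ[ℝ] EuclideanSpace ℝ (Fin p) :=
    deriv ρ (residual ρ g d i) • (act A).toLinearMap -
      deriv (deriv ρ) (residual ρ g d i) •
        (innerₗ (EuclideanSpace ℝ (Fin p)) (mEstimator ρ g d)).smulRight (act A (d.2 i))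
  have h : L₁ = L₂ := by
    refine (EuclideanSpace.basisFun (Fin p) ℝ).toBasis.ext fun j => ?_
    have hj := hA.deriv_design i j
    simp only [L₁, L₂, OrthonormalBasis.coe_toBasis, EuclideanSpace.basisFun_apply]
    refine hj.trans ?_
    simp [mul_smul, EuclideanSpace.inner_single_right]
  have h2 := LinearMap.congr_fun h v
  refine Eq.trans h2 ?_
  simp [L₂, mul_smul, real_inner_comm]

theorem RobustSelection.standardizedData_zero_single (n : ℕ) (S : Matrix (Fin p) (Fin p) ℝ)
    (βstar : EuclideanSpace ℝ (Fin p)) (i : Fin n) (v : EuclideanSpace ℝ (Fin p)) :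
    standardizedData n S βstar (0, Pi.single i v) =
      (inner ℝ (act (CFC.sqrt S) v) βstar • (EuclideanSpace.single i (1 : ℝ), 0) : Data n p) +
        (0, Pi.single i (act (CFC.sqrt S) v)) := by
  refine Prod.ext ?_ ?_
  · ext l
    rw [standardizedData_fst_apply]
    rcases eq_or_ne l i with rfl | hl
    · simp
    · simp [hl]
  · funext l
    rw [standardizedData_snd_apply]
    rcases eq_or_ne l i with rfl | hl
    · simp
    · simp [hl]

/-- Moving G_i by v moves x_i by Σ^{1/2}v and y_i by ⟨Σ^{1/2}v, β*⟩. In the sum of the two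
derivative formulas β* and β̂ combine into β̂ - β*, so the row derivative involves only the error H.
-/
theorem RobustSelection.IsDerivativeMatrix.hasFDerivAt_row {e : EuclideanSpace ℝ (Fin n)}
    {G : Fin n → EuclideanSpace ℝ (Fin p)}
    (hA : IsDerivativeMatrix μ S ρ g (standardizedData n S βstar (e, G)) A) (i : Fin n) :
    ∃ D : EuclideanSpace ℝ (Fin p) →L[ℝ] EuclideanSpace ℝ (Fin p),
      HasFDerivAt (fun x => standardizedError S βstar ρ g e (Function.update G i x)) D (G i) ∧
      ∀ v, D v =
        deriv ρ (residual ρ g (standardizedData n S βstar (e, G)) i) •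
          act (CFC.sqrt S * A * CFC.sqrt S) v -
        (deriv (deriv ρ) (residual ρ g (standardizedData n S βstar (e, G)) i) *
          inner ℝ v (standardizedError S βstar ρ g e G)) •
            act (CFC.sqrt S * A * CFC.sqrt S) (G i) := by
  set Φ := (standardizedData n S βstar).toContinuousLinearMap with hΦ
  set ℓ := fderiv ℝ (fun d' : Data n p => mEstimator ρ g d')
    (standardizedData n S βstar (e, G)) with hℓ
  have h1 : HasFDerivAt (fun x : EuclideanSpace ℝ (Fin p) =>
      ((e, Function.update G i x) : Data n p))
      ((0 : EuclideanSpace ℝ (Fin p) →L[ℝ] EuclideanSpace ℝ (Fin n)).prod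
        (ContinuousLinearMap.pi (Pi.single i (ContinuousLinearMap.id ℝ _)))) (G i) :=
    (hasFDerivAt_const e (G i)).prodMk (hasFDerivAt_update G (G i))
  have h2 := Φ.hasFDerivAt.comp (G i) h1
  have h3 : HasFDerivAt (fun d' : Data n p => mEstimator ρ g d') ℓ
      (Φ (e, Function.update G i (G i))) := by
    rw [Function.update_eq_self]
    exact hA.differentiableAt.hasFDerivAt
  have h4 := (act (CFC.sqrt S)).hasFDerivAt.comp (G i) ((h3.comp (G i) h2).sub_const βstar)
  refine ⟨_, h4, fun v => ?_⟩
  have hv : (ContinuousLinearMap.pi (Pi.single i (ContinuousLinearMap.id ℝ _)) :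
      EuclideanSpace ℝ (Fin p) →L[ℝ] (Fin n → EuclideanSpace ℝ (Fin p))) v = Pi.single i v := by
    funext l
    rcases eq_or_ne l i with rfl | hl
    · simp
    · simp [hl]
  have hℓv : ℓ (standardizedData n S βstar (0, Pi.single i v)) =
      deriv ρ (residual ρ g (standardizedData n S βstar (e, G)) i) •
          act A (act (CFC.sqrt S) v) -
        (deriv (deriv ρ) (residual ρ g (standardizedData n S βstar (e, G)) i) *
          inner ℝ v (standardizedError S βstar ρ g e G)) •
            act A (act (CFC.sqrt S) (G i)) := by
    rw [standardizedData_zero_single, map_add, map_smul, hA.fderiv_design,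
      hA.deriv_response, standardizedData_snd_apply, standardizedError, ← inner_act_sqrt,
      inner_sub_right]
    module
  have hgoal : act (CFC.sqrt S) (ℓ (Φ ((0 : EuclideanSpace ℝ (Fin n)),
      (ContinuousLinearMap.pi (Pi.single i (ContinuousLinearMap.id ℝ _)) :
      EuclideanSpace ℝ (Fin p) →L[ℝ] (Fin n → EuclideanSpace ℝ (Fin p))) v))) =
      act (CFC.sqrt S) (ℓ (standardizedData n S βstar (0, Pi.single i v))) := by
    rw [hv]
    rfl
  refine Eq.trans ?_ (hgoal.trans ?_)
  · rfl
  · rw [hℓv]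
    simp only [map_sub, map_smul, act_mul]

end Derivatives

/-! ### Divergence and Frobenius norm of the row derivative. -/

section RowDerivative

open EuclideanSpace

variable {n p : ℕ}

theorem partialDeriv_row_eq {H : (Fin n → EuclideanSpace ℝ (Fin p)) → EuclideanSpace ℝ (Fin p)}
    {G : Fin n → EuclideanSpace ℝ (Fin p)} {i : Fin n}
    {D : EuclideanSpace ℝ (Fin p) →L[ℝ] EuclideanSpace ℝ (Fin p)}
    (hD : HasFDerivAt (fun x => H (Function.update G i x)) D (G i)) (j k : Fin p) :
    partialDeriv k (fun x => H (Function.update G i x) j) (G i) = D (single k 1) j := by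
  have h := (EuclideanSpace.proj (𝕜 := ℝ) j).hasFDerivAt.comp (G i) hD
  have h2 : HasFDerivAt (fun x => H (Function.update G i x) j)
    ((EuclideanSpace.proj (𝕜 := ℝ) j).comp D) (G i) := h
  rw [partialDeriv, h2.fderiv]
  rfl

theorem sum_act_single_apply (Q : Matrix (Fin p) (Fin p) ℝ) :
    ∑ j, act Q (single j (1 : ℝ)) j = Q.trace := by
  rw [Matrix.trace]
  refine Finset.sum_congr rfl fun j _ => ?_
  simp [act, Matrix.ofLp_toEuclideanCLM]

variable {H : (Fin n → EuclideanSpace ℝ (Fin p)) → EuclideanSpace ℝ (Fin p)}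
    {G : Fin n → EuclideanSpace ℝ (Fin p)} {i : Fin n} {Q : Matrix (Fin p) (Fin p) ℝ}
    {D : EuclideanSpace ℝ (Fin p) →L[ℝ] EuclideanSpace ℝ (Fin p)} {ψ ψ' L M : ℝ}

/-- The derivative is ψQ minus a rank-one map. The trace of the first part is the correction used in
the criterion; that of the second is one inner product. -/
theorem rowDivergence_eq
    (hD : HasFDerivAt (fun x => H (Function.update G i x)) D (G i))
    (hDv : ∀ v, D v = ψ • act Q v - (ψ' * inner ℝ v (H G)) • act Q (G i)) :
    rowDivergence i H G = ψ * Q.trace - ψ' * inner ℝ (H G) (act Q (G i)) := by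
  simp only [rowDivergence, partialDeriv_row_eq hD, hDv, PiLp.sub_apply, PiLp.smul_apply,
    smul_eq_mul, inner_single_left, map_one, one_mul]
  rw [Finset.sum_sub_distrib, ← Finset.mul_sum, sum_act_single_apply, PiLp.inner_apply,
    Finset.mul_sum]
  congr 1
  exact Finset.sum_congr rfl fun j _ => by simp; ring

/-- Column by column, (x + y)² ≤ 2x² + 2y². The rank-one part sums to ‖H‖² with no factor p. -/
theorem rowSqDeriv_le
    (hD : HasFDerivAt (fun x => H (Function.update G i x)) D (G i))
    (hDv : ∀ v, D v = ψ • act Q v - (ψ' * inner ℝ v (H G)) • act Q (G i))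
    (hψ : |ψ| ≤ M) (hψ' : |ψ'| ≤ 1) (hQ : ‖act Q‖ ≤ L) :
    rowSqDeriv i H G ≤ 2 * L ^ 2 * (M ^ 2 * p + ‖G i‖ ^ 2 * ‖H G‖ ^ 2) := by
  have hL : 0 ≤ L := (norm_nonneg _).trans hQ
  have hM : 0 ≤ M := (abs_nonneg _).trans hψ
  have hk : ∀ k : Fin p, ‖D (single k 1)‖ ^ 2 ≤
      2 * L ^ 2 * (M ^ 2 + ‖G i‖ ^ 2 * H G k ^ 2) := by
    intro k
    have h1 : ‖act Q (single k (1 : ℝ))‖ ≤ L := by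
      simpa using (act Q).le_of_opNorm_le hQ (single k (1 : ℝ))
    have h2 : ‖act Q (G i)‖ ≤ L * ‖G i‖ := (act Q).le_of_opNorm_le hQ (G i)
    have h3 : ‖D (single k 1)‖ ≤ M * L + |H G k| * (L * ‖G i‖) := by
      rw [hDv, inner_single_left]
      refine (norm_sub_le _ _).trans ?_
      rw [norm_smul, norm_smul, Real.norm_eq_abs, Real.norm_eq_abs, abs_mul]
      have h4 : |ψ'| * |(starRingEnd ℝ) 1 * H G k| ≤ |H G k| := by
        simpa using mul_le_mul_of_nonneg_right hψ' (abs_nonneg (H G k))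
      gcongr
    calc _ ≤ (M * L + |H G k| * (L * ‖G i‖)) ^ 2 := by gcongr
      _ ≤ 2 * ((M * L) ^ 2 + (|H G k| * (L * ‖G i‖)) ^ 2) := by
          nlinarith [sq_nonneg (M * L - |H G k| * (L * ‖G i‖))]
      _ = _ := by rw [mul_pow |H G k|, sq_abs]; ring
  calc rowSqDeriv i H G = ∑ k, ‖D (single k 1)‖ ^ 2 := by
        simp only [rowSqDeriv, partialDeriv_row_eq hD, EuclideanSpace.real_norm_sq_eq]
        exact Finset.sum_comm
    _ ≤ ∑ k : Fin p, 2 * L ^ 2 * (M ^ 2 + ‖G i‖ ^ 2 * H G k ^ 2) :=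
        Finset.sum_le_sum fun k _ => hk k
    _ = _ := by
        rw [EuclideanSpace.real_norm_sq_eq (H G), ← Finset.mul_sum, Finset.sum_add_distrib,
          ← Finset.mul_sum]
        simp only [Finset.sum_const, Finset.card_univ, Fintype.card_fin, nsmul_eq_mul]
        ring

end RowDerivative

/-! ### Decomposition of the debiased residuals. -/

section Criterion

variable {n p : ℕ} {γ μ M : ℝ} {S A : Matrix (Fin p) (Fin p) ℝ} {ρ : ℝ → ℝ}
  {g : EuclideanSpace ℝ (Fin p) → ℝ} {βstar : EuclideanSpace ℝ (Fin p)}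

theorem RobustSelection.trace_sqrt_mul_mul_sqrt (hS : S.PosDef) (A : Matrix (Fin p) (Fin p) ℝ) :
    (CFC.sqrt S * A * CFC.sqrt S).trace = (S * A).trace := by
  rw [Matrix.trace_mul_comm, ← Matrix.mul_assoc, CFC.sqrt_mul_sqrt_self _ hS.posSemidef.nonneg]

theorem RobustSelection.IsDerivativeMatrix.rowSqDeriv_standardizedError_le
    (hρ : IsAdmissibleLoss M ρ) {e : EuclideanSpace ℝ (Fin n)}
    {G : Fin n → EuclideanSpace ℝ (Fin p)}
    (hA : IsDerivativeMatrix μ S ρ g (standardizedData n S βstar (e, G)) A) (i : Fin n) :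
    rowSqDeriv i (standardizedError S βstar ρ g e) G ≤
      2 * (n * μ)⁻¹ ^ 2 * (M ^ 2 * p + ‖G i‖ ^ 2 * ‖standardizedError S βstar ρ g e G‖ ^ 2) := by
  obtain ⟨D, hD, hDv⟩ := hA.hasFDerivAt_row i
  exact rowSqDeriv_le hD hDv (hρ.abs_deriv_le _) (hρ.abs_deriv_deriv_le _) hA.opNorm_le

/-- The debiased residuals are close to the noise minus the leave-one-out inner products. -/
theorem RobustSelection.IsDerivativeMatrix.exists_debiased_residual_eq (hS : S.PosDef)
    (hρ : IsAdmissibleLoss M ρ) {e : EuclideanSpace ℝ (Fin n)}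
    {G : Fin n → EuclideanSpace ℝ (Fin p)}
    (hA : IsDerivativeMatrix μ S ρ g (standardizedData n S βstar (e, G)) A) :
    ∃ e' : EuclideanSpace ℝ (Fin n),
      ‖e'‖ ^ 2 ≤ remainderSq μ (standardizedError S βstar ρ g e) G ∧
      residual ρ g (standardizedData n S βstar (e, G)) + (S * A).trace •
        coordwise (deriv ρ) (residual ρ g (standardizedData n S βstar (e, G))) =
      e - leaveOneOutVector (standardizedError S βstar ρ g e) G + e' := by
  set H := standardizedError S βstar ρ g e with hH
  set r := residual ρ g (standardizedData n S βstar (e, G)) with hr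
  set Q := CFC.sqrt S * A * CFC.sqrt S with hQ
  -- Since r_i = e_i - ⟨G_i, H⟩ and ψ tr Q = div_i H + ψ'⟨H, Q G_i⟩, these are exactly the terms
  -- left after removing e_i - ⟨G_i, H^(i)⟩.
  refine ⟨WithLp.toLp 2 fun i => -steinError i H G +
    deriv (deriv ρ) (r i) * inner ℝ (H G) (act Q (G i)), ?_, ?_⟩
  · rw [EuclideanSpace.real_norm_sq_eq, remainderSq]
    refine Finset.sum_le_sum fun i _ => ?_
    simp only
    set c := deriv (deriv ρ) (r i) * inner ℝ (H G) (act Q (G i)) with hc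
    have h1 : |c| ≤ (n * μ)⁻¹ * (‖G i‖ * ‖H G‖) := by
      have h2 : ‖act Q (G i)‖ ≤ (n * μ)⁻¹ * ‖G i‖ := (act Q).le_of_opNorm_le hA.opNorm_le (G i)
      rw [hc, abs_mul]
      calc _ ≤ 1 * (‖H G‖ * ((n * μ)⁻¹ * ‖G i‖)) := by
            gcongr
            · exact hρ.abs_deriv_deriv_le _
            · exact (abs_real_inner_le_norm _ _).trans (by gcongr)
        _ = _ := by ring
    have h3 : c ^ 2 ≤ ((n * μ)⁻¹ * (‖G i‖ * ‖H G‖)) ^ 2 := by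
      rw [← sq_abs]
      gcongr
    nlinarith [sq_nonneg (steinError i H G + c)]
  · ext i
    obtain ⟨D, hD, hDv⟩ := hA.hasFDerivAt_row i
    have hdiv := rowDivergence_eq hD hDv
    rw [trace_sqrt_mul_mul_sqrt hS, ← hH, ← hr] at hdiv
    have hri : r i = e i - inner ℝ (G i) (H G) := by
      rw [hr, residual_apply, standardizedData_fst_apply, standardizedData_snd_apply, hH,
        standardizedError, ← inner_act_sqrt, inner_sub_right]
      ring
    simp only [PiLp.add_apply, PiLp.sub_apply, PiLp.smul_apply, smul_eq_mul, coordwise,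
      leaveOneOutVector_apply, steinError, hdiv]
    rw [hri]
    ring

end Criterion

/-! ### Concentration of the criterion. -/

section Deviation

variable {n p : ℕ} {γ μ M : ℝ} {S : Matrix (Fin p) (Fin p) ℝ} {ρ : ℝ → ℝ}
  {g : EuclideanSpace ℝ (Fin p) → ℝ} {βstar : EuclideanSpace ℝ (Fin p)}
  {ν : Measure (EuclideanSpace ℝ (Fin n))}

/-- Here the density of the noise is used: the joint law of noise and standardized rows, and hence
that of the data, charges no Lebesgue null set. -/
theorem RobustSelection.ae_isDerivativeMatrix_standardizedData (hμ : 0 < μ) (hS : S.PosDef)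
    (hρ : IsAdmissibleLoss M ρ) (hg : IsAdmissiblePenalty μ S g) (hn : 0 < n)
    (βstar : EuclideanSpace ℝ (Fin p)) (hν : ν ≪ volume) :
    ∀ᵐ z ∂ν.prod (gaussianRows n p),
      IsDerivativeMatrix μ S ρ g (standardizedData n S βstar z)
        (derivativeMatrix μ S ρ g (standardizedData n S βstar z)) := by
  have h1 : gaussianRows n p ≪ volume :=
    Measure.AbsolutelyContinuous.pi_fin (stdGaussian_absolutelyContinuous p) n
  have h2 : ν.prod (gaussianRows n p) ≪ (volume : Measure (Data n p)) := hν.prod h1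
  exact h2.ae_le ((quasiMeasurePreserving_standardizedData hS βstar).ae
    (ae_isDerivativeMatrix hμ hS hρ hg hn))

/-- With high probability the squared criterion is the squared noise plus `n` times the
out-of-sample error, up to `a * n`. -/
theorem RobustSelection.measure_criterion_deviation_le [IsProbabilityMeasure ν] (hμ : 0 < μ) (hS : S.PosDef)
    (hρ : IsAdmissibleLoss M ρ) (hg : IsAdmissiblePenalty μ S g) (hn : 0 < n) (hγ : 0 < γ)
    (hp : (p : ℝ) ≤ γ * n) (hβ : ‖act (CFC.sqrt S) βstar‖ ^ 2 ≤ M) (hν : ν ≪ volume)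
    {a : ℝ} (ha : 0 < a) {U : Set (EuclideanSpace ℝ (Fin n))} (hU : MeasurableSet U) {t : ℝ}
    (ht : ∀ e ∈ U, ‖e‖ ^ 2 ≤ t) :
    ν.prod (gaussianRows n p) {z | z.1 ∈ U ∧
      a * n < |criterion μ S ρ g (standardizedData n S βstar z) ^ 2 - ‖z.1‖ ^ 2 -
        n * outOfSampleError S βstar ρ g (standardizedData n S βstar z)|} ≤
      ENNReal.ofReal (fluctuationConst γ μ (M / μ) M a * (1 / √n + t / n ^ 2)) := by
  have hM : 0 ≤ M := (sq_nonneg _).trans hβ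
  have hB : 0 ≤ M / μ := by positivity
  have hn' : (0 : ℝ) < n := by exact_mod_cast hn
  have hloo := isLeaveOneOutStable_standardizedError (n := n) hμ hS hρ hg hn βstar
  have hae := ae_isDerivativeMatrix_standardizedData hμ hS hρ hg hn βstar hν
  set f : Data n p → ENNReal := fun z =>
    ENNReal.ofReal (fluctuation μ a z.1 (standardizedError S βstar ρ g z.1) z.2) with hf
  have hfm : Measurable f := (measurable_fluctuation
    (continuous_standardizedError hμ hS hρ hg hn βstar) μ a).ennreal_ofReal
  -- The criterion rests on a choice of matrix and is not known to be measurable. The event is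
  -- therefore enlarged, up to a null set, to a measurable one to which Fubini and Markov for fixed
  -- noise apply.
  have hVm : MeasurableSet {z : Data n p | z.1 ∈ U ∧ 1 ≤ f z} :=
    (measurable_fst hU).inter (measurableSet_le measurable_const hfm)
  have hsub : ν.prod (gaussianRows n p) {z | z.1 ∈ U ∧
      a * n < |criterion μ S ρ g (standardizedData n S βstar z) ^ 2 - ‖z.1‖ ^ 2 -
        n * outOfSampleError S βstar ρ g (standardizedData n S βstar z)|} ≤
      ν.prod (gaussianRows n p) {z : Data n p | z.1 ∈ U ∧ 1 ≤ f z} := by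
    refine measure_mono_ae ?_
    filter_upwards [hae] with z hz hzU
    obtain ⟨h1, h2⟩ := hzU
    refine ⟨h1, ?_⟩
    obtain ⟨e', he', heq⟩ := hz.exists_debiased_residual_eq hS hρ
    rw [criterion, heq] at h2
    exact ENNReal.one_le_ofReal.2 (one_le_fluctuation ha hn z.1 _ z.2 he' h2)
  refine hsub.trans ?_
  rw [Measure.prod_apply hVm]
  refine (lintegral_mono_ae (g := fun _ => ENNReal.ofReal
    (fluctuationConst γ μ (M / μ) M a * (1 / √n + t / n ^ 2))) ?_).trans_eq (by simp)
  filter_upwards [Measure.ae_ae_of_ae_prod hae] with e he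
  by_cases heU : e ∈ U
  · have hD : ∀ᵐ G ∂gaussianRows n p, ∀ i, rowSqDeriv i (standardizedError S βstar ρ g e) G ≤
        2 * (n * μ)⁻¹ ^ 2 * (M ^ 2 * p +
          ‖G i‖ ^ 2 * ‖standardizedError S βstar ρ g e G‖ ^ 2) := by
      filter_upwards [he] with G hG i
      exact hG.rowSqDeriv_standardizedError_le hρ i
    have hle := (hloo e).lintegral_fluctuation_le hn hγ hp hB hβ hμ
      (exists_lipschitzOnWith_standardizedError hμ hS hρ hg hn βstar e) hD ha e
    have hmark := mul_meas_ge_le_lintegral (μ := gaussianRows n p)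
      (hfm.comp (measurable_prodMk_left (x := e))) 1
    rw [one_mul] at hmark
    refine (measure_mono ?_).trans (hmark.trans (hle.trans ?_))
    · intro G hG
      exact hG.2
    · refine ENNReal.ofReal_le_ofReal ?_
      have hC : 0 ≤ fluctuationConst γ μ (M / μ) M a :=
        (hloo e).fluctuationConst_nonneg hn hγ hp hB hβ ha
      gcongr
      exact ht e heU
  · have : Prod.mk e ⁻¹' {z : Data n p | z.1 ∈ U ∧ 1 ≤ f z} = ∅ := by
      ext G
      simp [heU]
    rw [this, measure_empty]
    exact zero_le

end Deviation

/-! ### From the statistical model to the standardized product law. -/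

section Model

variable {Ω : Type*} [MeasurableSpace Ω] {P : Measure Ω} {n p : ℕ}
  {q M : ℝ} {S : Matrix (Fin p) (Fin p) ℝ} {βstar : EuclideanSpace ℝ (Fin p)}
  {X : Ω → Fin n → EuclideanSpace ℝ (Fin p)} {ε : Ω → EuclideanSpace ℝ (Fin n)}

theorem RobustSelection.IsGaussianModel.map_invSqrt_row (h : IsGaussianModel P q M S βstar X ε)
    (i : Fin n) :
    P.map (fun ω => act (invSqrt S) (X ω i)) = stdGaussian (EuclideanSpace ℝ (Fin p)) := by
  have hm : Measurable (act (invSqrt S)) := (act (invSqrt S)).continuous.measurable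
  have h1 := (h.row_law i).map_eq
  have h2 : P.map (fun ω => act (invSqrt S) (X ω i)) =
      (P.map fun ω => X ω i).map (act (invSqrt S)) :=
    (AEMeasurable.map_map_of_aemeasurable hm.aemeasurable (h.row_law i).aemeasurable).symm
  rw [h2, h1, multivariateGaussian, Measure.map_map hm (by fun_prop)]
  have h3 : (act (invSqrt S)) ∘ (fun x => 0 + (Matrix.toEuclideanCLM (𝕜 := ℝ) (CFC.sqrt S)) x) =
      id := by
    funext x
    simp only [Function.comp_apply, zero_add, id]
    exact act_invSqrt_act_sqrt h.posDef x
  rw [h3, Measure.map_id]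

theorem RobustSelection.IsGaussianModel.aemeasurable_invSqrt_rows
    (h : IsGaussianModel P q M S βstar X ε) :
    AEMeasurable (fun ω i => act (invSqrt S) (X ω i)) P :=
  aemeasurable_pi_lambda _ fun i =>
    (act (invSqrt S)).continuous.measurable.comp_aemeasurable (h.row_law i).aemeasurable

theorem RobustSelection.IsGaussianModel.map_noise_invSqrt_rows [IsProbabilityMeasure P]
    (h : IsGaussianModel P q M S βstar X ε) :
    P.map (fun ω => (ε ω, fun i => act (invSqrt S) (X ω i))) =
      (P.map ε).prod (gaussianRows n p) := by
  have hm : Measurable (act (invSqrt S)) := (act (invSqrt S)).continuous.measurable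
  have hrow : P.map (fun ω i => act (invSqrt S) (X ω i)) = gaussianRows n p := by
    have h1 := h.rows_indep.comp (fun _ => act (invSqrt S)) (fun _ => hm)
    have h2 := (iIndepFun_iff_map_fun_eq_pi_map fun i =>
      hm.comp_aemeasurable (h.row_law i).aemeasurable).1 h1
    refine h2.trans ?_
    congr 1
    funext i
    exact h.map_invSqrt_row i
  have hm2 : Measurable fun (Y : Fin n → EuclideanSpace ℝ (Fin p)) i => act (invSqrt S) (Y i) := by
    fun_prop
  have h1 := h.noise_indep.comp measurable_id hm2
  have h2 := (indepFun_iff_map_prod_eq_prod_map_map h.noise_aemeasurable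
    h.aemeasurable_invSqrt_rows).1 h1
  refine h2.trans ?_
  rw [← hrow]

theorem RobustSelection.IsGaussianModel.standardizedData_eq_observed
    (h : IsGaussianModel P q M S βstar X ε) (ω : Ω) :
    standardizedData n S βstar (ε ω, fun i => act (invSqrt S) (X ω i)) =
      observed βstar X ε ω := by
  have h1 : (fun i => act (CFC.sqrt S) (act (invSqrt S) (X ω i))) = X ω :=
    funext fun i => act_sqrt_act_invSqrt h.posDef _
  change (design (fun i => act (CFC.sqrt S) (act (invSqrt S) (X ω i))) βstar + ε ω,
    fun i => act (CFC.sqrt S) (act (invSqrt S) (X ω i))) = _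
  rw [h1]
  rfl

/-- With high probability the squared criterion of the observed data is the squared noise plus `n`
times the out-of-sample error, up to `a * n`. -/
theorem RobustSelection.IsGaussianModel.measure_criterion_deviation_le
    [IsProbabilityMeasure P] {γ μ a t : ℝ}
    {ρ : ℝ → ℝ} {g : EuclideanSpace ℝ (Fin p) → ℝ} (h : IsGaussianModel P q M S βstar X ε)
    (hμ : 0 < μ) (hρ : IsAdmissibleLoss M ρ) (hg : IsAdmissiblePenalty μ S g) (hn : 0 < n)
    (hγ : 0 < γ) (hp : (p : ℝ) ≤ γ * n) (ha : 0 < a) {U : Set (EuclideanSpace ℝ (Fin n))}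
    (hU : MeasurableSet U) (ht : ∀ e ∈ U, ‖e‖ ^ 2 ≤ t) :
    P {ω | ε ω ∈ U ∧
      a * n < |criterion μ S ρ g (observed βstar X ε ω) ^ 2 - ‖ε ω‖ ^ 2 -
        n * outOfSampleError S βstar ρ g (observed βstar X ε ω)|} ≤
      ENNReal.ofReal (fluctuationConst γ μ (M / μ) M a * (1 / √n + t / n ^ 2)) := by
  have : IsProbabilityMeasure (P.map ε) := Measure.isProbabilityMeasure_map h.noise_aemeasurable
  have h1 := RobustSelection.measure_criterion_deviation_le (ν := P.map ε) hμ h.posDef hρ hg hn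
    hγ hp h.signal h.noise_density ha hU ht
  rw [← h.map_noise_invSqrt_rows] at h1
  -- This inequality holds for arbitrary sets, which matters as the event is not known to be
  -- measurable.
  have h2 := (Measure.le_map_apply
    (h.noise_aemeasurable.prodMk h.aemeasurable_invSqrt_rows) _).trans h1
  refine le_of_eq_of_le ?_ h2
  congr 1
  ext ω
  simp only [Set.mem_ofPred_eq, Set.mem_preimage, h.standardizedData_eq_observed]

end Model

/-! ### Control of the noise and the selection step. -/

section Noise

theorem sum_rpow_le_rpow_sum {ι : Type*} (s : Finset ι) {x : ι → ℝ} (hx : ∀ i, 0 ≤ x i) {r : ℝ}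
    (hr : 1 ≤ r) : ∑ i ∈ s, x i ^ r ≤ (∑ i ∈ s, x i) ^ r := by
  classical
  induction s using Finset.induction_on with
  | empty =>
    rw [Finset.sum_empty, Finset.sum_empty]
    exact Real.rpow_nonneg le_rfl r
  | insert i s hi ih =>
    rw [Finset.sum_insert hi, Finset.sum_insert hi]
    exact (add_le_add le_rfl ih).trans
      (Real.add_rpow_le_rpow_add (hx i) (Finset.sum_nonneg fun l _ => hx l) hr)

/-- The ℓ² norm is at most the ℓ^{1+q} norm as 1 + q ≤ 2, so the noise needs no finite variance. -/
theorem norm_sq_le_rpow_sum_rpow {n : ℕ} {q : ℝ} (hq0 : 0 ≤ q) (hq1 : q ≤ 1)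
    (e : EuclideanSpace ℝ (Fin n)) :
    ‖e‖ ^ 2 ≤ (∑ i, |e i| ^ (1 + q)) ^ (2 / (1 + q)) := by
  have hq : 0 < 1 + q := by linarith
  have h := sum_rpow_le_rpow_sum Finset.univ (x := fun i => |e i| ^ (1 + q))
    (fun i => by positivity) (r := 2 / (1 + q)) (by rw [le_div_iff₀ hq]; linarith)
  refine le_of_eq_of_le ?_ h
  rw [EuclideanSpace.real_norm_sq_eq]
  refine Finset.sum_congr rfl fun i _ => ?_
  rw [← Real.rpow_mul (abs_nonneg _), mul_div_cancel₀ _ hq.ne', Real.rpow_two, sq_abs]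

variable {Ω : Type*} [MeasurableSpace Ω] {P : Measure Ω} {n p : ℕ}
  {q M : ℝ} {S : Matrix (Fin p) (Fin p) ℝ} {βstar : EuclideanSpace ℝ (Fin p)}
  {X : Ω → Fin n → EuclideanSpace ℝ (Fin p)} {ε : Ω → EuclideanSpace ℝ (Fin n)}

theorem RobustSelection.IsGaussianModel.measure_noise_le [IsProbabilityMeasure P]
    (h : IsGaussianModel P q M S βstar X ε) (hM : 0 < M) (hn : 0 < n) {L : ℝ} (hL : 0 < L) :
    P {ω | n * M * L < ∑ i, |ε ω i| ^ (1 + q)} ≤ ENNReal.ofReal (1 / L) := by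
  have hn' : (0 : ℝ) < n := by exact_mod_cast hn
  have hi : Integrable (fun ω => ∑ i, |ε ω i| ^ (1 + q)) P :=
    integrable_finsetSum _ fun i _ => h.noise_integrable i
  have h1 := mul_meas_ge_le_integral_of_nonneg
    (ae_of_all P fun ω => Finset.sum_nonneg fun i _ => by positivity) hi (n * M * L)
  have h2 : ∫ ω, ∑ i, |ε ω i| ^ (1 + q) ∂P ≤ n * M := by
    rw [integral_finsetSum _ fun i _ => h.noise_integrable i]
    refine (Finset.sum_le_sum fun i _ => h.noise_moment i).trans_eq ?_
    simp
  have h3 : P.real {ω | n * M * L ≤ ∑ i, |ε ω i| ^ (1 + q)} ≤ 1 / L := by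
    rw [le_div_iff₀ hL]
    refine le_of_mul_le_mul_left ?_ (mul_pos hn' hM)
    linarith
  have h4 : {ω | n * M * L < ∑ i, |ε ω i| ^ (1 + q)} ⊆
      {ω | n * M * L ≤ ∑ i, |ε ω i| ^ (1 + q)} := by
    intro ω hω
    rw [Set.mem_ofPred_eq] at hω ⊢
    exact hω.le
  calc _ ≤ P {ω | n * M * L ≤ ∑ i, |ε ω i| ^ (1 + q)} := measure_mono h4
    _ = ENNReal.ofReal (P.real {ω | n * M * L ≤ ∑ i, |ε ω i| ^ (1 + q)}) :=
        (ofReal_measureReal).symm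
    _ ≤ _ := ENNReal.ofReal_le_ofReal h3

/-- If every criterion is close to the out-of-sample error, up to a common shift, then the
selected estimator is nearly optimal. -/
theorem le_iInf_add_of_abs_sub_le {ι : Type*} [Finite ι] {c v : ι → ℝ} {m a s : ℝ} (hm : 0 < m)
    {i₀ : ι} (hc : ∀ i, 0 ≤ c i) (hmin : ∀ i, c i₀ ≤ c i)
    (h : ∀ i, |c i ^ 2 - s - m * v i| ≤ a * m) : v i₀ ≤ (⨅ i, v i) + 2 * a := by
  have : Nonempty ι := ⟨i₀⟩
  obtain ⟨j, hj⟩ := exists_eq_ciInf_of_finite (f := v)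
  rw [← hj]
  have h1 := (abs_le.1 (h i₀)).1
  have h2 := (abs_le.1 (h j)).2
  have h3 : c i₀ ^ 2 ≤ c j ^ 2 := pow_le_pow_left₀ (hc i₀) (hmin j) 2
  refine le_of_mul_le_mul_left ?_ hm
  linarith

/-- A failure requires large noise or a deviation of some candidate. Markov's inequality bounds the
former by 1/L, and a union bound over the K candidates handles the latter on the complement. -/
theorem RobustSelection.IsGaussianModel.measure_selection_le [IsProbabilityMeasure P]
    {γ μ η L : ℝ} (h : IsGaussianModel P q M S βstar X ε) (hγ : 0 < γ) (hμ : 0 < μ)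
    (hq : q ∈ Set.Ioo (0 : ℝ) 1) (hM : 0 < M) (hη : 0 < η) (hL : 0 < L) (hn : 0 < n)
    (hp : (p : ℝ) ≤ γ * n) {K : ℕ} {ρ : Fin K → ℝ → ℝ} (hρ : ∀ k, IsAdmissibleLoss M (ρ k))
    {g : Fin K → EuclideanSpace ℝ (Fin p) → ℝ} (hg : ∀ k, IsAdmissiblePenalty μ S (g k))
    {khat : Ω → Fin K}
    (hkhat : ∀ ω k, criterion μ S (ρ (khat ω)) (g (khat ω)) (observed βstar X ε ω) ≤
      criterion μ S (ρ k) (g k) (observed βstar X ε ω)) :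
    P {ω | outOfSampleError S βstar (ρ (khat ω)) (g (khat ω)) (observed βstar X ε ω) >
        (⨅ k : Fin K, outOfSampleError S βstar (ρ k) (g k) (observed βstar X ε ω)) + η} ≤
      ENNReal.ofReal (1 / L) + ENNReal.ofReal (K * (fluctuationConst γ μ (M / μ) M (η / 2) *
        (1 / √n + (n * M * L) ^ (2 / (1 + q)) / n ^ 2))) := by
  have hn' : (0 : ℝ) < n := by exact_mod_cast hn
  set U : Set (EuclideanSpace ℝ (Fin n)) := {e | ∑ i, |e i| ^ (1 + q) ≤ n * M * L} with hU
  have hUm : MeasurableSet U := measurableSet_le (by fun_prop) measurable_const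
  have ht : ∀ e ∈ U, ‖e‖ ^ 2 ≤ (n * M * L) ^ (2 / (1 + q)) := fun e he =>
    (norm_sq_le_rpow_sum_rpow hq.1.le hq.2.le e).trans
      (Real.rpow_le_rpow (Finset.sum_nonneg fun i _ => by positivity) he
        (div_nonneg (by norm_num) (by linarith [hq.1])))
  set bad : Fin K → Set Ω := fun k => {ω | ε ω ∈ U ∧ η / 2 * n <
    |criterion μ S (ρ k) (g k) (observed βstar X ε ω) ^ 2 - ‖ε ω‖ ^ 2 -
      n * outOfSampleError S βstar (ρ k) (g k) (observed βstar X ε ω)|} with hbad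
  have hsub : {ω | outOfSampleError S βstar (ρ (khat ω)) (g (khat ω)) (observed βstar X ε ω) >
        (⨅ k : Fin K, outOfSampleError S βstar (ρ k) (g k) (observed βstar X ε ω)) + η} ⊆
      {ω | n * M * L < ∑ i, |ε ω i| ^ (1 + q)} ∪ ⋃ k, bad k := by
    intro ω hω
    by_contra hcon
    rw [Set.mem_union, not_or, Set.mem_iUnion, not_exists] at hcon
    obtain ⟨h1, h2⟩ := hcon
    have hωU : ε ω ∈ U := by
      rw [Set.mem_ofPred_eq, not_lt] at h1
      rw [hU, Set.mem_ofPred_eq]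
      exact h1
    -- A deviation is paid twice, for the selected candidate and for the best one; hence η / 2. The
    -- shift ‖ε‖² is the same for both.
    have h3 := le_iInf_add_of_abs_sub_le (i₀ := khat ω) (a := η / 2) hn'
      (fun k => norm_nonneg _) (hkhat ω) (fun k => not_lt.1 fun hlt => h2 k ⟨hωU, hlt⟩)
    rw [mul_div_cancel₀ _ (two_ne_zero' ℝ)] at h3
    exact absurd h3 (not_le.2 hω)
  refine (measure_mono hsub).trans ((measure_union_le _ _).trans
    (add_le_add (h.measure_noise_le hM hn hL) ?_))
  refine (measure_iUnion_fintype_le _ _).trans ((Finset.sum_le_sum fun k _ =>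
    h.measure_criterion_deviation_le hμ (hρ k) (hg k) hn hγ hp (half_pos hη) hUm ht).trans_eq ?_)
  rw [Finset.sum_const, Finset.card_univ, Fintype.card_fin, nsmul_eq_mul,
    ENNReal.ofReal_mul (Nat.cast_nonneg K), ENNReal.ofReal_natCast]

end Noise

/-! ### The rate as n tends to infinity. -/

section Limit

/-- Both terms are O(n^{-q/(1+q)}): q < 1 gives q/(1+q) ≤ 1/2, and 2/(1+q) - 2 = -2q/(1+q). -/
theorem tendsto_card_mul_rate {q : ℝ} (hq : q ∈ Set.Ioo (0 : ℝ) 1) {K : ℕ → ℕ}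
    (hK : (fun n => (K n : ℝ)) =o[atTop] fun n : ℕ => (n : ℝ) ^ (q / (1 + q))) (C : ℝ) {b : ℝ}
    (hb : 0 ≤ b) :
    Tendsto (fun n : ℕ => (K n : ℝ) * (C * (1 / √n + (n * b) ^ (2 / (1 + q)) / (n : ℝ) ^ 2)))
      atTop (𝓝 0) := by
  obtain ⟨hq0, hq1⟩ := hq
  have hq2 : 0 < 1 + q := by linarith
  have hO : (fun n : ℕ => C * (1 / √n + (n * b) ^ (2 / (1 + q)) / (n : ℝ) ^ 2)) =O[atTop]
      fun n : ℕ => (n : ℝ) ^ (-(q / (1 + q))) := by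
    refine IsBigO.of_bound (|C| * (1 + b ^ (2 / (1 + q)))) ?_
    filter_upwards [eventually_ge_atTop 1] with n hn
    have hn1 : (1 : ℝ) ≤ n := by exact_mod_cast hn
    have hn0 : (0 : ℝ) < n := by linarith
    have h1 : 1 / √(n : ℝ) ≤ (n : ℝ) ^ (-(q / (1 + q))) := by
      rw [Real.sqrt_eq_rpow, one_div, ← Real.rpow_neg hn0.le]
      refine Real.rpow_le_rpow_of_exponent_le hn1 (neg_le_neg ?_)
      rw [div_le_div_iff₀ hq2 two_pos]
      linarith
    have h2 : (n * b) ^ (2 / (1 + q)) / (n : ℝ) ^ 2 ≤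
        b ^ (2 / (1 + q)) * (n : ℝ) ^ (-(q / (1 + q))) := by
      have e : (n * b) ^ (2 / (1 + q)) / (n : ℝ) ^ 2 =
          b ^ (2 / (1 + q)) * (n : ℝ) ^ (2 / (1 + q) - 2) := by
        rw [Real.mul_rpow hn0.le hb, Real.rpow_sub hn0, Real.rpow_two]
        ring
      rw [e]
      refine mul_le_mul_of_nonneg_left ?_ (Real.rpow_nonneg hb _)
      refine Real.rpow_le_rpow_of_exponent_le hn1 ?_
      have e2 : 2 / (1 + q) - 2 = -(q / (1 + q)) - q / (1 + q) := by
        field_simp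
        ring
      have : 0 ≤ q / (1 + q) := by positivity
      linarith
    have h0 : 0 ≤ 1 / √(n : ℝ) + (n * b) ^ (2 / (1 + q)) / (n : ℝ) ^ 2 := by positivity
    rw [norm_mul, Real.norm_eq_abs, Real.norm_of_nonneg h0,
      Real.norm_of_nonneg (Real.rpow_nonneg hn0.le _), mul_assoc]
    refine mul_le_mul_of_nonneg_left ?_ (abs_nonneg C)
    linarith
  have h := hK.mul_isBigO hO
  refine ((h.congr' EventuallyEq.rfl ?_ : _ =o[atTop] fun _ : ℕ => (1 : ℝ)).tendsto_zero_of_tendsto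
    tendsto_const_nhds)
  filter_upwards [eventually_ge_atTop 1] with n hn
  have hn0 : (0 : ℝ) < n := by exact_mod_cast hn
  rw [← Real.rpow_add hn0, add_neg_cancel, Real.rpow_zero]

end Limit

theorem mainTheorem7
    (γ μ q M η : ℝ) (hγ : 0 < γ) (hμ : 0 < μ) (hq : q ∈ Set.Ioo (0 : ℝ) 1) (hM : 0 < M)
    (hη : 0 < η)
    (p : ℕ → ℕ) (hp : ∀ n, (p n : ℝ) ≤ γ * n)
    {Ω : ℕ → Type*} [∀ n, MeasurableSpace (Ω n)]
    (P : ∀ n, Measure (Ω n)) [∀ n, IsProbabilityMeasure (P n)]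
    (S : ∀ n, Matrix (Fin (p n)) (Fin (p n)) ℝ)
    (βstar : ∀ n, EuclideanSpace ℝ (Fin (p n)))
    (X : ∀ n, Ω n → Fin n → EuclideanSpace ℝ (Fin (p n)))
    (ε : ∀ n, Ω n → EuclideanSpace ℝ (Fin n))
    (hmodel : ∀ n, IsGaussianModel (P n) q M (S n) (βstar n) (X n) (ε n))
    (K : ℕ → ℕ)
    (hK : (fun n => (K n : ℝ)) =o[atTop] fun n : ℕ => (n : ℝ) ^ (q / (1 + q)))
    (ρ : ∀ n, Fin (K n) → ℝ → ℝ) (hρ : ∀ n k, IsAdmissibleLoss M (ρ n k))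
    (g : ∀ n, Fin (K n) → EuclideanSpace ℝ (Fin (p n)) → ℝ)
    (hg : ∀ n k, IsAdmissiblePenalty μ (S n) (g n k))
    (khat : ∀ n, Ω n → Fin (K n))
    (hkhat : ∀ n ω k,
      criterion μ (S n) (ρ n (khat n ω)) (g n (khat n ω)) (observed (βstar n) (X n) (ε n) ω) ≤
        criterion μ (S n) (ρ n k) (g n k) (observed (βstar n) (X n) (ε n) ω)) :
    Tendsto
      (fun n => P n {ω |
        outOfSampleError (S n) (βstar n) (ρ n (khat n ω)) (g n (khat n ω))
            (observed (βstar n) (X n) (ε n) ω) >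
          (⨅ k : Fin (K n), outOfSampleError (S n) (βstar n) (ρ n k) (g n k)
            (observed (βstar n) (X n) (ε n) ω)) + η})
      atTop (𝓝 0) := by
  refine ENNReal.tendsto_nhds_zero.2 fun δ hδ => ?_
  obtain ⟨δ', hδ0, hδ'⟩ : ∃ δ' : ℝ, 0 < δ' ∧ ENNReal.ofReal (2 * δ') ≤ δ := by
    obtain ⟨r, hr0, hr⟩ := ENNReal.lt_iff_exists_nnreal_btwn.1 hδ
    refine ⟨r / 2, by simpa using hr0, ?_⟩
    rw [mul_div_cancel₀ _ (two_ne_zero' ℝ), ENNReal.ofReal_coe_nnreal]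
    exact hr.le
  -- With L = 1/δ' the large noise event costs δ' uniformly in n; L stays fixed while n grows and
  -- makes the other term at most δ'.
  have hL : 0 < 1 / δ' := by positivity
  have hlim := tendsto_card_mul_rate hq hK (fluctuationConst γ μ (M / μ) M (η / 2))
    (mul_pos hM hL).le
  filter_upwards [hlim.eventually_le_const hδ0, eventually_gt_atTop 0] with n h1 h2
  refine ((hmodel n).measure_selection_le hγ hμ hq hM hη hL h2 (hp n) (hρ n) (hg n)
    (hkhat n)).trans (le_trans ?_ hδ')
  rw [← mul_assoc] at h1
  rw [two_mul, ENNReal.ofReal_add hδ0.le hδ0.le]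
  refine add_le_add (ENNReal.ofReal_le_ofReal (by simp)) (ENNReal.ofReal_le_ofReal ?_)
  simpa only [mul_assoc] using h1
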